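/- **Setting.** For sequences $f:\mathbf Z\to\mathbf R$ put $\delta^+f(j)=f(j+1)-f(j)$, $\delta^-f(j)=f(j)-f(j-1)$, $S^\pm f(j)=f(j\pm1)$, and write $\|f,g\|_{\ell^2}=\|f\|_{\ell^2}+\|g\|_{\ell^2}$. For functions on $\mathbf R$ let $$\|F\|_{H^7(1)}^2=\int_{\mathbf R}(1+X^2)F^2\,dX+\int_{\mathbf R}(1+X^2)(\partial_X^7F)^2\,dX$$ (weak derivatives). Let $\mathcal V(q)=\frac12q^2+\frac13q^3$. **Masses (transparency hypothesis).** $m(j)=1+\delta^+\delta^-\zeta(j)$, where $\zeta(j)$, $j\in\mathbf Z$, are i.i.d. random variables with mean zero, variance $\sigma^2$ and (closed) support contained in $(-1/4,1/4)$. **KdV solutions.** Let $T_0>0$ and let $A(w,T)$, $B(l,T)$ be good solutions of KdV on $[-T_0,T_0]$, that is, classical solutions for $|T|\le T_0$ of $$2\partial_TA+\left(\tfrac1{12}+2\sigma^2\right)\partial_w^3A+\partial_w(A^2)=0,\qquad 2\partial_TB-\left(\tfrac1{12}+2\sigma^2\right)\partial_l^3B-\partial_l(B^2)=0$$ with $0<\sup_{|T|\le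 T_0}\big(\|A(\cdot,T)\|_{H^7(1)}+\|B(\cdot,T)\|_{H^7(1)}\big)<\infty$. **Autoregressive processes.** For each $\epsilon\in(0,1)$ let $\gamma_1,\gamma_2:\mathbf Z\to\mathbf R$ (depending on $\epsilon$ and on the realization of $\zeta$) satisfy $\gamma_1(0)=\gamma_2(0)=0$ and $$\delta^+\gamma_1=-\epsilon\,\mathrm{sgn}(j)\gamma_1-(\zeta+S^+\zeta),\qquad \delta^-\gamma_2=-\epsilon\,\mathrm{sgn}(j)\gamma_2+\left(\zeta+S^-\zeta+\zeta\,\delta^+\delta^-\zeta+2\sigma^2\right).$$ **Extended KdV approximators.** Put $\mathcal A(w,T)=\int_0^wA(y,T)\,dy$, $\mathcal B(l,T)=\int_0^lB(y,T)\,dy$, $$A_2=\tfrac14\left[\left(\tfrac14-2\sigma^2\right)\partial_l^2B-\left(2\,\partial_wA\,\mathcal B+2AB+B^2\right)\right],\qquad B_2=\tfrac14\left[\left(\tfrac14-2\sigma^2\right)\partial_w^2A-\left(A^2+2AB+2\mathcal A\,\partial_lB\right)\right],$$ and, with $w=X-\tau$, $l=X+\tau$, $$Q_0=A+B,\quad P_0=-A+B,\quad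 Q_1=\tfrac12\partial_XQ_0+\delta^+\zeta\,\partial_\tau P_0,\quad P_1=0,$$ $$Q_2=A_2+B_2-\zeta\,\partial_X^2Q_0,\quad P_2=-A_2+B_2+\zeta\,\partial_X^2P_0,$$ $$Q_3=\left(\gamma_2+\tfrac12\zeta\right)\partial_X^3Q_0-\delta^+\zeta\,\partial_X(Q_0^2)+\delta^+\zeta\left(\partial_TP_0-\partial_\tau A_2+\partial_\tau B_2\right),\quad P_3=\gamma_1\,\partial_X^3P_0,$$ $$\tilde q_\epsilon(j,t)=\sum_{n=0}^3\epsilon^{n+2}Q_n(j,\epsilon j,\epsilon t,\epsilon^3t),\qquad \tilde p_\epsilon(j,t)=\sum_{n=0}^3\epsilon^{n+2}P_n(j,\epsilon j,\epsilon t,\epsilon^3t).$$ Let $\mathrm{Res}_1=\delta^+\tilde p_\epsilon-\partial_t\tilde q_\epsilon$, $\mathrm{Res}_2=\frac1m\delta^-[\mathcal V'(\tilde q_\epsilon)]-\partial_t\tilde p_\epsilon$ and $$\alpha_1(\epsilon)=\sup_{|t|\le T_0/\epsilon^3}\|\tilde q_\epsilon,\tilde p_\epsilon\|_{\ell^2},\qquad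 \beta_1(\epsilon)=\inf_{|t|\le T_0/\epsilon^3}\|\tilde q_\epsilon,\tilde p_\epsilon\|_{\ell^2},$$ $$\alpha_2(\epsilon)=\sup_{|t|\le T_0/\epsilon^3}\|\partial_t\tilde q_\epsilon\|_{\ell^\infty},\qquad \alpha_3(\epsilon)=\sup_{|t|\le T_0/\epsilon^3}\left(\|\mathrm{Res}_1\|_{\ell^2}+\|\mathrm{Res}_2\|_{\ell^2}\right).$$ Derivatives in $T$ and $t$ at the endpoints of $[-T_0,T_0]$ and $[-T_0/\epsilon^3,T_0/\epsilon^3]$ are one-sided. **Proposition.** Almost surely, $\tilde q_\epsilon(j,\cdot)$ and $\tilde p_\epsilon(j,\cdot)$ are differentiable on $[-T_0/\epsilon^3,T_0/\epsilon^3]$ for all $\epsilon\in(0,1)$ and $j\in\mathbf Z$, and $$\alpha_1(\epsilon)=O(\epsilon^{3/2}),\qquad\alpha_2(\epsilon)=O(\epsilon^3),\qquad\alpha_3(\epsilon)=O\!\left(\epsilon^5\sqrt{|\ln\epsilon|}\right),\qquad\beta_1(\epsilon)^{-1}=O(\epsilon^{-3/2}).$$ Here $f(\epsilon)=O(g(\epsilon))$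 means that there are $C_\star,\epsilon_\star>0$, which may depend on the realization of $\zeta$, with $|f(\epsilon)|\le C_\star|g(\epsilon)|$ for all $\epsilon\in(0,\epsilon_\star)$. -/

import Mathlib

open MeasureTheory ProbabilityTheory Set
open scoped ENNReal

noncomputable section

namespace TransparentFPUT

/-! Sequences on the integers -/

/-- Right finite difference. -/
def deltaPlus (f : ℤ → ℝ) (j : ℤ) : ℝ := f (j + 1) - f j

/-- Left finite difference. -/
def deltaMinus (f : ℤ → ℝ) (j : ℤ) : ℝ := f j - f (j - 1)

/-- The `ℓ²` norm, with value `∞` for sequences that are not square summable. -/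
def ell2Norm (f : ℤ → ℝ) : ℝ≥0∞ := (∑' j, ‖f j‖ₑ ^ 2) ^ (1 / 2 : ℝ)

/-- The `ℓ^∞` norm, with value `∞` for unbounded sequences. -/
def ellInftyNorm (f : ℤ → ℝ) : ℝ≥0∞ := ⨆ j, ‖f j‖ₑ

/-! Weighted Sobolev norms on the line -/

/-- `G` is the weak (distributional) first derivative of `F` on the line. -/
def IsWeakDeriv (F G : ℝ → ℝ) : Prop :=
  LocallyIntegrable F ∧ LocallyIntegrable G ∧
    ∀ φ : ℝ → ℝ, ContDiff ℝ ((⊤ : ℕ∞) : WithTop ℕ∞) φ → HasCompactSupport φ →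
      ∫ x, F x * deriv φ x = - ∫ x, G x * φ x

/-- `G` is the weak derivative of order `n` of `F` on the line. -/
def IsIterWeakDeriv : ℕ → (ℝ → ℝ) → (ℝ → ℝ) → Prop
  | 0, F, G => LocallyIntegrable F ∧ F =ᵐ[volume] G
  | n + 1, F, G => ∃ H : ℝ → ℝ, IsIterWeakDeriv n F H ∧ IsWeakDeriv H G

/-- The norm of the weighted Sobolev space `H^n(r)`,
`(∫ (1 + X²)^r F² + ∫ (1 + X²)^r (∂ⁿF)²)^(1/2)`. The weak derivative of order `n` is unique up to
null sets when it exists, so the infimum only selects it; the norm is `∞` if there is none or if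
one of the integrals diverges, that is, if `F` is not in `H^n(r)`. -/
def sobolevNorm (n r : ℕ) (F : ℝ → ℝ) : ℝ≥0∞ :=
  ⨅ (G : ℝ → ℝ) (_ : IsIterWeakDeriv n F G),
    ((∫⁻ X, ENNReal.ofReal ((1 + X ^ 2) ^ r * F X ^ 2)) +
      ∫⁻ X, ENNReal.ofReal ((1 + X ^ 2) ^ r * G X ^ 2)) ^ (1 / 2 : ℝ)

/-! The lattice -/

/-- The spring potential. -/
def springPotential (q : ℝ) : ℝ := 1 / 2 * q ^ 2 + 1 / 3 * q ^ 3

/-- The transparent mass coefficients `m = 1 + δ⁺δ⁻ζ`. -/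
def mass (ζ : ℤ → ℝ) (j : ℤ) : ℝ := 1 + deltaPlus (deltaMinus ζ) j

/-- The `ζ(j)` are i.i.d. with mean zero, variance `σ²` and (closed) support of their law
contained in the open interval `(-1/4, 1/4)`. -/
structure IsTransparentNoise {Ω : Type*} [MeasurableSpace Ω] (P : Measure Ω)
    (ζ : ℤ → Ω → ℝ) (σ : ℝ) : Prop where
  measurable : ∀ j, Measurable (ζ j)
  indep : iIndepFun ζ P
  identDistrib : ∀ i j, IdentDistrib (ζ i) (ζ j) P P
  mean_zero : ∀ j, ∫ ω, ζ j ω ∂P = 0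
  variance_eq : ∀ j, variance (ζ j) P = σ ^ 2
  support_subset : ∀ j, (P.map (ζ j)).support ⊆ Ioo (-(1 / 4)) (1 / 4)

/-! The KdV equations. Functions of the slow time are only considered for `T ∈ [-T₀, T₀]`, with
one-sided time derivatives at the endpoints. -/

/-- The derivative in the slow time `T`, relative to the interval `[-T₀, T₀]`. -/
def slowDeriv (T₀ : ℝ) (f : ℝ → ℝ) (T : ℝ) : ℝ := derivWithin f (Icc (-T₀) T₀) T

/-- `A` is a classical solution on `[-T₀, T₀]` of
`2 ∂_T A + (1/12 + 2σ²) ∂_w³ A + ∂_w A² = 0`. -/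
def IsKdVSolutionA (σ T₀ : ℝ) (A : ℝ → ℝ → ℝ) : Prop :=
  ∀ T ∈ Icc (-T₀) T₀, ContDiff ℝ 3 (fun w => A w T) ∧ ∀ w,
    DifferentiableWithinAt ℝ (fun s => A w s) (Icc (-T₀) T₀) T ∧
    2 * slowDeriv T₀ (fun s => A w s) T
      + (1 / 12 + 2 * σ ^ 2) * iteratedDeriv 3 (fun y => A y T) w
      + deriv (fun y => A y T ^ 2) w = 0

/-- `B` is a classical solution on `[-T₀, T₀]` of
`2 ∂_T B - (1/12 + 2σ²) ∂_l³ B - ∂_l B² = 0`. -/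
def IsKdVSolutionB (σ T₀ : ℝ) (B : ℝ → ℝ → ℝ) : Prop :=
  ∀ T ∈ Icc (-T₀) T₀, ContDiff ℝ 3 (fun l => B l T) ∧ ∀ l,
    DifferentiableWithinAt ℝ (fun s => B l s) (Icc (-T₀) T₀) T ∧
    2 * slowDeriv T₀ (fun s => B l s) T
      - (1 / 12 + 2 * σ ^ 2) * iteratedDeriv 3 (fun y => B y T) l
      - deriv (fun y => B y T ^ 2) l = 0

/-- Good solutions of KdV on `[-T₀, T₀]`. -/
structure IsGoodKdV (σ T₀ : ℝ) (A B : ℝ → ℝ → ℝ) : Prop where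
  kdvA : IsKdVSolutionA σ T₀ A
  kdvB : IsKdVSolutionB σ T₀ B
  nontrivial : 0 < ⨆ T ∈ Icc (-T₀) T₀,
    (sobolevNorm 7 1 (fun w => A w T) + sobolevNorm 7 1 (fun l => B l T))
  bounded : (⨆ T ∈ Icc (-T₀) T₀,
    (sobolevNorm 7 1 (fun w => A w T) + sobolevNorm 7 1 (fun l => B l T))) < ∞

/-! The autoregressive processes -/

/-- `γ₁` solves `δ⁺γ₁ = -ε sgn(j) γ₁ - (ζ + S⁺ζ)` and starts from `γ₁(0) = 0`. -/
def IsAutoregressive₁ (ε : ℝ) (ζ γ₁ : ℤ → ℝ) : Prop :=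
  γ₁ 0 = 0 ∧ ∀ j : ℤ,
    deltaPlus γ₁ j = -ε * (Int.sign j : ℝ) * γ₁ j - (ζ j + ζ (j + 1))

/-- `γ₂` solves `δ⁻γ₂ = -ε sgn(j) γ₂ + (ζ + S⁻ζ + ζ δ⁺δ⁻ζ + 2σ²)` and starts from
`γ₂(0) = 0`. -/
def IsAutoregressive₂ (σ ε : ℝ) (ζ γ₂ : ℤ → ℝ) : Prop :=
  γ₂ 0 = 0 ∧ ∀ j : ℤ,
    deltaMinus γ₂ j = -ε * (Int.sign j : ℝ) * γ₂ j
      + (ζ j + ζ (j - 1) + ζ j * deltaPlus (deltaMinus ζ) j + 2 * σ ^ 2)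

/-! The terms of the expansion, as functions of `(j, X, τ, T)`, where `w = X - τ`, `l = X + τ` -/

/-- The antiderivative in space that vanishes at the origin. -/
def antideriv (F : ℝ → ℝ → ℝ) (x T : ℝ) : ℝ := ∫ y in (0 : ℝ)..x, F y T

/-- `A₂(w, l, T)`. -/
def A₂ (σ : ℝ) (A B : ℝ → ℝ → ℝ) (w l T : ℝ) : ℝ :=
  1 / 4 * ((1 / 4 - 2 * σ ^ 2) * iteratedDeriv 2 (fun y => B y T) l
    - (2 * deriv (fun y => A y T) w * antideriv B l T + 2 * A w T * B l T + B l T ^ 2))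

/-- `B₂(w, l, T)`. -/
def B₂ (σ : ℝ) (A B : ℝ → ℝ → ℝ) (w l T : ℝ) : ℝ :=
  1 / 4 * ((1 / 4 - 2 * σ ^ 2) * iteratedDeriv 2 (fun y => A y T) w
    - (A w T ^ 2 + 2 * A w T * B l T + 2 * antideriv A w T * deriv (fun y => B y T) l))

def Q₀ (A B : ℝ → ℝ → ℝ) (X τ T : ℝ) : ℝ := A (X - τ) T + B (X + τ) T

def P₀ (A B : ℝ → ℝ → ℝ) (X τ T : ℝ) : ℝ := -A (X - τ) T + B (X + τ) T

def Q₁ (A B : ℝ → ℝ → ℝ) (ζ : ℤ → ℝ) (j : ℤ) (X τ T : ℝ) : ℝ :=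
  1 / 2 * deriv (fun X' => Q₀ A B X' τ T) X + deltaPlus ζ j * deriv (fun τ' => P₀ A B X τ' T) τ

def P₁ (_j : ℤ) (_X _τ _T : ℝ) : ℝ := 0

def Q₂ (σ : ℝ) (A B : ℝ → ℝ → ℝ) (ζ : ℤ → ℝ) (j : ℤ) (X τ T : ℝ) : ℝ :=
  A₂ σ A B (X - τ) (X + τ) T + B₂ σ A B (X - τ) (X + τ) T
    - ζ j * iteratedDeriv 2 (fun X' => Q₀ A B X' τ T) X

def P₂ (σ : ℝ) (A B : ℝ → ℝ → ℝ) (ζ : ℤ → ℝ) (j : ℤ) (X τ T : ℝ) : ℝ :=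
  -A₂ σ A B (X - τ) (X + τ) T + B₂ σ A B (X - τ) (X + τ) T
    + ζ j * iteratedDeriv 2 (fun X' => P₀ A B X' τ T) X

def Q₃ (σ T₀ : ℝ) (A B : ℝ → ℝ → ℝ) (ζ γ₂ : ℤ → ℝ) (j : ℤ) (X τ T : ℝ) : ℝ :=
  (γ₂ j + 1 / 2 * ζ j) * iteratedDeriv 3 (fun X' => Q₀ A B X' τ T) X
    - deltaPlus ζ j * deriv (fun X' => Q₀ A B X' τ T ^ 2) X
    + deltaPlus ζ j * (slowDeriv T₀ (fun T' => P₀ A B X τ T') T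
        - deriv (fun τ' => A₂ σ A B (X - τ') (X + τ') T) τ
        + deriv (fun τ' => B₂ σ A B (X - τ') (X + τ') T) τ)

def P₃ (A B : ℝ → ℝ → ℝ) (γ₁ : ℤ → ℝ) (j : ℤ) (X τ T : ℝ) : ℝ :=
  γ₁ j * iteratedDeriv 3 (fun X' => P₀ A B X' τ T) X

/-- The extended KdV approximator `q̃_ε(j, t)`. -/
def qApprox (σ T₀ : ℝ) (A B : ℝ → ℝ → ℝ) (ζ γ₂ : ℤ → ℝ) (ε : ℝ) (j : ℤ) (t : ℝ) : ℝ :=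
  ε ^ 2 * Q₀ A B (ε * j) (ε * t) (ε ^ 3 * t)
    + ε ^ 3 * Q₁ A B ζ j (ε * j) (ε * t) (ε ^ 3 * t)
    + ε ^ 4 * Q₂ σ A B ζ j (ε * j) (ε * t) (ε ^ 3 * t)
    + ε ^ 5 * Q₃ σ T₀ A B ζ γ₂ j (ε * j) (ε * t) (ε ^ 3 * t)

/-- The extended KdV approximator `p̃_ε(j, t)`. -/
def pApprox (σ : ℝ) (A B : ℝ → ℝ → ℝ) (ζ γ₁ : ℤ → ℝ) (ε : ℝ) (j : ℤ) (t : ℝ) : ℝ :=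
  ε ^ 2 * P₀ A B (ε * j) (ε * t) (ε ^ 3 * t)
    + ε ^ 3 * P₁ j (ε * j) (ε * t) (ε ^ 3 * t)
    + ε ^ 4 * P₂ σ A B ζ j (ε * j) (ε * t) (ε ^ 3 * t)
    + ε ^ 5 * P₃ A B γ₁ j (ε * j) (ε * t) (ε ^ 3 * t)

/-! Residuals and the quantities that measure the approximators. Here `q p : ℤ → ℝ → ℝ` are
approximators for one value of `ε`. -/

/-- The time interval `|t| ≤ T₀ / ε³`. -/
def timeInterval (T₀ ε : ℝ) : Set ℝ := Icc (-(T₀ / ε ^ 3)) (T₀ / ε ^ 3)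

/-- The time derivative on the interval `|t| ≤ T₀ / ε³` (one-sided at the endpoints). -/
def timeDeriv (T₀ ε : ℝ) (u : ℤ → ℝ → ℝ) (j : ℤ) (t : ℝ) : ℝ :=
  derivWithin (u j) (timeInterval T₀ ε) t

/-- `Res₁ = δ⁺p̃ - ∂ₜq̃`. -/
def res₁ (T₀ ε : ℝ) (q p : ℤ → ℝ → ℝ) (j : ℤ) (t : ℝ) : ℝ :=
  deltaPlus (fun i => p i t) j - timeDeriv T₀ ε q j t

/-- `Res₂ = m⁻¹ δ⁻[V'(q̃)] - ∂ₜp̃`. -/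
def res₂ (T₀ ε : ℝ) (m : ℤ → ℝ) (q p : ℤ → ℝ → ℝ) (j : ℤ) (t : ℝ) : ℝ :=
  1 / m j * deltaMinus (fun i => deriv springPotential (q i t)) j - timeDeriv T₀ ε p j t

def alpha₁ (T₀ ε : ℝ) (q p : ℤ → ℝ → ℝ) : ℝ≥0∞ :=
  ⨆ t ∈ timeInterval T₀ ε, (ell2Norm (fun j => q j t) + ell2Norm (fun j => p j t))

def beta₁ (T₀ ε : ℝ) (q p : ℤ → ℝ → ℝ) : ℝ≥0∞ :=
  ⨅ t ∈ timeInterval T₀ ε, (ell2Norm (fun j => q j t) + ell2Norm (fun j => p j t))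

def alpha₂ (T₀ ε : ℝ) (q : ℤ → ℝ → ℝ) : ℝ≥0∞ :=
  ⨆ t ∈ timeInterval T₀ ε, ellInftyNorm (fun j => timeDeriv T₀ ε q j t)

def alpha₃ (T₀ ε : ℝ) (m : ℤ → ℝ) (q p : ℤ → ℝ → ℝ) : ℝ≥0∞ :=
  ⨆ t ∈ timeInterval T₀ ε,
    (ell2Norm (fun j => res₁ T₀ ε q p j t) + ell2Norm (fun j => res₂ T₀ ε m q p j t))

/-- `f(ε) = O(g(ε))` as `ε → 0⁺`; in particular `f(ε)` is finite for small `ε > 0`. -/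
def IsBigOZero (f : ℝ → ℝ≥0∞) (g : ℝ → ℝ) : Prop :=
  ∃ C > 0, ∃ ε₀ > 0, ∀ ε ∈ Ioo (0 : ℝ) ε₀, f ε ≤ ENNReal.ofReal (C * |g ε|)

end TransparentFPUT

end

open TransparentFPUT

/-! The expansion is built so that both residuals are `ε⁶` times a function dominated by `(1 + |γ₁|
+ |γ₂|)` times a majorant of the two waves near the site. Orders `ε³` and `ε⁴` cancel because `Q₀`,
`P₀` solve the wave equation and because the `ζ` terms of `Q₁`, `Q₂`, `P₂` reproduce the random
mass. At order `ε⁵` the random coefficients of `∂_X³P₀` and `∂_X³Q₀` are removed by `δ⁺γ₁` and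
`δ⁻γ₂`; the damping `ε sgn(j) γ` that this introduces is of order `ε⁶`. The product `ζ δ⁺δ⁻ζ` has
mean `-2σ²`, so the drive of `γ₂` is centred only after adding `2σ²`, and this is compensated by the
`2σ²` in the KdV dispersion. What is left at order `ε⁵` is deterministic and vanishes by the KdV
equations and the choice of `A₂`, `B₂`: these are `corr_identity₁` and `corr_identity₂`.

The size of `γ₁`, `γ₂` is the probabilistic point. Bounded centred variables are sub-Gaussian, so by
Borel–Cantelli over all integer intervals `[m, n)` the sums of the drive are `O(√((n - m) log(2 +
|m| + |n|)))` almost surely (`ControlledSums`). The constant depends on the realization but not on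
`ε`. A recursion with damping rate at least `ε/2` then satisfies `γ(j)² = O(log(2 + 2|j|)/ε)`
(`abs_le_of_autoregressive`). The waves sit near `|j| ≤ T₀/ε³`, where the logarithm is `O(|ln ε|)`;
farther away its growth is absorbed by the weight `1 + X²` of `H⁷(1)`. An `ℓ²` norm over the sites
`εj` costs a factor `ε^(-1/2)`, and `ε⁶ · (|ln ε|/ε)^(1/2) · ε^(-1/2)` is the bound for `α₃`.

On the analytic side, `H⁷(1)` gives six classical derivatives, bounded on unit cells by a sequence
that is square summable with weight `1 + n²`, and a sixth derivative that is Hölder of exponent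
`1/2`. Time derivatives of three space derivatives use all six. No joint smoothness in space and
time is assumed; commuting derivatives and the chain rule along characteristics rest on that Hölder
bound.

For the other quantities the crude bound `εγ = O(1)` suffices, since `ε⁵γ` is then `O(ε⁴)`. The
leading term `ε²(±A + B)` gives `α₁`, and its `τ` derivative gives `α₂`. For `β₁`, the sum of `q̃² +
p̃²` is compared with `ε³ ∫ (A² + B²)` by a Riemann sum, and this integral is positive uniformly in
time because KdV conserves the `L²` norm. -/

section
open Filter Topology
open scoped NNReal

/-! ### Weak derivatives and their continuous representatives -/

theorem MeasureTheory.LocallyIntegrable.intervalIntegrable' {G : ℝ → ℝ} (hG : LocallyIntegrable G)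
    (a b : ℝ) : IntervalIntegrable G volume a b :=
  (hG.integrableOn_isCompact isCompact_uIcc).intervalIntegrable

/-- The primitive started to the left of the support is constant to its right, with value the total
integral, which is zero. -/
theorem exists_primitive_hasCompactSupport {θ : ℝ → ℝ}
    (hθ : ContDiff ℝ ((⊤ : ℕ∞) : WithTop ℕ∞) θ) (hc : HasCompactSupport θ)
    (h0 : ∫ x, θ x = 0) :
    ∃ φ : ℝ → ℝ, ContDiff ℝ ((⊤ : ℕ∞) : WithTop ℕ∞) φ ∧ HasCompactSupport φ ∧ deriv φ = θ := by
  obtain ⟨R, hR⟩ := hc.isCompact.isBounded.subset_ball 0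
  rw [Real.ball_eq_Ioo] at hR
  simp only [zero_sub, zero_add] at hR
  have hz : ∀ x, x ∉ Ioo (-R) R → θ x = 0 := fun x hx =>
    image_eq_zero_of_notMem_tsupport (fun h => hx (hR h))
  have hd : ∀ x, HasDerivAt (fun x => ∫ t in (-R)..x, θ t) (θ x) x := fun x =>
    hθ.continuous.integral_hasStrictDerivAt (-R) x |>.hasDerivAt
  have hderiv : deriv (fun x => ∫ t in (-R)..x, θ t) = θ := by
    ext x; exact (hd x).deriv
  refine ⟨fun x => ∫ t in (-R)..x, θ t, ?_, ?_, hderiv⟩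
  · rw [contDiff_infty_iff_deriv]
    exact ⟨fun x => (hd x).differentiableAt, by rw [hderiv]; exact hθ⟩
  · refine HasCompactSupport.intro (isCompact_Icc (a := -R) (b := R)) ?_
    intro x hx
    simp only [mem_Icc, not_and_or, not_le] at hx
    have hRx : ∀ a b : ℝ, (∀ t ∈ uIoc a b, t ∉ Ioo (-R) R) → ∫ t in a..b, θ t = 0 := by
      intro a b hab
      rw [intervalIntegral.integral_congr_ae (g := fun _ => (0 : ℝ))]
      · simp
      · exact ae_of_all _ fun t ht => hz t (hab t ht)
    rcases hx with hx | hx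
    · apply hRx
      intro t ht
      rw [uIoc_comm, uIoc_of_le hx.le] at ht
      simp only [mem_Ioo, not_and_or, not_lt]; left; exact ht.2
    · by_cases hRR : -R ≤ R
      · have hsupp : Function.support θ ⊆ Ioc (-R) R := fun t ht => by
          by_contra h
          exact ht (hz t fun h' => h (Ioo_subset_Ioc_self h'))
        have h1 := intervalIntegral.integral_eq_integral_of_support_subset (μ := volume) hsupp
        have h2 := intervalIntegral.integral_add_adjacent_intervals
          (hθ.continuous.intervalIntegrable (μ := volume) (-R) R)
          (hθ.continuous.intervalIntegrable (μ := volume) R x)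
        rw [← h2, h1, h0, zero_add]
        apply hRx
        intro t ht
        rw [uIoc_of_le hx.le] at ht
        simp only [mem_Ioo, not_and_or, not_lt]; right; exact ht.1.le
      · apply hRx
        intro t _
        simp only [mem_Ioo]
        rintro ⟨h1, h2⟩
        exact hRR (h1.trans h2).le

/-- A primitive of a locally integrable function is absolutely continuous on bounded intervals,
hence can be integrated by parts; Lebesgue differentiation identifies its derivative almost
everywhere. -/
theorem integral_primitive_mul_deriv {G φ : ℝ → ℝ} (hG : LocallyIntegrable G)
    (hφ : ContDiff ℝ ((⊤ : ℕ∞) : WithTop ℕ∞) φ) (hc : HasCompactSupport φ) :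
    ∫ x, (∫ t in (0 : ℝ)..x, G t) * deriv φ x = - ∫ x, G x * φ x := by
  obtain ⟨R', hR'⟩ := hc.isCompact.isBounded.subset_ball 0
  rw [Real.ball_eq_Ioo] at hR'
  set R := max R' 1
  have hR0 : 0 < R := lt_of_lt_of_le one_pos (le_max_right _ _)
  have hR : tsupport φ ⊆ Ioo (-R) R := hR'.trans (Ioo_subset_Ioo (by simp [R]) (by simp [R]))
  have hz : ∀ x, x ∉ Ioo (-R) R → φ x = 0 := fun x hx =>
    image_eq_zero_of_notMem_tsupport (fun h => hx (hR h))
  have s1 : Function.support (fun x => (∫ t in (0 : ℝ)..x, G t) * deriv φ x) ⊆ Ioc (-R) R := by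
    intro x hx
    have : deriv φ x ≠ 0 := right_ne_zero_of_mul hx
    exact Ioo_subset_Ioc_self (hR (support_deriv_subset this))
  have s2 : Function.support (fun x => G x * φ x) ⊆ Ioc (-R) R := by
    intro x hx
    by_contra h
    exact right_ne_zero_of_mul hx (hz x fun h' => h (Ioo_subset_Ioc_self h'))
  rw [← intervalIntegral.integral_eq_integral_of_support_subset s1,
    ← intervalIntegral.integral_eq_integral_of_support_subset s2]
  have hGi : IntervalIntegrable G volume (-R) R := hG.intervalIntegrable' _ _
  have hac := hGi.absolutelyContinuousOnInterval_intervalIntegral (c := 0)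
    (by rw [uIcc_of_le (by linarith)]; constructor <;> linarith)
  have hφac : AbsolutelyContinuousOnInterval φ (-R) R :=
    ContDiffOn.absolutelyContinuousOnInterval (hφ.of_le (by simp)).contDiffOn
  rw [hac.integral_mul_deriv_eq_deriv_mul hφac, hz R (by simp), hz (-R) (by simp)]
  simp only [mul_zero, sub_zero, zero_sub, neg_inj]
  apply intervalIntegral.integral_congr_ae
  filter_upwards [LocallyIntegrable.ae_hasDerivAt_integral hG] with x hx _
  rw [(hx 0).deriv]

/-- A function with a weak derivative is almost everywhere a primitive of it. -/
theorem TransparentFPUT.IsWeakDeriv.ae_eq_primitive {H G : ℝ → ℝ} (h : IsWeakDeriv H G) :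
    ∃ c, ∀ᵐ x, H x = c + ∫ t in (0 : ℝ)..x, G t := by
  obtain ⟨hH, hG, hw⟩ := h
  have hIc : Continuous (fun x => ∫ t in (0 : ℝ)..x, G t) :=
    intervalIntegral.continuous_primitive (fun a b => hG.intervalIntegrable' a b) 0
  set D : ℝ → ℝ := fun x => H x - ∫ t in (0 : ℝ)..x, G t with hD
  have hDl : LocallyIntegrable D := hH.sub hIc.locallyIntegrable
  have hint : ∀ {F φ : ℝ → ℝ}, LocallyIntegrable F → Continuous φ → HasCompactSupport φ →
      Integrable (fun x => F x * φ x) := by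
    intro F φ hF hφ hc
    have := hF.integrable_smul_left_of_hasCompactSupport hφ hc
    simpa [mul_comm] using this
  have hD0 : ∀ φ : ℝ → ℝ, ContDiff ℝ ((⊤ : ℕ∞) : WithTop ℕ∞) φ → HasCompactSupport φ →
      ∫ x, D x * deriv φ x = 0 := by
    intro φ hφ hc
    have hdc : Continuous (deriv φ) := hφ.continuous_deriv (by simp)
    have := integral_sub (hint hH hdc hc.deriv) (hint hIc.locallyIntegrable hdc hc.deriv)
    simp only [hD, sub_mul]
    rw [this, hw φ hφ hc, integral_primitive_mul_deriv hG hφ hc, sub_self]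
  -- The du Bois-Reymond argument: `ψ` minus its integral times a unit bump is the derivative of a
  -- test function, so `D` pairs with `ψ` as the constant `∫ D φ₀` does.
  let b : ContDiffBump (0 : ℝ) := ⟨1, 2, one_pos, by norm_num⟩
  set φ₀ : ℝ → ℝ := b.normed volume with hφ₀
  have h₀s : ContDiff ℝ ((⊤ : ℕ∞) : WithTop ℕ∞) φ₀ := b.contDiff_normed
  have h₀c : HasCompactSupport φ₀ := b.hasCompactSupport_normed
  have h₀i : ∫ x, φ₀ x = 1 := b.integral_normed
  refine ⟨∫ x, D x * φ₀ x, ?_⟩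
  set c := ∫ x, D x * φ₀ x with hcdef
  have key : ∀ᵐ x, D x = c := by
    apply ae_eq_of_integral_contDiff_smul_eq hDl (locallyIntegrable_const c)
    intro ψ hψ hψc
    have hψi : Integrable ψ := hψ.continuous.integrable_of_hasCompactSupport hψc
    have h₀int : Integrable φ₀ := h₀s.continuous.integrable_of_hasCompactSupport h₀c
    set k := ∫ x, ψ x
    obtain ⟨φ, h1, h2, h3⟩ := exists_primitive_hasCompactSupport (θ := fun x => ψ x - k * φ₀ x)
      (hψ.sub (contDiff_const.mul h₀s)) (hψc.sub (h₀c.mul_left))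
      (by rw [integral_sub hψi (h₀int.const_mul k), integral_const_mul, h₀i, mul_one, sub_self])
    have h4 := hD0 φ h1 h2
    rw [h3] at h4
    have h5 : ∫ x, D x * (ψ x - k * φ₀ x) = (∫ x, D x * ψ x) - k * c := by
      rw [hcdef, ← integral_const_mul, ← integral_sub (hint hDl hψ.continuous hψc)
        ((hint hDl h₀s.continuous h₀c).const_mul k)]
      congr 1; ext x; ring
    rw [h5] at h4
    simp only [smul_eq_mul, integral_mul_const]
    rw [← sub_eq_zero.mp h4]
    congr 1; ext x; ring
  filter_upwards [key] with x hx
  rw [← hx, hD]; ring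

/-- The continuous representatives of a function with a weak derivative of order `n + 1`. -/
theorem TransparentFPUT.IsIterWeakDeriv.exists_chain {n : ℕ} {F G : ℝ → ℝ}
    (h : IsIterWeakDeriv (n + 1) F G) :
    LocallyIntegrable G ∧ ∃ u : ℕ → ℝ → ℝ, F =ᵐ[volume] u 0 ∧
      (∀ k < n, ∀ x, HasDerivAt (u k) (u (k + 1) x) x) ∧
      ∃ c, ∀ x, u n x = c + ∫ t in (0 : ℝ)..x, G t := by
  induction n generalizing G with
  | zero =>
    obtain ⟨H, ⟨hF, hFH⟩, hHG⟩ := h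
    obtain ⟨c, hc⟩ := hHG.ae_eq_primitive
    exact ⟨hHG.2.1, fun _ x => c + ∫ t in (0 : ℝ)..x, G t, hFH.trans hc, by simp, c, fun x => rfl⟩
  | succ n ih =>
    obtain ⟨H, hFH, hHG⟩ := h
    obtain ⟨c, hc⟩ := hHG.ae_eq_primitive
    obtain ⟨hH, u, hu0, hud, c', hc'⟩ := ih hFH
    have hwc : Continuous (fun x => c + ∫ t in (0 : ℝ)..x, G t) :=
      continuous_const.add
        (intervalIntegral.continuous_primitive (fun a b => hHG.2.1.intervalIntegrable' a b) 0)
    set w : ℝ → ℝ := fun x => c + ∫ t in (0 : ℝ)..x, G t with hw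
    -- The former top function is a primitive of `H`, and `H` agrees almost everywhere with the
    -- continuous `w`; so it gains a classical derivative.
    have hun : ∀ x, HasDerivAt (u n) (w x) x := by
      have : u n = fun x => c' + ∫ t in (0 : ℝ)..x, w t := by
        ext x
        rw [hc' x]
        congr 1
        exact intervalIntegral.integral_congr_ae (hc.mono fun t ht _ => ht)
      intro x
      rw [this]
      exact ((hwc.integral_hasStrictDerivAt 0 x).hasDerivAt).const_add c'
    refine ⟨hHG.2.1, fun k => if k ≤ n then u k else w, by simpa using hu0, ?_, c, ?_⟩
    · intro k hk x
      rcases Nat.lt_succ_iff_lt_or_eq.mp hk with hk' | rfl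
      · simpa [hk'.le, Nat.succ_le_of_lt hk'] using hud k hk' x
      · simpa using hun x
    · intro x; simp [hw]

/-! ### Local and weighted Sobolev bounds -/

/-- Induction on the order. The `n`-th derivative is small at a point of the first third and at a
point of the last third; these are at least `L/3` apart, so the mean value theorem yields a point
between them where the next derivative is small. -/
theorem exists_abs_le_sqrt_integral (n : ℕ) {L : ℝ} (hL : 0 < L) :
    ∃ C, 0 ≤ C ∧ ∀ (a : ℝ) (u : ℕ → ℝ → ℝ), (∀ k < n, ∀ x, HasDerivAt (u k) (u (k + 1) x) x) →
      Continuous (u 0) →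
      ∃ ξ ∈ Icc a (a + L), |u n ξ| ≤ C * √(∫ x in a..(a + L), u 0 x ^ 2) := by
  induction n generalizing L with
  | zero =>
    refine ⟨1 / √L, by positivity, fun a u _ hu => ?_⟩
    obtain ⟨ξ, hξ, hmin⟩ := (isCompact_Icc (a := a) (b := a + L)).exists_isMinOn
      ⟨a, by simp [hL.le]⟩ (hu.pow 2).continuousOn
    refine ⟨ξ, hξ, ?_⟩
    have h1 : ∫ x in a..(a + L), u 0 ξ ^ 2 ≤ ∫ x in a..(a + L), u 0 x ^ 2 :=
      intervalIntegral.integral_mono_on (by linarith) (by simp)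
        ((hu.pow 2).intervalIntegrable _ _) fun x hx => hmin hx
    rw [intervalIntegral.integral_const, add_sub_cancel_left, smul_eq_mul] at h1
    have h2 := Real.sqrt_le_sqrt h1
    rw [Real.sqrt_mul hL.le, Real.sqrt_sq_eq_abs] at h2
    rw [one_div, ← div_eq_inv_mul, le_div_iff₀ (by positivity), mul_comm]
    exact h2
  | succ n ih =>
    obtain ⟨C, hC0, hC⟩ := ih (L := L / 3) (by positivity)
    refine ⟨2 * C / (L / 3), by positivity, fun a u hu hu0 => ?_⟩
    have hsub : ∀ b, a ≤ b → b + L / 3 ≤ a + L →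
        √(∫ x in b..(b + L / 3), u 0 x ^ 2) ≤ √(∫ x in a..(a + L), u 0 x ^ 2) := by
      intro b hb hb'
      refine Real.sqrt_le_sqrt (intervalIntegral.integral_mono_interval hb (by linarith) hb'
        (ae_of_all _ fun x => by positivity) ((hu0.pow 2).intervalIntegrable _ _))
    obtain ⟨x, hx, hxu⟩ := hC a u (fun k hk => hu k (hk.trans (Nat.lt_succ_self n))) hu0
    obtain ⟨y, hy, hyu⟩ := hC (a + 2 * L / 3) u
      (fun k hk => hu k (hk.trans (Nat.lt_succ_self n))) hu0
    have h1 := hsub a le_rfl (by linarith)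
    have h2 := hsub (a + 2 * L / 3) (by linarith) (by linarith)
    have hxy : x < y := by have := hx.2; have := hy.1; linarith
    obtain ⟨ξ, hξ, hξu⟩ := exists_hasDerivAt_eq_slope (u n) (u (n + 1)) hxy
      (fun z _ => (hu n (Nat.lt_succ_self n) z).continuousAt.continuousWithinAt)
      (fun z _ => hu n (Nat.lt_succ_self n) z)
    refine ⟨ξ, ⟨hx.1.trans hξ.1.le, hξ.2.le.trans (by linarith [hy.2])⟩, ?_⟩
    set S := √(∫ x in a..(a + L), u 0 x ^ 2)
    have hS : 0 ≤ S := Real.sqrt_nonneg _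
    have hgap : L / 3 ≤ y - x := by have := hx.2; have := hy.1; linarith
    rw [hξu, abs_div, abs_of_pos (by linarith : (0 : ℝ) < y - x), div_le_iff₀ (by linarith)]
    have h3 : |u n y - u n x| ≤ 2 * C * S := by
      calc _ ≤ |u n y| + |u n x| := abs_sub _ _
        _ ≤ C * S + C * S := add_le_add (hyu.trans (by gcongr)) (hxu.trans (by gcongr))
        _ = _ := by ring
    calc _ ≤ 2 * C * S := h3
      _ = 2 * C / (L / 3) * S * (L / 3) := by field_simp
      _ ≤ _ := by gcongr

/-- Cauchy–Schwarz, from the discriminant of the nonnegative quadratic `l ↦ ∫ (l - G)²`. -/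
theorem abs_integral_le_sqrt_mul_sqrt {G : ℝ → ℝ} {a b : ℝ} (hab : a ≤ b)
    (hG : IntervalIntegrable G volume a b)
    (hG2 : IntervalIntegrable (fun x => G x ^ 2) volume a b) :
    |∫ x in a..b, G x| ≤ √(b - a) * √(∫ x in a..b, G x ^ 2) := by
  have hnn : ∀ l : ℝ, 0 ≤ (b - a) * (l * l) + (-2 * ∫ x in a..b, G x) * l
      + ∫ x in a..b, G x ^ 2 := by
    intro l
    have h : 0 ≤ ∫ x in a..b, (l * l - 2 * l * G x + G x ^ 2) :=
      intervalIntegral.integral_nonneg hab fun x _ => by nlinarith [sq_nonneg (l - G x)]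
    rw [intervalIntegral.integral_add ((by simp : IntervalIntegrable _ _ _ _).sub (hG.const_mul _)) hG2, intervalIntegral.integral_sub (by simp)
      (hG.const_mul _), intervalIntegral.integral_const, intervalIntegral.integral_const_mul,
      smul_eq_mul] at h
    linarith
  have hd := discrim_le_zero hnn
  rw [discrim] at hd
  rw [← Real.sqrt_mul (by linarith)]
  apply Real.abs_le_sqrt
  nlinarith

/-- A function with six classical derivatives and a seventh one in `L²_loc`. -/
structure IsSobolevChain (u : ℕ → ℝ → ℝ) (G : ℝ → ℝ) : Prop where
  hasDerivAt : ∀ k < 6, ∀ x, HasDerivAt (u k) (u (k + 1) x) x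
  sub_eq : ∀ x y, u 6 y - u 6 x = ∫ t in x..y, G t
  int : LocallyIntegrable G
  int_sq : LocallyIntegrable (fun x => G x ^ 2)

namespace IsSobolevChain

theorem continuous_zero {u : ℕ → ℝ → ℝ} {G : ℝ → ℝ} (h : IsSobolevChain u G) :
    Continuous (u 0) :=
  continuous_iff_continuousAt.mpr fun x => (h.hasDerivAt 0 (by norm_num) x).continuousAt

theorem abs_top_sub_le {u : ℕ → ℝ → ℝ} {G : ℝ → ℝ} (h : IsSobolevChain u G) {a b x y : ℝ}
    (hx : x ∈ Icc a b) (hy : y ∈ Icc a b) :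
    |u 6 y - u 6 x| ≤ √|y - x| * √(∫ t in a..b, G t ^ 2) := by
  wlog hxy : x ≤ y generalizing x y
  · have := this hy hx (le_of_not_ge hxy)
    rwa [abs_sub_comm, abs_sub_comm y x]
  rw [h.sub_eq, abs_of_nonneg (sub_nonneg.mpr hxy)]
  refine (abs_integral_le_sqrt_mul_sqrt hxy (h.int.intervalIntegrable' _ _)
    (h.int_sq.intervalIntegrable' _ _)).trans ?_
  gcongr
  exact intervalIntegral.integral_mono_interval hx.1 hxy hy.2
    (ae_of_all _ fun x => by positivity) (h.int_sq.intervalIntegrable' _ _)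

/-- Downward induction from order six. Each derivative is small at one point of the unit interval,
and its oscillation there is controlled by the derivative above it, or by `G` at the top order. -/
theorem exists_sup_bound : ∃ C, 0 ≤ C ∧ ∀ (u : ℕ → ℝ → ℝ) (G : ℝ → ℝ), IsSobolevChain u G →
    ∀ a, ∀ k ≤ 6, ∀ x ∈ Icc a (a + 1),
      |u k x| ≤ C * (√(∫ t in a..(a + 1), u 0 t ^ 2) + √(∫ t in a..(a + 1), G t ^ 2)) := by
  have step : ∀ i ≤ 6, ∃ D, 0 ≤ D ∧ ∀ (u : ℕ → ℝ → ℝ) (G : ℝ → ℝ), IsSobolevChain u G →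
      ∀ a, ∀ x ∈ Icc a (a + 1), |u (6 - i) x| ≤
        D * (√(∫ t in a..(a + 1), u 0 t ^ 2) + √(∫ t in a..(a + 1), G t ^ 2)) := by
    intro i hi
    induction i with
    | zero =>
      obtain ⟨C, hC0, hC⟩ := exists_abs_le_sqrt_integral 6 (L := 1) one_pos
      refine ⟨C + 1, by positivity, fun u G h a x hx => ?_⟩
      obtain ⟨ξ, hξ, hb⟩ := hC a u h.hasDerivAt h.continuous_zero
      have h1 := h.abs_top_sub_le hξ hx
      have h2 : √|x - ξ| ≤ 1 := by
        rw [Real.sqrt_le_one]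
        rw [abs_le]; constructor <;> linarith [hx.1, hx.2, hξ.1, hξ.2]
      set N := √(∫ t in a..(a + 1), u 0 t ^ 2)
      set D := √(∫ t in a..(a + 1), G t ^ 2)
      have hN : 0 ≤ N := Real.sqrt_nonneg _
      have hD : 0 ≤ D := Real.sqrt_nonneg _
      have h3 : |u 6 x| ≤ |u 6 x - u 6 ξ| + |u 6 ξ| := by
        simpa using abs_add_le (u 6 x - u 6 ξ) (u 6 ξ)
      have h4 : √|x - ξ| * D ≤ D := by nlinarith
      simp only [Nat.sub_zero]
      nlinarith
    | succ i ih =>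
      obtain ⟨D', hD'0, hD'⟩ := ih (by omega)
      obtain ⟨C, hC0, hC⟩ := exists_abs_le_sqrt_integral (6 - (i + 1)) (L := 1) one_pos
      refine ⟨C + D', by positivity, fun u G h a x hx => ?_⟩
      obtain ⟨ξ, hξ, hb⟩ := hC a u (fun k hk => h.hasDerivAt k (by omega)) h.continuous_zero
      have hk : 6 - (i + 1) + 1 = 6 - i := by omega
      have hder : ∀ y ∈ Icc a (a + 1), HasDerivWithinAt (u (6 - (i + 1))) (u (6 - i) y)
          (Icc a (a + 1)) y := fun y _ => by
        have := h.hasDerivAt (6 - (i + 1)) (by omega) y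
        rw [hk] at this
        exact this.hasDerivWithinAt
      have h1 := (convex_Icc a (a + 1)).norm_image_sub_le_of_norm_hasDerivWithin_le hder
        (fun y hy => hD' u G h a y hy) hξ hx
      simp only [Real.norm_eq_abs] at h1
      set N := √(∫ t in a..(a + 1), u 0 t ^ 2)
      set D := √(∫ t in a..(a + 1), G t ^ 2)
      have hN : 0 ≤ N := Real.sqrt_nonneg _
      have hD : 0 ≤ D := Real.sqrt_nonneg _
      have h2 : |x - ξ| ≤ 1 := by
        rw [abs_le]; constructor <;> linarith [hx.1, hx.2, hξ.1, hξ.2]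
      have h3 : |u (6 - (i + 1)) x| ≤
          |u (6 - (i + 1)) x - u (6 - (i + 1)) ξ| + |u (6 - (i + 1)) ξ| := by
        simpa using abs_add_le (u (6 - (i + 1)) x - u (6 - (i + 1)) ξ) (u (6 - (i + 1)) ξ)
      have h4 : D' * (N + D) * |x - ξ| ≤ D' * (N + D) :=
        mul_le_of_le_one_right (by positivity) h2
      nlinarith
  choose! D hD0 hD using step
  refine ⟨∑ i ∈ Finset.range 7, D i, Finset.sum_nonneg fun i hi =>
    hD0 i (by simpa [Nat.lt_succ_iff] using hi), fun u G h a k hk x hx => ?_⟩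
  have h1 := hD (6 - k) (by omega) u G h a x hx
  rw [show 6 - (6 - k) = k by omega] at h1
  refine h1.trans ?_
  gcongr
  exact Finset.single_le_sum (f := D) (fun i hi => hD0 i (by simpa [Nat.lt_succ_iff] using hi))
    (by simp; omega)

/-- The local bound is applied on each cell `[n, n + 1]`, where `1 + n² ≤ 3(1 + x²)`; the squares of
the cell norms add up to the weighted integrals over the line. -/
theorem exists_envelope : ∃ C, 0 < C ∧ ∀ (u : ℕ → ℝ → ℝ) (G : ℝ → ℝ), IsSobolevChain u G →
    Integrable (fun x => (1 + x ^ 2) * u 0 x ^ 2) → Integrable (fun x => (1 + x ^ 2) * G x ^ 2) →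
    ∃ g : ℤ → ℝ, (∀ n, 0 ≤ g n) ∧ Summable (fun n : ℤ => (1 + (n : ℝ) ^ 2) * g n ^ 2) ∧
      ∑' n : ℤ, (1 + (n : ℝ) ^ 2) * g n ^ 2 ≤
        C * ((∫ x, (1 + x ^ 2) * u 0 x ^ 2) + ∫ x, (1 + x ^ 2) * G x ^ 2) ∧
      ∀ k ≤ 6, ∀ x, |u k x| ≤ g ⌊x⌋ := by
  obtain ⟨C, hC0, hC⟩ := exists_sup_bound
  refine ⟨6 * C ^ 2 + 1, by positivity, fun u G h hu hG => ?_⟩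
  set N : ℤ → ℝ := fun n => √(∫ t in (n : ℝ)..(n + 1), u 0 t ^ 2)
  set D : ℤ → ℝ := fun n => √(∫ t in (n : ℝ)..(n + 1), G t ^ 2)
  have hsu := hu.hasSum_intervalIntegral 0
  have hsG := hG.hasSum_intervalIntegral 0
  simp only [zero_add] at hsu hsG
  set g : ℤ → ℝ := fun n => C * (N n + D n) with hg
  have hloc : ∀ f : ℝ → ℝ, LocallyIntegrable (fun x => f x ^ 2) →
      Integrable (fun x => (1 + x ^ 2) * f x ^ 2) → ∀ n : ℤ,
      (1 + (n : ℝ) ^ 2) * √(∫ t in (n : ℝ)..(n + 1), f t ^ 2) ^ 2 ≤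
        3 * ∫ t in (n : ℝ)..(n + 1), (1 + t ^ 2) * f t ^ 2 := by
    intro f hf hf' n
    rw [Real.sq_sqrt (intervalIntegral.integral_nonneg (by linarith) fun x _ => by positivity),
      ← intervalIntegral.integral_const_mul, ← intervalIntegral.integral_const_mul]
    apply intervalIntegral.integral_mono_on (by linarith)
      ((hf.intervalIntegrable' _ _).const_mul _) (hf'.intervalIntegrable.const_mul _)
    intro x hx
    have : 1 + (n : ℝ) ^ 2 ≤ 3 * (1 + x ^ 2) := by
      nlinarith [hx.1, hx.2, sq_nonneg (x + (x - n))]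
    nlinarith [sq_nonneg (f x)]
  have hle : ∀ n : ℤ, (1 + (n : ℝ) ^ 2) * g n ^ 2 ≤ 6 * C ^ 2 *
      ((∫ t in (n : ℝ)..(n + 1), (1 + t ^ 2) * u 0 t ^ 2)
        + ∫ t in (n : ℝ)..(n + 1), (1 + t ^ 2) * G t ^ 2) := by
    intro n
    have h1 := hloc (u 0) (h.continuous_zero.pow 2).locallyIntegrable hu n
    have h2 := hloc G h.int_sq hG n
    have h3 : g n ^ 2 ≤ 2 * C ^ 2 * (N n ^ 2 + D n ^ 2) := by
      rw [hg]; nlinarith [mul_nonneg (sq_nonneg C) (sq_nonneg (N n - D n))]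
    calc (1 + (n : ℝ) ^ 2) * g n ^ 2
        ≤ (1 + (n : ℝ) ^ 2) * (2 * C ^ 2 * (N n ^ 2 + D n ^ 2)) := by gcongr
      _ = 2 * C ^ 2 * ((1 + (n : ℝ) ^ 2) * N n ^ 2 + (1 + (n : ℝ) ^ 2) * D n ^ 2) := by ring
      _ ≤ 2 * C ^ 2 * (3 * (∫ t in (n : ℝ)..(n + 1), (1 + t ^ 2) * u 0 t ^ 2) +
          3 * ∫ t in (n : ℝ)..(n + 1), (1 + t ^ 2) * G t ^ 2) := by gcongr
      _ = _ := by ring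
  have hS := (hsu.add hsG).mul_left (6 * C ^ 2)
  have hsum : Summable (fun n : ℤ => (1 + (n : ℝ) ^ 2) * g n ^ 2) :=
    Summable.of_nonneg_of_le (fun n => by positivity) hle hS.summable
  refine ⟨g, fun n => by positivity, hsum, ?_, ?_⟩
  · refine (hasSum_le hle hsum.hasSum hS).trans ?_
    have h1 : 0 ≤ ∫ x, (1 + x ^ 2) * u 0 x ^ 2 := integral_nonneg fun x => by positivity
    have h2 : 0 ≤ ∫ x, (1 + x ^ 2) * G x ^ 2 := integral_nonneg fun x => by positivity
    nlinarith
  · intro k hk x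
    exact hC u G h ⌊x⌋ k hk x ⟨Int.floor_le x, (Int.lt_floor_add_one x).le⟩

end IsSobolevChain

theorem hasDerivAt_iteratedDeriv_of_chain {n : ℕ} {u : ℕ → ℝ → ℝ}
    (h : ∀ k < n, ∀ x, HasDerivAt (u k) (u (k + 1) x) x) :
    ∀ k ≤ n, iteratedDeriv k (u 0) = u k := by
  intro k hk
  induction k with
  | zero => simp
  | succ k ih =>
    rw [iteratedDeriv_succ, ih (by omega)]
    ext x
    exact (h k (by omega) x).deriv

theorem integrable_of_lintegral_ofReal_lt {f : ℝ → ℝ} (hf : AEStronglyMeasurable f)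
    (h0 : ∀ x, 0 ≤ f x) {c : ℝ} (hc : 0 ≤ c) (h : ∫⁻ x, ENNReal.ofReal (f x) ≤ ENNReal.ofReal c) :
    Integrable f ∧ ∫ x, f x ≤ c := by
  have hi : Integrable f := by
    refine ⟨hf, ?_⟩
    rw [hasFiniteIntegral_iff_ofReal (ae_of_all _ h0)]
    exact h.trans_lt ENNReal.ofReal_lt_top
  refine ⟨hi, ?_⟩
  rwa [← ofReal_integral_eq_lintegral_ofReal hi (ae_of_all _ h0),
    ENNReal.ofReal_le_ofReal_iff hc] at h

/-- The consequences of a bound in the weighted Sobolev space `H⁷(1)` for a continuous function. -/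
theorem exists_envelope_of_sobolevNorm_lt : ∃ C, 0 < C ∧ ∀ (F : ℝ → ℝ) (K : ℝ), 0 < K →
    Continuous F → sobolevNorm 7 1 F < ENNReal.ofReal K →
    (∀ k < 6, ∀ x, HasDerivAt (iteratedDeriv k F) (iteratedDeriv (k + 1) F x) x) ∧
    (∃ g : ℤ → ℝ, (∀ n, 0 ≤ g n) ∧ Summable (fun n : ℤ => (1 + (n : ℝ) ^ 2) * g n ^ 2) ∧
      ∑' n : ℤ, (1 + (n : ℝ) ^ 2) * g n ^ 2 ≤ C * K ^ 2 ∧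
      ∀ k ≤ 6, ∀ x, |iteratedDeriv k F x| ≤ g ⌊x⌋) ∧
    (∀ x y, |iteratedDeriv 6 F x - iteratedDeriv 6 F y| ≤ K * √|x - y|) ∧
    Integrable (fun x => (1 + x ^ 2) * F x ^ 2) ∧ ∫ x, (1 + x ^ 2) * F x ^ 2 ≤ K ^ 2 := by
  obtain ⟨C, hC0, hC⟩ := IsSobolevChain.exists_envelope
  refine ⟨2 * C, by positivity, fun F K hK hF hlt => ?_⟩
  rw [sobolevNorm] at hlt
  simp only [iInf_lt_iff] at hlt
  obtain ⟨G, hG, hlt⟩ := hlt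
  obtain ⟨hGl, u, hu0, hud, c, hc⟩ := hG.exists_chain
  have huc : Continuous (u 0) :=
    continuous_iff_continuousAt.mpr fun x => (hud 0 (by norm_num) x).continuousAt
  -- Two continuous functions that agree almost everywhere agree everywhere, so the chain consists
  -- of the classical derivatives of `F` itself.
  have hFu : F = u 0 := (hF.ae_eq_iff_eq volume huc).mp hu0
  have hit : ∀ k ≤ 6, iteratedDeriv k F = u k := by
    rw [hFu]; exact hasDerivAt_iteratedDeriv_of_chain hud
  simp only [pow_one] at hlt
  have hsum : (∫⁻ X, ENNReal.ofReal ((1 + X ^ 2) * F X ^ 2)) +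
      ∫⁻ X, ENNReal.ofReal ((1 + X ^ 2) * G X ^ 2) ≤ ENNReal.ofReal (K ^ 2) := by
    have := ENNReal.rpow_le_rpow hlt.le (by norm_num : (0 : ℝ) ≤ 2)
    rw [← ENNReal.rpow_mul] at this
    norm_num at this
    rwa [ENNReal.ofReal_pow hK.le]
  obtain ⟨hFi, hFK⟩ := integrable_of_lintegral_ofReal_lt
    (f := fun x => (1 + x ^ 2) * F x ^ 2) (by fun_prop) (fun x => by positivity) (sq_nonneg K)
    (le_self_add.trans hsum)
  have hGm : AEStronglyMeasurable G := hGl.aestronglyMeasurable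
  obtain ⟨hGi, hGK⟩ := integrable_of_lintegral_ofReal_lt
    (f := fun x => (1 + x ^ 2) * G x ^ 2)
    ((by fun_prop : AEStronglyMeasurable (fun x : ℝ => 1 + x ^ 2)).mul (hGm.pow 2))
    (fun x => by positivity) (sq_nonneg K) (le_add_self.trans hsum)
  have hmono : ∀ f : ℝ → ℝ, AEStronglyMeasurable f →
      Integrable (fun x => (1 + x ^ 2) * f x ^ 2) → Integrable (fun x => f x ^ 2) := by
    intro f hf hfi
    refine hfi.mono' (hf.pow 2) (ae_of_all _ fun x => ?_)
    rw [Real.norm_of_nonneg (by positivity)]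
    nlinarith [mul_nonneg (sq_nonneg x) (sq_nonneg (f x))]
  have hG2 := hmono G hGm hGi
  have hch : IsSobolevChain u G := by
    refine ⟨hud, fun x y => ?_, hGl, hG2.locallyIntegrable⟩
    rw [hc, hc, add_sub_add_left_eq_sub, intervalIntegral.integral_interval_sub_left
      (hGl.intervalIntegrable' _ _) (hGl.intervalIntegrable' _ _)]
  refine ⟨fun k hk x => ?_, ?_, fun x y => ?_, hFi, hFK⟩
  · rw [hit k hk.le, hit (k + 1) hk]; exact hud k hk x
  · obtain ⟨g, h0, hs, ht, hb⟩ := hC u G hch (by rw [← hFu]; exact hFi) hGi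
    refine ⟨g, h0, hs, ht.trans ?_, fun k hk x => by rw [hit k hk]; exact hb k hk x⟩
    rw [← hFu, mul_comm 2 C, mul_assoc]
    gcongr
    linarith
  · rw [hit 6 le_rfl]
    have h1 := hch.abs_top_sub_le (a := min x y) (b := max x y) (x := y) (y := x)
      ⟨min_le_right _ _, le_max_right _ _⟩ ⟨min_le_left _ _, le_max_left _ _⟩
    refine h1.trans ?_
    rw [mul_comm]
    gcongr
    apply Real.sqrt_le_iff.mpr ⟨hK.le, ?_⟩
    rw [intervalIntegral.integral_of_le (min_le_max)]
    calc _ ≤ ∫ x, G x ^ 2 := setIntegral_le_integral hG2 (ae_of_all _ fun x => by positivity)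
      _ ≤ ∫ x, (1 + x ^ 2) * G x ^ 2 := integral_mono hG2 hGi fun x => by
          nlinarith [mul_nonneg (sq_nonneg x) (sq_nonneg (G x))]
      _ ≤ K ^ 2 := hGK

/-! ### Sums over the scaled lattice -/

theorem summable_comp_of_card_fiber_le {w : ℤ → ℝ} (hw : ∀ n, 0 ≤ w n) (hs : Summable w)
    {φ : ℤ → ℤ} {N : ℝ} (hN : ∀ (s : Finset ℤ) n, ((s.filter (φ · = n)).card : ℝ) ≤ N) :
    Summable (fun j => w (φ j)) ∧ ∑' j, w (φ j) ≤ N * ∑' n, w n := by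
  have hN0 : 0 ≤ N := by simpa using hN ∅ 0
  have hfin : ∀ s : Finset ℤ, ∑ j ∈ s, w (φ j) ≤ N * ∑' n, w n := by
    intro s
    rw [Finset.sum_comp w φ]
    calc ∑ n ∈ s.image φ, (s.filter (φ · = n)).card • w n
        ≤ ∑ n ∈ s.image φ, N * w n := Finset.sum_le_sum fun n _ => by
          rw [nsmul_eq_mul]; exact mul_le_mul_of_nonneg_right (hN s n) (hw n)
      _ = N * ∑ n ∈ s.image φ, w n := by rw [Finset.mul_sum]
      _ ≤ N * ∑' n, w n := by gcongr; exact hs.sum_le_tsum _ fun n _ => hw n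
  exact ⟨summable_of_sum_le (fun j => hw _) hfin,
    Real.tsum_le_of_sum_le (fun j => hw _) hfin⟩

/-- These sites fill a half-open interval of length `1/ε`, which contains fewer than `1/ε + 1 ≤ 2/ε`
integers. -/
theorem card_filter_floor_eq_le (ε s : ℝ) (hε : 0 < ε) (hε1 : ε ≤ 1) (S : Finset ℤ) (n : ℤ) :
    ((S.filter (fun j : ℤ => ⌊ε * j - s⌋ = n)).card : ℝ) ≤ 2 / ε := by
  set a := (n + s) / ε
  have hsub : S.filter (fun j : ℤ => ⌊ε * j - s⌋ = n) ⊆ Finset.Ico ⌈a⌉ ⌈a + 1 / ε⌉ := by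
    intro j hj
    simp only [Finset.mem_filter, Int.floor_eq_iff] at hj
    obtain ⟨_, h1, h2⟩ := hj
    rw [Finset.mem_Ico, Int.ceil_le, Int.lt_ceil]
    constructor
    · rw [div_le_iff₀ hε]; linarith
    · rw [← add_div, lt_div_iff₀ hε]; linarith
  have h1 : ((S.filter (fun j : ℤ => ⌊ε * j - s⌋ = n)).card : ℝ) ≤
      ((Finset.Ico ⌈a⌉ ⌈a + 1 / ε⌉).card : ℝ) := by exact_mod_cast Finset.card_le_card hsub
  refine h1.trans ?_
  have h01 : 1 ≤ 1 / ε := by rwa [one_le_div hε]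
  have hle : ⌈a⌉ ≤ ⌈a + 1 / ε⌉ := Int.ceil_mono (by linarith)
  rw [Int.card_Ico]
  have h2 : (((⌈a + 1 / ε⌉ - ⌈a⌉).toNat : ℤ) : ℝ) = (⌈a + 1 / ε⌉ : ℝ) - ⌈a⌉ := by
    rw [Int.toNat_of_nonneg (by linarith)]; push_cast; ring
  have h3 : (((⌈a + 1 / ε⌉ - ⌈a⌉).toNat : ℕ) : ℝ) = (⌈a + 1 / ε⌉ : ℝ) - ⌈a⌉ := by
    rw [← h2]; norm_cast
  rw [h3]
  have h4 := Int.ceil_lt_add_one (a + 1 / ε)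
  have h5 := Int.le_ceil a
  have : 2 / ε = 1 / ε + 1 / ε := by ring
  linarith

/-- The majorant of a function at all points of distance at most one, from its majorants on the
unit cells. -/
noncomputable def cellMajorant (g : ℤ → ℝ) (x : ℝ) : ℝ := g (⌊x⌋ - 1) + g ⌊x⌋ + g (⌊x⌋ + 1)

theorem cellMajorant_nonneg {g : ℤ → ℝ} (hg : ∀ n, 0 ≤ g n) (x : ℝ) : 0 ≤ cellMajorant g x :=
  add_nonneg (add_nonneg (hg _) (hg _)) (hg _)

theorem le_cellMajorant {g : ℤ → ℝ} (hg : ∀ n, 0 ≤ g n) {x y : ℝ} (h : |y - x| ≤ 1) :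
    g ⌊y⌋ ≤ cellMajorant g x := by
  rw [abs_le] at h
  have h1 : ⌊x⌋ - 1 ≤ ⌊y⌋ := by
    rw [Int.le_floor]; push_cast; linarith [Int.floor_le x]
  have h2 : ⌊y⌋ < ⌊x⌋ + 2 := by
    rw [Int.floor_lt]; push_cast; linarith [Int.lt_floor_add_one x]
  have h3 : ⌊y⌋ = ⌊x⌋ - 1 ∨ ⌊y⌋ = ⌊x⌋ ∨ ⌊y⌋ = ⌊x⌋ + 1 := by omega
  have := hg (⌊x⌋ - 1)
  have := hg ⌊x⌋
  have := hg (⌊x⌋ + 1)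
  rw [cellMajorant]
  rcases h3 with h | h | h <;> rw [h] <;> linarith

theorem weight_mul_sq_le_aux {x n : ℝ} (h1 : n ≤ x) (h2 : x ≤ n + 1) (a b c : ℝ) :
    (1 + x ^ 2) * (a + b + c) ^ 2 ≤
      27 * ((1 + (n - 1) ^ 2) * a ^ 2 + (1 + n ^ 2) * b ^ 2 + (1 + (n + 1) ^ 2) * c ^ 2) := by
  have h3 : 1 + x ^ 2 ≤ 3 * (1 + n ^ 2) := by nlinarith [sq_nonneg (n - (x - n))]
  have h4 : (a + b + c) ^ 2 ≤ 3 * (a ^ 2 + b ^ 2 + c ^ 2) := by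
    nlinarith [sq_nonneg (a - b), sq_nonneg (a - c), sq_nonneg (b - c)]
  have h5 : 1 + n ^ 2 ≤ 3 * (1 + (n - 1) ^ 2) := by nlinarith [sq_nonneg (2 * n - 3)]
  have h6 : 1 + n ^ 2 ≤ 3 * (1 + (n + 1) ^ 2) := by nlinarith [sq_nonneg (2 * n + 3)]
  calc (1 + x ^ 2) * (a + b + c) ^ 2
      ≤ (3 * (1 + n ^ 2)) * (3 * (a ^ 2 + b ^ 2 + c ^ 2)) := by gcongr
    _ = 9 * ((1 + n ^ 2) * a ^ 2 + (1 + n ^ 2) * b ^ 2 + (1 + n ^ 2) * c ^ 2) := by ring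
    _ ≤ 9 * ((3 * (1 + (n - 1) ^ 2)) * a ^ 2 + (3 * (1 + n ^ 2)) * b ^ 2
          + (3 * (1 + (n + 1) ^ 2)) * c ^ 2) := by
        gcongr
        nlinarith [sq_nonneg n]
    _ = _ := by ring

/-- The constant is `27 · 3 · 2`: the factor of `weight_mul_sq_le_aux`, three neighbouring cells,
and at most `2/ε` sites in each cell. -/
theorem sum_cellMajorant {g : ℤ → ℝ}
    (hs : Summable (fun n : ℤ => (1 + (n : ℝ) ^ 2) * g n ^ 2)) {ε : ℝ} (hε : 0 < ε) (hε1 : ε ≤ 1)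
    (s : ℝ) :
    Summable (fun j : ℤ => (1 + (ε * j - s) ^ 2) * cellMajorant g (ε * j - s) ^ 2) ∧
    ∑' j : ℤ, (1 + (ε * j - s) ^ 2) * cellMajorant g (ε * j - s) ^ 2 ≤
      162 * (∑' n : ℤ, (1 + (n : ℝ) ^ 2) * g n ^ 2) / ε := by
  set w : ℤ → ℝ := fun n => (1 + (n : ℝ) ^ 2) * g n ^ 2 with hw
  have hw0 : ∀ n, 0 ≤ w n := fun n => by positivity
  set φ : ℤ → ℤ := fun j => ⌊ε * j - s⌋
  have hshift : ∀ r : ℤ, Summable (fun j => w (φ j + r)) ∧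
      ∑' j, w (φ j + r) ≤ 2 / ε * ∑' n, w n := by
    intro r
    have h := summable_comp_of_card_fiber_le (w := fun n => w (n + r)) (fun n => hw0 _)
      ((Equiv.addRight r).summable_iff.mpr hs) (φ := φ) (N := 2 / ε)
      (fun S n => card_filter_floor_eq_le ε s hε hε1 S n)
    rwa [show ∑' n, w (n + r) = ∑' n, w n from (Equiv.addRight r).tsum_eq w] at h
  have hle : ∀ j : ℤ, (1 + (ε * j - s) ^ 2) * cellMajorant g (ε * j - s) ^ 2 ≤
      27 * (w (φ j + (-1)) + w (φ j + 0) + w (φ j + 1)) := by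
    intro j
    have := weight_mul_sq_le_aux (Int.floor_le (ε * j - s)) (Int.lt_floor_add_one (ε * j - s)).le
      (g (⌊ε * j - s⌋ - 1)) (g ⌊ε * j - s⌋) (g (⌊ε * j - s⌋ + 1))
    simpa [hw, φ, cellMajorant, ← sub_eq_add_neg] using this
  have hS : Summable fun j : ℤ => 27 * (w (φ j + (-1)) + w (φ j + 0) + w (φ j + 1)) :=
    (((hshift (-1)).1.add (hshift 0).1).add (hshift 1).1).mul_left 27
  have hsum := Summable.of_nonneg_of_le (fun j : ℤ => by positivity) hle hS
  refine ⟨hsum, (hsum.tsum_le_tsum hle hS).trans ?_⟩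
  rw [tsum_mul_left, ((hshift (-1)).1.add (hshift 0).1).tsum_add (hshift 1).1,
    (hshift (-1)).1.tsum_add (hshift 0).1]
  have e : 162 * (∑' n, w n) / ε =
    27 * (2 / ε * ∑' n, w n + 2 / ε * ∑' n, w n + 2 / ε * ∑' n, w n) := by ring
  rw [e]
  gcongr
  exacts [(hshift (-1)).2, (hshift 0).2, (hshift 1).2]

/-- Pointwise `|F| ≤ (1 + y²)F² + (1 + y²)⁻¹`, and the last term has integral `π`. Bounded
primitives are what keeps the terms `∂_w A · 𝓑` and `𝓐 · ∂_l B` of the correctors under control. -/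
theorem abs_intervalIntegral_le_of_weighted {F : ℝ → ℝ}
    (hi : Integrable (fun x => (1 + x ^ 2) * F x ^ 2)) (x : ℝ) :
    |∫ y in (0 : ℝ)..x, F y| ≤ (∫ y, (1 + y ^ 2) * F y ^ 2) + Real.pi := by
  have hI : Integrable (fun y => (1 + y ^ 2) * F y ^ 2 + (1 + y ^ 2)⁻¹) :=
    hi.add integrable_inv_one_add_sq
  have hpt : ∀ y, |F y| ≤ (1 + y ^ 2) * F y ^ 2 + (1 + y ^ 2)⁻¹ := by
    intro y
    have h0 : 0 < 1 + y ^ 2 := by positivity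
    have h1 : (1 + y ^ 2) * (1 + y ^ 2)⁻¹ = 1 := mul_inv_cancel₀ h0.ne'
    have h2 : 0 < (1 + y ^ 2)⁻¹ := by positivity
    have h3 : F y ^ 2 = |F y| ^ 2 := (sq_abs _).symm
    rw [h3]
    by_contra hcon
    push Not at hcon
    have h4 := abs_nonneg (F y)
    nlinarith [sq_nonneg ((1 + y ^ 2) * |F y| - 1), mul_lt_mul_of_pos_left hcon h0]
  have h := intervalIntegral.norm_integral_le_integral_norm_uIoc (f := F) (μ := volume) (a := 0)
    (b := x)
  rw [Real.norm_eq_abs] at h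
  refine h.trans ?_
  calc ∫ y in uIoc 0 x, ‖F y‖ ≤ ∫ y in uIoc 0 x, ((1 + y ^ 2) * F y ^ 2 + (1 + y ^ 2)⁻¹) :=
        integral_mono_of_nonneg (ae_of_all _ fun y => norm_nonneg _) hI.integrableOn
          (ae_of_all _ hpt)
    _ ≤ ∫ y, ((1 + y ^ 2) * F y ^ 2 + (1 + y ^ 2)⁻¹) :=
        setIntegral_le_integral hI (ae_of_all _ fun y => by simp only [Pi.zero_apply]; positivity)
    _ = _ := by rw [integral_add hi integrable_inv_one_add_sq, integral_univ_inv_one_add_sq]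

/-! ### Bounds for waves, uniform in the slow time -/

/-- The spatial derivatives of a function of `(x, T)`. -/
noncomputable def jet (v : ℝ → ℝ → ℝ) (k : ℕ) (x T : ℝ) : ℝ := iteratedDeriv k (fun y => v y T) x

/-- Bounds for a function of `(x, T)` in `H⁷(1)`, uniformly in `T ∈ [-T₀, T₀]`. -/
structure WaveBounds (T₀ : ℝ) (v : ℝ → ℝ → ℝ) (M : ℝ) (h : ℝ → ℝ → ℝ) : Prop where
  pos : 0 < M
  hasDerivAt : ∀ T ∈ Icc (-T₀) T₀, ∀ k < 6, ∀ x,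
    HasDerivAt (fun y => jet v k y T) (jet v (k + 1) x T) x
  nonneg : ∀ T x, 0 ≤ h T x
  jet_le : ∀ T ∈ Icc (-T₀) T₀, ∀ k ≤ 6, ∀ x y, |y - x| ≤ 1 → |jet v k y T| ≤ h T x
  summable : ∀ T ∈ Icc (-T₀) T₀, ∀ ε ∈ Ioc (0 : ℝ) 1, ∀ s,
    Summable (fun j : ℤ => (1 + (ε * j - s) ^ 2) * h T (ε * j - s) ^ 2)
  tsum_le : ∀ T ∈ Icc (-T₀) T₀, ∀ ε ∈ Ioc (0 : ℝ) 1, ∀ s,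
    ∑' j : ℤ, (1 + (ε * j - s) ^ 2) * h T (ε * j - s) ^ 2 ≤ M / ε
  holder : ∀ T ∈ Icc (-T₀) T₀, ∀ x y, |jet v 6 x T - jet v 6 y T| ≤ M * √|x - y|
  primitive_le : ∀ T ∈ Icc (-T₀) T₀, ∀ x, |∫ y in (0 : ℝ)..x, v y T| ≤ M
  integrable_sq : ∀ T ∈ Icc (-T₀) T₀, Integrable (fun x => v x T ^ 2)

theorem exists_waveBounds {T₀ : ℝ} {v : ℝ → ℝ → ℝ} {K : ℝ} (hK : 0 < K)
    (hv : ∀ T ∈ Icc (-T₀) T₀, Continuous (fun x => v x T))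
    (hn : ∀ T ∈ Icc (-T₀) T₀, sobolevNorm 7 1 (fun x => v x T) < ENNReal.ofReal K) :
    ∃ M h, WaveBounds T₀ v M h := by
  obtain ⟨C, hC0, hC⟩ := exists_envelope_of_sobolevNorm_lt
  have hC' := fun T (hT : T ∈ Icc (-T₀) T₀) => hC _ K hK (hv T hT) (hn T hT)
  have hex : ∀ T, ∃ g : ℤ → ℝ, (∀ n, 0 ≤ g n) ∧ (T ∈ Icc (-T₀) T₀ →
      Summable (fun n : ℤ => (1 + (n : ℝ) ^ 2) * g n ^ 2) ∧
      ∑' n : ℤ, (1 + (n : ℝ) ^ 2) * g n ^ 2 ≤ C * K ^ 2 ∧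
      ∀ k ≤ 6, ∀ x, |iteratedDeriv k (fun x => v x T) x| ≤ g ⌊x⌋) := by
    intro T
    -- Outside the time interval the zero envelope is chosen, so that the majorant is nonnegative
    -- for every `T`.
    by_cases hT : T ∈ Icc (-T₀) T₀
    · obtain ⟨g, h1, h2⟩ := (hC' T hT).2.1
      exact ⟨g, h1, fun _ => h2⟩
    · exact ⟨fun _ => 0, fun _ => le_rfl, fun h => absurd h hT⟩
  choose g hg0 hg using hex
  -- One constant for three bounds: the first summand serves the lattice sums, the second the Hölder
  -- estimate, the third the primitive.
  refine ⟨162 * (C * K ^ 2) + K + (K ^ 2 + Real.pi), fun T => cellMajorant (g T), ?_⟩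
  have hπ := Real.pi_pos
  refine ⟨by positivity, fun T hT => (hC' T hT).1, fun T x => cellMajorant_nonneg (hg0 T) x,
    ?_, ?_, ?_, ?_, ?_, ?_⟩
  · intro T hT k hk x y hxy
    exact ((hg T hT).2.2 k hk y).trans (le_cellMajorant (hg0 T) hxy)
  · intro T hT ε hε s
    exact (sum_cellMajorant (hg T hT).1 hε.1 hε.2 s).1
  · intro T hT ε hε s
    refine (sum_cellMajorant (hg T hT).1 hε.1 hε.2 s).2.trans ?_
    have := hε.1
    gcongr
    have := (hg T hT).2.1
    nlinarith [sq_nonneg K]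
  · intro T hT x y
    refine ((hC' T hT).2.2.1 x y).trans ?_
    gcongr
    nlinarith [mul_pos hC0 (pow_pos hK 2), sq_nonneg K]
  · intro T hT x
    refine (abs_intervalIntegral_le_of_weighted (hC' T hT).2.2.2.1 x).trans ?_
    have := (hC' T hT).2.2.2.2
    nlinarith [mul_pos hC0 (pow_pos hK 2)]
  · intro T hT
    refine (hC' T hT).2.2.2.1.mono' ((hv T hT).pow 2).aestronglyMeasurable
      (ae_of_all _ fun x => ?_)
    rw [Real.norm_of_nonneg (by positivity)]
    nlinarith [mul_nonneg (sq_nonneg x) (sq_nonneg (v x T))]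

namespace WaveBounds

variable {T₀ : ℝ} {v : ℝ → ℝ → ℝ} {M : ℝ} {h : ℝ → ℝ → ℝ}

theorem weight_mul_sq_le (H : WaveBounds T₀ v M h) {T : ℝ} (hT : T ∈ Icc (-T₀) T₀) (x : ℝ) :
    (1 + x ^ 2) * h T x ^ 2 ≤ M := by
  -- With `ε = 1` and shift `-x`, the value at `x` is the term `j = 0` of the lattice sum.
  have h1 := (H.summable T hT 1 ⟨one_pos, le_rfl⟩ (-x)).le_tsum 0 fun j _ => by positivity
  have h2 := H.tsum_le T hT 1 ⟨one_pos, le_rfl⟩ (-x)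
  simpa using h1.trans h2

theorem majorant_le (H : WaveBounds T₀ v M h) {T : ℝ} (hT : T ∈ Icc (-T₀) T₀) (x : ℝ) :
    h T x ≤ M + 1 := by
  have h1 := H.weight_mul_sq_le hT x
  have h2 := H.nonneg T x
  nlinarith [mul_nonneg (sq_nonneg x) (sq_nonneg (h T x)), sq_nonneg (h T x - 1), H.pos]

theorem abs_jet_le (H : WaveBounds T₀ v M h) {T : ℝ} (hT : T ∈ Icc (-T₀) T₀) {k : ℕ} (hk : k ≤ 6)
    (x : ℝ) : |jet v k x T| ≤ M + 1 :=
  (H.jet_le T hT k hk x x (by simp)).trans (H.majorant_le hT x)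

end WaveBounds

/-! ### Differentiation in time: limits, paths, integrals -/

/-- By the mean value inequality `φ - φs n` has a small Lipschitz constant on `I` once the
derivatives are uniformly close; working inside a convex set covers the one-sided derivatives at
endpoints. -/
theorem hasDerivWithinAt_of_tendsto_uniformly {I : Set ℝ} (hI : Convex ℝ I) {φ f : ℝ → ℝ}
    {φs fs : ℕ → ℝ → ℝ} (hd : ∀ n, ∀ T ∈ I, HasDerivWithinAt (φs n) (fs n T) I T)
    (hφ : ∀ T ∈ I, Tendsto (fun n => φs n T) atTop (𝓝 (φ T)))
    (hf : ∀ η > 0, ∀ᶠ n in atTop, ∀ T ∈ I, |fs n T - f T| ≤ η) {T : ℝ} (hT : T ∈ I) :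
    HasDerivWithinAt φ (f T) I T := by
  rw [hasDerivWithinAt_iff_isLittleO, Asymptotics.isLittleO_iff]
  intro η hη
  obtain ⟨n, hn⟩ := eventually_atTop.mp (hf (η / 4) (by positivity))
  have h1 : ∀ T' ∈ I, |(φ T' - φs n T') - (φ T - φs n T)| ≤ η / 2 * |T' - T| := by
    intro T' hT'
    have hlim : Tendsto (fun m => |(φs m T' - φs n T') - (φs m T - φs n T)|) atTop
        (𝓝 |(φ T' - φs n T') - (φ T - φs n T)|) :=
      (((hφ T' hT').sub_const _).sub ((hφ T hT).sub_const _)).abs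
    refine le_of_tendsto hlim (eventually_atTop.mpr ⟨n, fun m hm => ?_⟩)
    have := hI.norm_image_sub_le_of_norm_hasDerivWithin_le (f := fun T => φs m T - φs n T)
      (f' := fun T => fs m T - fs n T) (C := η / 2)
      (fun s hs => (hd m s hs).sub (hd n s hs)) (fun s hs => ?_) hT hT'
    · simpa using this
    · have a1 := hn m hm s hs
      have a2 := hn n le_rfl s hs
      rw [Real.norm_eq_abs]
      rw [abs_le] at *
      constructor <;> linarith [a1.1, a1.2, a2.1, a2.2]
  have h2 := hd n T hT
  rw [hasDerivWithinAt_iff_isLittleO, Asymptotics.isLittleO_iff] at h2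
  filter_upwards [h2 (show 0 < η / 4 by positivity), self_mem_nhdsWithin] with T' h3 hT'
  have h4 := h1 T' hT'
  have h5 := hn n le_rfl T hT
  simp only [Real.norm_eq_abs, smul_eq_mul] at *
  have h6 : |(T' - T) * (fs n T - f T)| ≤ |T' - T| * (η / 4) := by
    rw [abs_mul]; gcongr
  have h7 : φ T' - φ T - (T' - T) * f T = ((φ T' - φs n T') - (φ T - φs n T)) +
      ((φs n T' - φs n T - (T' - T) * fs n T) + (T' - T) * (fs n T - f T)) := by ring
  rw [h7]
  refine (abs_add_le _ _).trans ((add_le_add_right (abs_add_le _ _) _).trans ?_)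
  linarith

/-- The chain rule along a path, for a function whose partial derivative in the second variable
is equicontinuous in the first one. -/
theorem hasDerivWithinAt_comp_path {I J : Set ℝ} (hI : Convex ℝ I) {v F : ℝ → ℝ → ℝ}
    {ξ τ : ℝ → ℝ} {d ξ' τ' t C : ℝ} (ht : t ∈ J) (hτI : MapsTo τ J I)
    (hx : HasDerivAt (fun y => v y (τ t)) d (ξ t))
    (hT : ∀ T ∈ I, ∀ y, HasDerivWithinAt (fun s => v y s) (F y T) I T)
    (hF : ∀ T ∈ I, ∀ y z, |y - z| ≤ 1 → |F y T - F z T| ≤ C * √|y - z|)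
    (hξ : HasDerivWithinAt ξ ξ' J t) (hτ : HasDerivWithinAt τ τ' J t) :
    HasDerivWithinAt (fun r => v (ξ r) (τ r)) (d * ξ' + F (ξ t) (τ t) * τ') J t := by
  have h1 : HasDerivWithinAt (fun r => v (ξ r) (τ t)) (d * ξ') J t :=
    hx.comp_hasDerivWithinAt t hξ
  have h2 : HasDerivWithinAt (fun r => v (ξ t) (τ r)) (F (ξ t) (τ t) * τ') J t :=
    (hT (τ t) (hτI ht) (ξ t)).comp t hτ hτI
  -- `E` is the mixed second difference. The mean value inequality in the second variable bounds it
  -- by `√|Δξ| · |Δτ|`, which is `o(r - t)`; no continuity of `F` in time is needed.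
  set E : ℝ → ℝ := fun r => (v (ξ r) (τ r) - v (ξ t) (τ r)) - (v (ξ r) (τ t) - v (ξ t) (τ t))
    with hE
  have hEle : ∀ r ∈ J, |ξ r - ξ t| ≤ 1 → |E r| ≤ C * √|ξ r - ξ t| * |τ r - τ t| := by
    intro r hr h
    have := hI.norm_image_sub_le_of_norm_hasDerivWithin_le
      (f := fun s => v (ξ r) s - v (ξ t) s) (f' := fun s => F (ξ r) s - F (ξ t) s)
      (C := C * √|ξ r - ξ t|) (fun s hs => (hT s hs _).sub (hT s hs _))
      (fun s hs => hF s hs _ _ h) (hτI ht) (hτI hr)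
    simp only [Real.norm_eq_abs] at this
    rw [hE]
    convert this using 2
  have h3 : HasDerivWithinAt E 0 J t := by
    rw [hasDerivWithinAt_iff_isLittleO]
    simp only [hE, sub_self, smul_zero, sub_zero]
    have hξ0 : Tendsto (fun r => ξ r - ξ t) (𝓝[J] t) (𝓝 0) := by
      have : Tendsto (fun r => ξ r - ξ t) (𝓝[J] t) (𝓝 (ξ t - ξ t)) :=
        hξ.continuousWithinAt.tendsto.sub_const _
      rwa [sub_self] at this
    have hb : ∀ᶠ r in 𝓝[J] t, |ξ r - ξ t| ≤ 1 := by
      have := hξ0.abs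
      rw [abs_zero] at this
      exact this.eventually_le_const one_pos
    have hO : (fun r => (v (ξ r) (τ r) - v (ξ t) (τ r)) - (v (ξ r) (τ t) - v (ξ t) (τ t)))
        =O[𝓝[J] t] fun r => (C * √|ξ r - ξ t|) * (τ r - τ t) := by
      refine Asymptotics.IsBigO.of_bound 1 ?_
      filter_upwards [hb, self_mem_nhdsWithin] with r hr hrJ
      rw [one_mul, norm_mul, Real.norm_eq_abs, Real.norm_eq_abs, Real.norm_eq_abs]
      refine (hEle r hrJ hr).trans ?_
      gcongr
      exact le_abs_self _
    refine hO.trans_isLittleO ?_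
    have hs : (fun r => C * √|ξ r - ξ t|) =o[𝓝[J] t] fun _ => (1 : ℝ) := by
      rw [Asymptotics.isLittleO_one_iff]
      have := ((hξ0.abs.sqrt).const_mul C)
      simpa using this
    have := hs.mul_isBigO hτ.differentiableWithinAt.isBigO_sub
    simpa using this
  have h4 := ((h1.add h2).add h3).sub_const (v (ξ t) (τ t))
  rw [add_zero] at h4
  refine h4.congr_of_mem (fun r _ => ?_) ht
  simp only [hE, Pi.add_apply]
  ring

/-- Dominated convergence for the difference quotients, which are bounded by `C` through the mean
value inequality. -/
theorem hasDerivWithinAt_intervalIntegral {I : Set ℝ} (hI : Convex ℝ I) {φ f : ℝ → ℝ → ℝ}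
    {C : ℝ} (hφ : ∀ T ∈ I, Continuous (fun y => φ y T))
    (hd : ∀ T ∈ I, ∀ y, HasDerivWithinAt (fun s => φ y s) (f y T) I T)
    (hf : ∀ T ∈ I, ∀ y, |f y T| ≤ C) (a b : ℝ) {T : ℝ} (hT : T ∈ I) :
    HasDerivWithinAt (fun s => ∫ y in a..b, φ y s) (∫ y in a..b, f y T) I T := by
  rw [hasDerivWithinAt_iff_tendsto_slope]
  have hev : ∀ᶠ s in 𝓝[I \ {T}] T, s ∈ I :=
    eventually_mem_nhdsWithin.mono fun s hs => hs.1
  have h1 : Tendsto (fun s => ∫ y in a..b, slope (fun s => φ y s) T s) (𝓝[I \ {T}] T)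
      (𝓝 (∫ y in a..b, f y T)) := by
    apply intervalIntegral.tendsto_integral_filter_of_dominated_convergence (fun _ => C)
    · filter_upwards [hev] with s hs
      simp only [slope_def_field]
      exact (((hφ s hs).sub (hφ T hT)).div_const _).aestronglyMeasurable
    · filter_upwards [hev] with s hs
      refine ae_of_all _ fun y _ => ?_
      have := hI.norm_image_sub_le_of_norm_hasDerivWithin_le (f := fun s => φ y s)
        (f' := fun s => f y s) (fun r hr => hd r hr y) (fun r hr => hf r hr y) hT hs
      rw [slope_def_field, norm_div]
      exact div_le_of_le_mul₀ (norm_nonneg _) ((abs_nonneg _).trans (hf T hT y)) this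
    · simp
    · exact ae_of_all _ fun y _ => (hasDerivWithinAt_iff_tendsto_slope.mp (hd T hT y))
  refine h1.congr' ?_
  filter_upwards [hev] with s hs
  simp only [slope_def_field]
  rw [intervalIntegral.integral_div, intervalIntegral.integral_sub
    ((hφ s hs).intervalIntegrable _ _) ((hφ T hT).intervalIntegrable _ _)]

/-! ### Calculus of domination up to constants -/

/-- `f` is bounded on `S` by a multiple of `H`. -/
def Dom {ι : Type*} (S : Set ι) (H f : ι → ℝ) : Prop := ∃ C, 0 ≤ C ∧ ∀ i ∈ S, |f i| ≤ C * H i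

/-- `f` is bounded on `S`. -/
def Bd {ι : Type*} (S : Set ι) (f : ι → ℝ) : Prop := ∃ C, 0 ≤ C ∧ ∀ i ∈ S, |f i| ≤ C

section Dom

variable {ι : Type*} {S : Set ι} {H f g : ι → ℝ}

theorem Dom.add (hf : Dom S H f) (hg : Dom S H g) : Dom S H (fun i => f i + g i) := by
  obtain ⟨C, hC, hf⟩ := hf
  obtain ⟨D, hD, hg⟩ := hg
  refine ⟨C + D, by positivity, fun i hi => (abs_add_le _ _).trans ?_⟩
  rw [add_mul]
  exact add_le_add (hf i hi) (hg i hi)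

theorem Dom.neg (hf : Dom S H f) : Dom S H (fun i => -f i) := by
  obtain ⟨C, hC, hf⟩ := hf
  exact ⟨C, hC, fun i hi => by rw [abs_neg]; exact hf i hi⟩

theorem Dom.sub (hf : Dom S H f) (hg : Dom S H g) : Dom S H (fun i => f i - g i) := by
  simpa [sub_eq_add_neg] using hf.add hg.neg

theorem Dom.mul_bd (hf : Dom S H f) (hg : Bd S g) : Dom S H (fun i => f i * g i) := by
  obtain ⟨C, hC, hf⟩ := hf
  obtain ⟨D, hD, hg⟩ := hg
  refine ⟨C * D, by positivity, fun i hi => ?_⟩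
  rw [abs_mul, mul_right_comm]
  exact mul_le_mul (hf i hi) (hg i hi) (abs_nonneg _) ((abs_nonneg _).trans (hf i hi))

theorem Dom.bd_mul (hf : Bd S f) (hg : Dom S H g) : Dom S H (fun i => f i * g i) := by
  simpa [mul_comm] using hg.mul_bd hf

theorem Dom.const_mul (c : ℝ) (hf : Dom S H f) : Dom S H (fun i => c * f i) :=
  Dom.bd_mul ⟨|c|, abs_nonneg c, fun _ _ => le_rfl⟩ hf

theorem Dom.bd (hf : Dom S H f) (hH : Bd S H) : Bd S f := by
  obtain ⟨C, hC, hf⟩ := hf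
  obtain ⟨D, hD, hH⟩ := hH
  exact ⟨C * D, by positivity, fun i hi => (hf i hi).trans
    (mul_le_mul_of_nonneg_left ((le_abs_self _).trans (hH i hi)) hC)⟩

theorem bd_iff_dom_one : Bd S f ↔ Dom S (fun _ => 1) f := by simp [Bd, Dom]

theorem Bd.const (c : ℝ) : Bd S (fun _ : ι => c) := ⟨|c|, abs_nonneg c, fun _ _ => le_rfl⟩

theorem Bd.add (hf : Bd S f) (hg : Bd S g) : Bd S (fun i => f i + g i) := by
  rw [bd_iff_dom_one] at *; exact hf.add hg

theorem Bd.sub (hf : Bd S f) (hg : Bd S g) : Bd S (fun i => f i - g i) := by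
  rw [bd_iff_dom_one] at *; exact hf.sub hg

theorem Bd.mul (hf : Bd S f) (hg : Bd S g) : Bd S (fun i => f i * g i) := by
  rw [bd_iff_dom_one] at hf ⊢; exact hf.mul_bd hg

theorem Bd.pow (hf : Bd S f) (n : ℕ) : Bd S (fun i => f i ^ n) := by
  induction n with
  | zero => simpa using Bd.const 1
  | succ n ih => simpa [pow_succ] using ih.mul hf

end Dom

/-! ### Time derivatives of KdV solutions and conservation of the `L²` norm -/

/-- The time derivative of the spatial derivatives of a solution of
`2 ∂_T v = κ (c ∂³v + ∂(v²))`. -/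
noncomputable def timeJet (κ c : ℝ) (v : ℝ → ℝ → ℝ) : ℕ → ℝ → ℝ → ℝ
  | 0, x, T => κ / 2 * (c * jet v 3 x T + 2 * (jet v 0 x T * jet v 1 x T))
  | 1, x, T => κ / 2 * (c * jet v 4 x T
      + 2 * (jet v 1 x T * jet v 1 x T + jet v 0 x T * jet v 2 x T))
  | 2, x, T => κ / 2 * (c * jet v 5 x T
      + (6 * (jet v 1 x T * jet v 2 x T) + 2 * (jet v 0 x T * jet v 3 x T)))
  | _, x, T => κ / 2 * (c * jet v 6 x T + (6 * (jet v 2 x T * jet v 2 x T)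
      + 8 * (jet v 1 x T * jet v 3 x T) + 2 * (jet v 0 x T * jet v 4 x T)))

/-- The time derivative of the primitive of a solution of `2 ∂_T v = κ (c ∂³v + ∂(v²))`. -/
noncomputable def primTimeJet (κ c : ℝ) (v : ℝ → ℝ → ℝ) (x T : ℝ) : ℝ :=
  κ / 2 * (c * (jet v 2 x T - jet v 2 0 T) + (jet v 0 x T ^ 2 - jet v 0 0 T ^ 2))

namespace WaveBounds

variable {T₀ : ℝ} {v : ℝ → ℝ → ℝ} {M : ℝ} {h : ℝ → ℝ → ℝ} {κ c : ℝ}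

theorem bd_jet (H : WaveBounds T₀ v M h) {k : ℕ} (hk : k ≤ 6) :
    Bd {i : ℝ × ℝ | i.2 ∈ Icc (-T₀) T₀} (fun i => jet v k i.1 i.2) :=
  ⟨M + 1, by linarith [H.pos], fun i hi => H.abs_jet_le hi hk i.1⟩

theorem bd_timeJet (H : WaveBounds T₀ v M h) (κ c : ℝ) {k : ℕ} (hk : k ≤ 3) :
    Bd {i : ℝ × ℝ | i.2 ∈ Icc (-T₀) T₀} (fun i => timeJet κ c v k i.1 i.2) := by
  interval_cases k <;> simp only [timeJet] <;>
  repeat' first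
    | exact H.bd_jet (by norm_num)
    | exact Bd.const _
    | apply Bd.add
    | apply Bd.mul

theorem bd_primTimeJet (H : WaveBounds T₀ v M h) (κ c : ℝ) :
    Bd {i : ℝ × ℝ | i.2 ∈ Icc (-T₀) T₀} (fun i => primTimeJet κ c v i.1 i.2) := by
  have h0 : ∀ k ≤ 6, Bd {i : ℝ × ℝ | i.2 ∈ Icc (-T₀) T₀} (fun i => jet v k 0 i.2) := fun k hk =>
    ⟨M + 1, by linarith [H.pos], fun i hi => H.abs_jet_le hi hk 0⟩
  simp only [primTimeJet]
  repeat' first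
    | exact H.bd_jet (by norm_num)
    | exact h0 _ (by norm_num)
    | exact Bd.const _
    | apply Bd.sub
    | apply Bd.add
    | apply Bd.pow
    | apply Bd.mul

theorem hasDerivAt_timeJet (H : WaveBounds T₀ v M h) {T : ℝ} (hT : T ∈ Icc (-T₀) T₀) {k : ℕ}
    (hk : k < 3) (x : ℝ) :
    HasDerivAt (fun y => timeJet κ c v k y T) (timeJet κ c v (k + 1) x T) x := by
  have d := fun k hk => H.hasDerivAt T hT k hk x
  have d0 := d 0 (by norm_num)
  have d1 := d 1 (by norm_num)
  have d2 := d 2 (by norm_num)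
  have d3 := d 3 (by norm_num)
  have d4 := d 4 (by norm_num)
  have d5 := d 5 (by norm_num)
  simp only [Nat.reduceAdd] at d0 d1 d2 d3 d4 d5
  interval_cases k <;> simp only [timeJet]
  · exact (((d3.const_mul c).add ((d0.mul d1).const_mul 2)).const_mul (κ / 2)).congr_deriv
      (by ring)
  · exact (((d4.const_mul c).add (((d1.mul d1).add (d0.mul d2)).const_mul 2)).const_mul
      (κ / 2)).congr_deriv (by ring)
  · exact (((d5.const_mul c).add (((d1.mul d2).const_mul 6).add
      ((d0.mul d3).const_mul 2))).const_mul (κ / 2)).congr_deriv (by ring)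

/-- For `k ≤ 2` the space derivative is bounded, which gives a Lipschitz bound. For `k = 3` the term
`∂⁶v` has no classical derivative and only its Hölder bound is available; this fixes the exponent
`1/2`. -/
theorem exists_holder_timeJet (H : WaveBounds T₀ v M h) (κ c : ℝ) :
    ∃ C, 0 < C ∧ ∀ k ≤ 3, ∀ T ∈ Icc (-T₀) T₀, ∀ y z, |y - z| ≤ 1 →
      |timeJet κ c v k y T - timeJet κ c v k z T| ≤ C * √|y - z| := by
  have hsqrt : ∀ x : ℝ, |x| ≤ 1 → |x| ≤ √|x| := fun x hx => by
    apply Real.le_sqrt_of_sq_le; nlinarith [abs_nonneg x]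
  have hlip : ∀ F F' : ℝ → ℝ → ℝ, (∀ T ∈ Icc (-T₀) T₀, ∀ x,
      HasDerivAt (fun y => F y T) (F' x T) x) →
      Bd {i : ℝ × ℝ | i.2 ∈ Icc (-T₀) T₀} (fun i => F' i.1 i.2) →
      ∃ C, 0 ≤ C ∧ ∀ T ∈ Icc (-T₀) T₀, ∀ y z, |y - z| ≤ 1 →
        |F y T - F z T| ≤ C * √|y - z| := by
    intro F F' hF ⟨C, hC0, hC⟩
    refine ⟨C, hC0, fun T hT y z hyz => ?_⟩
    have := (convex_univ (𝕜 := ℝ) (E := ℝ)).norm_image_sub_le_of_norm_hasDerivWithin_le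
      (f := fun y => F y T) (f' := fun y => F' y T)
      (C := C) (fun x _ => (hF T hT x).hasDerivWithinAt) (fun x _ => hC (x, T) hT) (mem_univ z)
      (mem_univ y)
    refine this.trans ?_
    gcongr
    exact hsqrt _ hyz
  have h3 : ∀ k < 3, ∃ C, 0 ≤ C ∧ ∀ T ∈ Icc (-T₀) T₀, ∀ y z, |y - z| ≤ 1 →
      |timeJet κ c v k y T - timeJet κ c v k z T| ≤ C * √|y - z| := fun k hk =>
    hlip (timeJet κ c v k) (timeJet κ c v (k + 1)) (fun T hT x => H.hasDerivAt_timeJet hT hk x)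
      (H.bd_timeJet κ c (by omega))
  obtain ⟨C0, p0, h0⟩ := h3 0 (by norm_num)
  obtain ⟨C1, p1, h1⟩ := h3 1 (by norm_num)
  obtain ⟨C2, p2, h2⟩ := h3 2 (by norm_num)
  obtain ⟨C3, p3, h3'⟩ := hlip
    (fun x T => 6 * (jet v 2 x T * jet v 2 x T)
      + 8 * (jet v 1 x T * jet v 3 x T) + 2 * (jet v 0 x T * jet v 4 x T))
    (fun x T => 6 * (jet v 3 x T * jet v 2 x T + jet v 2 x T * jet v 3 x T)
      + 8 * (jet v 2 x T * jet v 3 x T + jet v 1 x T * jet v 4 x T)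
      + 2 * (jet v 1 x T * jet v 4 x T + jet v 0 x T * jet v 5 x T))
    (fun T hT x => by
      have d := fun k hk => H.hasDerivAt T hT k hk x
      exact ((((d 2 (by norm_num)).mul (d 2 (by norm_num))).const_mul 6).add
        (((d 1 (by norm_num)).mul (d 3 (by norm_num))).const_mul 8)).add
        (((d 0 (by norm_num)).mul (d 4 (by norm_num))).const_mul 2))
    (by
      repeat' first
        | exact H.bd_jet (by norm_num)
        | exact Bd.const _
        | apply Bd.add
        | apply Bd.mul)
  have hM := H.pos
  refine ⟨C0 + C1 + C2 + |κ / 2| * (|c| * M + C3) + 1, by positivity, fun k hk T hT y z hyz => ?_⟩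
  have hs := Real.sqrt_nonneg |y - z|
  have hq : 0 ≤ |κ / 2| * (|c| * M + C3) := by positivity
  interval_cases k
  · exact (h0 T hT y z hyz).trans (mul_le_mul_of_nonneg_right (by linarith) hs)
  · exact (h1 T hT y z hyz).trans (mul_le_mul_of_nonneg_right (by linarith) hs)
  · exact (h2 T hT y z hyz).trans (mul_le_mul_of_nonneg_right (by linarith) hs)
  · simp only [timeJet]
    have e1 := h3' T hT y z hyz
    have e2 := H.holder T hT y z
    rw [← mul_sub, abs_mul, add_sub_add_comm, ← mul_sub]
    calc _ ≤ |κ / 2| * (|c| * (M * √|y - z|) + C3 * √|y - z|) := by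
          refine mul_le_mul_of_nonneg_left ((abs_add_le _ _).trans (add_le_add ?_ e1))
            (abs_nonneg _)
          rw [abs_mul]
          exact mul_le_mul_of_nonneg_left e2 (abs_nonneg _)
      _ = (|κ / 2| * (|c| * M + C3)) * √|y - z| := by ring
      _ ≤ _ := mul_le_mul_of_nonneg_right (by linarith) hs

end WaveBounds

namespace WaveBounds

variable {T₀ : ℝ} {v : ℝ → ℝ → ℝ} {M : ℝ} {h : ℝ → ℝ → ℝ} {κ c : ℝ}

theorem jet_zero (v : ℝ → ℝ → ℝ) (x T : ℝ) : jet v 0 x T = v x T := by simp [jet]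

theorem continuous_jet (H : WaveBounds T₀ v M h) {T : ℝ} (hT : T ∈ Icc (-T₀) T₀) {k : ℕ}
    (hk : k < 6) : Continuous (fun x => jet v k x T) :=
  continuous_iff_continuousAt.mpr fun x => (H.hasDerivAt T hT k hk x).continuousAt

/-- Difference quotients of a function with Hölder continuous derivative. -/
theorem abs_slope_sub_le {f f' : ℝ → ℝ} {C : ℝ} (hC : 0 ≤ C) (hf : ∀ x, HasDerivAt f (f' x) x)
    (hh : ∀ y z, |y - z| ≤ 1 → |f' y - f' z| ≤ C * √|y - z|) (x : ℝ) {δ : ℝ} (hδ : 0 < δ)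
    (hδ1 : δ ≤ 1) : |(f (x + δ) - f x) / δ - f' x| ≤ C * √δ := by
  obtain ⟨ξ, hξ, e⟩ := exists_hasDerivAt_eq_slope f f' (by linarith : x < x + δ)
    (fun z _ => (hf z).continuousAt.continuousWithinAt) (fun z _ => hf z)
  rw [add_sub_cancel_left] at e
  rw [← e]
  have h1 : |ξ - x| ≤ δ := by rw [abs_of_pos (by linarith [hξ.1])]; linarith [hξ.2]
  refine (hh ξ x (h1.trans hδ1)).trans ?_
  gcongr

/-- Space and time derivatives commute without joint smoothness. The spatial difference quotients of
`∂ᵏv` have as time derivatives the difference quotients of `timeJet k`, and the Hölder bound on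
`timeJet (k + 1)` makes these converge uniformly in time. -/
theorem hasDerivWithinAt_jet (H : WaveBounds T₀ v M h)
    (hv : ∀ T ∈ Icc (-T₀) T₀, ∀ x,
      HasDerivWithinAt (fun s => v x s) (timeJet κ c v 0 x T) (Icc (-T₀) T₀) T)
    {k : ℕ} (hk : k ≤ 3) {T : ℝ} (hT : T ∈ Icc (-T₀) T₀) (x : ℝ) :
    HasDerivWithinAt (fun s => jet v k x s) (timeJet κ c v k x T) (Icc (-T₀) T₀) T := by
  induction k generalizing T x with
  | zero => simpa only [jet_zero] using hv T hT x
  | succ k ih =>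
    obtain ⟨C, hC0, hC⟩ := H.exists_holder_timeJet κ c
    set δ : ℕ → ℝ := fun n => 1 / ((n : ℝ) + 1)
    have hδ0 : ∀ n, 0 < δ n := fun n => by positivity
    have hδ1 : ∀ n, δ n ≤ 1 := fun n => by
      simp only [δ]; rw [div_le_one (by positivity)]; linarith [(Nat.cast_nonneg n : (0 : ℝ) ≤ n)]
    have hδt : Tendsto δ atTop (𝓝 0) := tendsto_one_div_add_atTop_nhds_zero_nat
    refine hasDerivWithinAt_of_tendsto_uniformly (convex_Icc (-T₀) T₀)
      (φs := fun n s => (jet v k (x + δ n) s - jet v k x s) / δ n)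
      (f := fun s => timeJet κ c v (k + 1) x s)
      (fs := fun n s => (timeJet κ c v k (x + δ n) s - timeJet κ c v k x s) / δ n)
      (fun n s hs => ((ih (by omega) hs _).sub (ih (by omega) hs _)).div_const _)
      (fun s hs => ?_) (fun η hη => ?_) hT
    · have h1 := (H.hasDerivAt s hs k (by omega) x).tendsto_slope_zero
      have h2 : Tendsto δ atTop (𝓝[≠] 0) :=
        tendsto_nhdsWithin_of_tendsto_nhds_of_eventually_within _ hδt
          (Eventually.of_forall fun n => (hδ0 n).ne')
      refine (h1.comp h2).congr fun n => ?_
      simp [div_eq_inv_mul]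
    · have h3 : Tendsto (fun n => C * √(δ n)) atTop (𝓝 0) := by
        simpa using (hδt.sqrt).const_mul C
      filter_upwards [h3.eventually_le_const hη] with n hn s hs
      exact (abs_slope_sub_le hC0.le (fun y => H.hasDerivAt_timeJet hs (by omega) y)
        (hC (k + 1) hk s hs) x (hδ0 n) (hδ1 n)).trans hn

theorem hasDerivWithinAt_jet_path (H : WaveBounds T₀ v M h)
    (hv : ∀ T ∈ Icc (-T₀) T₀, ∀ x,
      HasDerivWithinAt (fun s => v x s) (timeJet κ c v 0 x T) (Icc (-T₀) T₀) T)
    {k : ℕ} (hk : k ≤ 3) {J : Set ℝ} {ξ τ : ℝ → ℝ} {ξ' τ' t : ℝ} (ht : t ∈ J)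
    (hτJ : MapsTo τ J (Icc (-T₀) T₀)) (hξ : HasDerivWithinAt ξ ξ' J t)
    (hτ : HasDerivWithinAt τ τ' J t) :
    HasDerivWithinAt (fun r => jet v k (ξ r) (τ r))
      (jet v (k + 1) (ξ t) (τ t) * ξ' + timeJet κ c v k (ξ t) (τ t) * τ') J t := by
  obtain ⟨C, hC0, hC⟩ := H.exists_holder_timeJet κ c
  exact hasDerivWithinAt_comp_path (convex_Icc (-T₀) T₀) ht hτJ
    (H.hasDerivAt _ (hτJ ht) k (by omega) _)
    (fun T hT y => H.hasDerivWithinAt_jet hv hk hT y) (hC k hk) hξ hτ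

theorem continuous_timeJet_zero (H : WaveBounds T₀ v M h) {T : ℝ} (hT : T ∈ Icc (-T₀) T₀) :
    Continuous (fun x => timeJet κ c v 0 x T) :=
  continuous_iff_continuousAt.mpr fun x => (H.hasDerivAt_timeJet hT (by norm_num) x).continuousAt

theorem hasDerivAt_primTimeJet (H : WaveBounds T₀ v M h) {T : ℝ} (hT : T ∈ Icc (-T₀) T₀) (x : ℝ) :
    HasDerivAt (fun y => primTimeJet κ c v y T) (timeJet κ c v 0 x T) x := by
  have d := fun k hk => H.hasDerivAt T hT k hk x
  have := (((((d 2 (by norm_num)).sub_const (jet v 2 0 T)).const_mul c).add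
    (((d 0 (by norm_num)).pow 2).sub_const (jet v 0 0 T ^ 2))).const_mul (κ / 2))
  refine this.congr_deriv ?_
  simp only [timeJet]
  push_cast
  ring

/-- The right-hand side of KdV is a space derivative, so integrating it from `0` to `x` leaves a
flux difference; the terms at `0` in `primTimeJet` are the lower boundary values. -/
theorem hasDerivWithinAt_antideriv (H : WaveBounds T₀ v M h)
    (hv : ∀ T ∈ Icc (-T₀) T₀, ∀ x,
      HasDerivWithinAt (fun s => v x s) (timeJet κ c v 0 x T) (Icc (-T₀) T₀) T)
    {T : ℝ} (hT : T ∈ Icc (-T₀) T₀) (x : ℝ) :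
    HasDerivWithinAt (fun s => antideriv v x s) (primTimeJet κ c v x T) (Icc (-T₀) T₀) T := by
  obtain ⟨C, hC0, hC⟩ := H.bd_timeJet κ c (k := 0) (by norm_num)
  have h1 := hasDerivWithinAt_intervalIntegral (convex_Icc (-T₀) T₀) (φ := v)
    (f := timeJet κ c v 0) (C := C)
    (fun T hT => by simpa only [jet_zero] using H.continuous_jet hT (k := 0) (by norm_num))
    hv (fun T hT y => hC (y, T) hT) 0 x hT
  have h2 := intervalIntegral.integral_eq_sub_of_hasDerivAt (a := 0) (b := x)
    (fun y _ => H.hasDerivAt_primTimeJet (κ := κ) (c := c) hT y)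
    ((H.continuous_timeJet_zero hT).intervalIntegrable _ _)
  rw [h2] at h1
  refine h1.congr_deriv ?_
  simp [primTimeJet]

theorem hasDerivAt_antideriv (H : WaveBounds T₀ v M h) {T : ℝ} (hT : T ∈ Icc (-T₀) T₀) (x : ℝ) :
    HasDerivAt (fun y => antideriv v y T) (jet v 0 x T) x := by
  have hc := H.continuous_jet hT (k := 0) (by norm_num)
  simp only [jet_zero] at hc ⊢
  exact (hc.integral_hasStrictDerivAt 0 x).hasDerivAt

theorem hasDerivWithinAt_antideriv_path (H : WaveBounds T₀ v M h)
    (hv : ∀ T ∈ Icc (-T₀) T₀, ∀ x,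
      HasDerivWithinAt (fun s => v x s) (timeJet κ c v 0 x T) (Icc (-T₀) T₀) T)
    {J : Set ℝ} {ξ τ : ℝ → ℝ} {ξ' τ' t : ℝ} (ht : t ∈ J)
    (hτJ : MapsTo τ J (Icc (-T₀) T₀)) (hξ : HasDerivWithinAt ξ ξ' J t)
    (hτ : HasDerivWithinAt τ τ' J t) :
    HasDerivWithinAt (fun r => antideriv v (ξ r) (τ r))
      (jet v 0 (ξ t) (τ t) * ξ' + primTimeJet κ c v (ξ t) (τ t) * τ') J t := by
  obtain ⟨C, hC0, hC⟩ := H.bd_timeJet κ c (k := 0) (by norm_num)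
  refine hasDerivWithinAt_comp_path (convex_Icc (-T₀) T₀) (C := C) ht hτJ
    (H.hasDerivAt_antideriv (hτJ ht) _)
    (fun T hT y => H.hasDerivWithinAt_antideriv hv hT y) (fun T hT y z hyz => ?_) hξ hτ
  have := (convex_univ (𝕜 := ℝ) (E := ℝ)).norm_image_sub_le_of_norm_hasDerivWithin_le
    (f := fun y => primTimeJet κ c v y T) (f' := fun y => timeJet κ c v 0 y T)
    (C := C) (fun x _ => (H.hasDerivAt_primTimeJet hT x).hasDerivWithinAt)
    (fun x _ => hC (x, T) hT) (mem_univ z) (mem_univ y)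
  refine this.trans ?_
  gcongr
  apply Real.le_sqrt_of_sq_le
  simp only [Real.norm_eq_abs]
  nlinarith [abs_nonneg (y - z)]

/-- The `L²` norm of a solution is conserved. -/
theorem integral_sq_eq (H : WaveBounds T₀ v M h)
    (hv : ∀ T ∈ Icc (-T₀) T₀, ∀ x,
      HasDerivWithinAt (fun s => v x s) (timeJet κ c v 0 x T) (Icc (-T₀) T₀) T)
    {T T' : ℝ} (hT : T ∈ Icc (-T₀) T₀) (hT' : T' ∈ Icc (-T₀) T₀) :
    ∫ x, v x T ^ 2 = ∫ x, v x T' ^ 2 := by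
  have hvc : ∀ T ∈ Icc (-T₀) T₀, Continuous (fun x => v x T) := fun T hT => by
    simpa only [jet_zero] using H.continuous_jet hT (k := 0) (by norm_num)
  -- The local conservation law: `2v ∂_T v` is the space derivative of this flux.
  set flux : ℝ → ℝ → ℝ := fun x T => κ * (c * (jet v 0 x T * jet v 2 x T
    - jet v 1 x T * jet v 1 x T / 2) + 2 / 3 * (jet v 0 x T) ^ 3)
  have hflux : ∀ T ∈ Icc (-T₀) T₀, ∀ x,
      HasDerivAt (fun y => flux y T) (2 * v x T * timeJet κ c v 0 x T) x := by
    intro T hT x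
    have d := fun k hk => H.hasDerivAt T hT k hk x
    have := (((((d 0 (by norm_num)).mul (d 2 (by norm_num))).sub
      (((d 1 (by norm_num)).mul (d 1 (by norm_num))).div_const 2)).const_mul c).add
      (((d 0 (by norm_num)).pow 3).const_mul (2 / 3))).const_mul κ
    refine this.congr_deriv ?_
    simp only [timeJet, ← jet_zero v x T]
    push_cast
    ring
  set D : ℝ := |κ| * (|c| * (2 * M) + M * (M + 1)) with hD
  have hM := H.pos
  -- The weighted bound `x² h² ≤ M` makes the flux through `±R` of size `R⁻²`, uniformly in time, so
  -- the balance on `[-R, R]` passes to the line.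
  have hflux_le : ∀ T ∈ Icc (-T₀) T₀, ∀ x, x ^ 2 * |flux x T| ≤ D := by
    intro T hT x
    have hj := fun k hk => H.jet_le T hT k hk x x (by simp)
    have hw := H.weight_mul_sq_le hT x
    have hh := H.nonneg T x
    have hm := H.majorant_le hT x
    set y := h T x
    have hxy : x ^ 2 * y ^ 2 ≤ M := by nlinarith [sq_nonneg y]
    have j0 := hj 0 (by norm_num)
    have j1 := hj 1 (by norm_num)
    have j2 := hj 2 (by norm_num)
    have e1 : |jet v 0 x T * jet v 2 x T - jet v 1 x T * jet v 1 x T / 2| ≤ 2 * y ^ 2 := by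
      refine (abs_sub _ _).trans ?_
      rw [abs_mul, abs_div, abs_mul, abs_of_pos (two_pos : (0 : ℝ) < 2)]
      have := mul_le_mul j0 j2 (abs_nonneg _) hh
      have := mul_le_mul j1 j1 (abs_nonneg _) hh
      nlinarith
    have e2 : |2 / 3 * (jet v 0 x T) ^ 3| ≤ y ^ 2 * (M + 1) := by
      rw [abs_mul, abs_pow, abs_of_pos (by norm_num : (0 : ℝ) < 2 / 3)]
      have := pow_le_pow_left₀ (abs_nonneg _) j0 3
      have : y ^ 3 ≤ y ^ 2 * (M + 1) := by rw [pow_succ]; gcongr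
      have : 0 ≤ y ^ 3 := by positivity
      linarith
    calc x ^ 2 * |flux x T|
        ≤ x ^ 2 * (|κ| * (|c| * (2 * y ^ 2) + y ^ 2 * (M + 1))) := by
          refine mul_le_mul_of_nonneg_left ?_ (sq_nonneg x)
          simp only [flux]
          rw [abs_mul]
          refine mul_le_mul_of_nonneg_left ((abs_add_le _ _).trans (add_le_add ?_ e2))
            (abs_nonneg _)
          rw [abs_mul]
          exact mul_le_mul_of_nonneg_left e1 (abs_nonneg _)
      _ = |κ| * (|c| * (2 * (x ^ 2 * y ^ 2)) + (x ^ 2 * y ^ 2) * (M + 1)) := by ring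
      _ ≤ D := by rw [hD]; gcongr
  obtain ⟨C, hC0, hC⟩ := ((bd_jet H (k := 0) (by norm_num)).mul
    (H.bd_timeJet κ c (k := 0) (by norm_num))).mul (Bd.const 2)
  have hder : ∀ R : ℝ, ∀ T ∈ Icc (-T₀) T₀, HasDerivWithinAt
      (fun s => ∫ x in (-R)..R, v x s ^ 2) (flux R T - flux (-R) T) (Icc (-T₀) T₀) T := by
    intro R T hT
    have h1 := hasDerivWithinAt_intervalIntegral (convex_Icc (-T₀) T₀) (φ := fun x s => v x s ^ 2)
      (f := fun x s => 2 * v x s * timeJet κ c v 0 x s) (C := C)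
      (fun T hT => (hvc T hT).pow 2)
      (fun T hT y => ((hv T hT y).pow 2).congr_deriv (by push_cast; ring))
      (fun T hT y => by
        have := hC (y, T) hT
        simp only [jet_zero] at this
        convert this using 2
        ring) (-R) R hT
    have h2 := intervalIntegral.integral_eq_sub_of_hasDerivAt (a := -R) (b := R)
      (fun y _ => hflux T hT y)
      ((((hvc T hT).const_mul 2).mul (H.continuous_timeJet_zero hT)).intervalIntegrable _ _)
    rwa [h2] at h1
  have hlim : ∀ T ∈ Icc (-T₀) T₀,
      Tendsto (fun R : ℝ => ∫ x in (-R)..R, v x T ^ 2) atTop (𝓝 (∫ x, v x T ^ 2)) := fun T hT =>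
    intervalIntegral_tendsto_integral (H.integrable_sq T hT) tendsto_neg_atTop_atBot tendsto_id
  have hle : ∀ᶠ R : ℝ in atTop,
      |(∫ x in (-R)..R, v x T ^ 2) - ∫ x in (-R)..R, v x T' ^ 2|
        ≤ 2 * D * |T - T'| * (R ^ 2)⁻¹ := by
    filter_upwards [eventually_gt_atTop 0] with R hR
    have hR2 : 0 < R ^ 2 := by positivity
    have := (convex_Icc (-T₀) T₀).norm_image_sub_le_of_norm_hasDerivWithin_le
      (C := 2 * D * (R ^ 2)⁻¹) (hder R) (fun s hs => ?_) hT' hT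
    · simp only [Real.norm_eq_abs] at this
      linarith
    · have a1 := hflux_le s hs R
      have a2 := hflux_le s hs (-R)
      rw [neg_sq] at a2
      rw [← div_eq_mul_inv, le_div_iff₀ hR2, Real.norm_eq_abs]
      have a3 := abs_sub (flux R s) (flux (-R) s)
      nlinarith
  have h0 : Tendsto (fun R : ℝ => 2 * D * |T - T'| * (R ^ 2)⁻¹) atTop (𝓝 0) := by
    have : Tendsto (fun R : ℝ => (R ^ 2)⁻¹) atTop (𝓝 0) :=
      (tendsto_pow_atTop (two_ne_zero)).inv_tendsto_atTop
    simpa using this.const_mul (2 * D * |T - T'|)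
  have h1 := le_of_tendsto_of_tendsto ((hlim T hT).sub (hlim T' hT')).abs h0 hle
  exact sub_eq_zero.mp (abs_nonpos_iff.mp h1)

end WaveBounds

/-! ### Almost sure control of sums of the noise -/

/-- The sums of `x` over intervals grow like the square root of the length, up to a logarithm. -/
def ControlledSums (x : ℤ → ℝ) : Prop :=
  ∃ C, 0 ≤ C ∧ ∀ m n : ℤ, m ≤ n →
    |∑ i ∈ Finset.Ico m n, x i| ≤ C * √((n - m) * Real.log (2 + |(m : ℝ)| + |(n : ℝ)|))

namespace ControlledSums

variable {x y : ℤ → ℝ}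

theorem add (hx : ControlledSums x) (hy : ControlledSums y) :
    ControlledSums (fun i => x i + y i) := by
  obtain ⟨C, hC0, hC⟩ := hx
  obtain ⟨D, hD0, hD⟩ := hy
  refine ⟨C + D, by positivity, fun m n hmn => ?_⟩
  rw [Finset.sum_add_distrib, add_mul]
  exact (abs_add_le _ _).trans (add_le_add (hC m n hmn) (hD m n hmn))

theorem const_mul (c : ℝ) (hx : ControlledSums x) : ControlledSums (fun i => c * x i) := by
  obtain ⟨C, hC0, hC⟩ := hx
  refine ⟨|c| * C, by positivity, fun m n hmn => ?_⟩
  rw [← Finset.mul_sum, abs_mul, mul_assoc]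
  exact mul_le_mul_of_nonneg_left (hC m n hmn) (abs_nonneg c)

theorem shift (hx : ControlledSums x) {r : ℤ} (hr : |(r : ℝ)| ≤ 1) :
    ControlledSums (fun i => x (i + r)) := by
  obtain ⟨C, hC0, hC⟩ := hx
  refine ⟨C * √2, by positivity, fun m n hmn => ?_⟩
  have h1 := hC (m + r) (n + r) (by omega)
  rw [← Finset.sum_Ico_add'] at h1
  refine h1.trans ?_
  rw [mul_assoc, ← Real.sqrt_mul (by norm_num)]
  have hnm : (0 : ℝ) ≤ n - m := sub_nonneg.mpr (by exact_mod_cast hmn)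
  refine mul_le_mul_of_nonneg_left (Real.sqrt_le_sqrt ?_) hC0
  push_cast
  have hm := abs_add_le (m : ℝ) r
  have hn := abs_add_le (n : ℝ) r
  have hm0 := abs_nonneg (m : ℝ)
  have hn0 := abs_nonneg (n : ℝ)
  -- A shift enlarges the argument by at most `2`, and `4 + |m| + |n| ≤ (2 + |m| + |n|)²`.
  have hlog : Real.log (2 + |(m : ℝ) + r| + |(n : ℝ) + r|) ≤
      2 * Real.log (2 + |(m : ℝ)| + |(n : ℝ)|) := by
    rw [← Real.log_rpow (by positivity)]
    apply Real.log_le_log (by positivity)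
    norm_num
    nlinarith
  calc _ = ((n : ℝ) - m) * Real.log (2 + |(m : ℝ) + r| + |(n : ℝ) + r|) := by ring
    _ ≤ ((n : ℝ) - m) * (2 * Real.log (2 + |(m : ℝ)| + |(n : ℝ)|)) := by gcongr
    _ = _ := by ring

end ControlledSums

/-- The exponential is an inverse fourth power, dominated by a product of inverse squares in the two
indices; the offset `1/2` keeps the denominators away from zero. -/
theorem summable_int_prod_log :
    Summable fun p : ℤ × ℤ => 2 * Real.exp (-4 * Real.log (2 + |(p.1 : ℝ)| + |(p.2 : ℝ)|)) := by
  have h1 : Summable fun n : ℤ => 1 / |(n : ℝ) + 1 / 2| ^ (2 : ℝ) :=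
    (Real.summable_one_div_int_add_rpow (1 / 2) 2).mpr one_lt_two
  have h2 := (h1.mul_of_nonneg h1 (fun n => by positivity) (fun n => by positivity)).mul_left 2
  refine Summable.of_nonneg_of_le (fun p => by positivity) (fun p => ?_) h2
  have key : ∀ n : ℤ, 0 < |(n : ℝ) + 1 / 2| := fun n => by
    rw [abs_pos]
    intro h
    have h2 : (2 * n + 1 : ℝ) = 0 := by linarith
    have : (2 * n + 1 : ℤ) = 0 := by exact_mod_cast h2
    omega
  have hle : ∀ n : ℤ, |(n : ℝ) + 1 / 2| ≤ |(n : ℝ)| + 1 := fun n =>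
    (abs_add_le _ _).trans (by norm_num)
  set a := |(p.1 : ℝ)|
  set b := |(p.2 : ℝ)|
  have ha : 0 ≤ a := abs_nonneg _
  have hb : 0 ≤ b := abs_nonneg _
  have e : Real.exp (-4 * Real.log (2 + a + b)) = 1 / (2 + a + b) ^ 4 := by
    rw [neg_mul, Real.exp_neg, one_div, mul_comm, Real.exp_mul, Real.exp_log (by positivity)]
    norm_cast
  rw [e]
  refine mul_le_mul_of_nonneg_left ?_ zero_le_two
  rw [Real.rpow_ofNat, Real.rpow_ofNat, one_div_mul_one_div]
  have k1 := key p.1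
  have k2 := key p.2
  have l1 := hle p.1
  have l2 := hle p.2
  apply one_div_le_one_div_of_le (by positivity)
  calc _ ≤ (2 + a + b) ^ 2 * (2 + a + b) ^ 2 := by
        gcongr <;> linarith
    _ = _ := by ring

section

variable {Ω : Type*} [MeasurableSpace Ω] {P : Measure Ω}

theorem HasSubgaussianMGF.mono {X : Ω → ℝ} {c c' : ℝ≥0} (h : HasSubgaussianMGF X c P)
    (hc : c ≤ c') : HasSubgaussianMGF X c' P :=
  ⟨h.integrable_exp_mul, fun t => (h.mgf_le t).trans (by gcongr)⟩

/-- A Chernoff bound for each interval and Borel–Cantelli over the countably many intervals. Almost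
surely only finitely many of them violate the bound with constant `K`, and these are absorbed into
the constant of the realization. -/
theorem ae_controlledSums_of_subgaussian [IsProbabilityMeasure P] {X : ℤ → Ω → ℝ} {c : ℝ≥0}
    (hc : 0 < c)
    (hX : ∀ m n : ℤ, HasSubgaussianMGF (fun ω => ∑ i ∈ Finset.Ico m n, X i ω)
      (c * (n - m).toNat) P) :
    ∀ᵐ ω ∂P, ControlledSums (fun i => X i ω) := by
  -- With `K² = 8c` and variance proxy `c (n - m)`, the exponent of the tail bound is `-4 log(2 +
  -- |m| + |n|)`, which is summable over pairs.
  set K : ℝ := √(8 * c) with hK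
  have hK0 : 0 ≤ K := Real.sqrt_nonneg _
  set W : ℤ × ℤ → ℝ := fun p => √((p.2 - p.1) * Real.log (2 + |(p.1 : ℝ)| + |(p.2 : ℝ)|)) with hW
  set s : ℤ × ℤ → Set Ω := fun p =>
    {ω | p.1 < p.2 ∧ K * W p ≤ |∑ i ∈ Finset.Ico p.1 p.2, X i ω|} with hs
  have hlog : ∀ p : ℤ × ℤ, 0 < Real.log (2 + |(p.1 : ℝ)| + |(p.2 : ℝ)|) := fun p =>
    Real.log_pos (by have := abs_nonneg (p.1 : ℝ); have := abs_nonneg (p.2 : ℝ); linarith)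
  have hmeas : ∀ p, P (s p) ≤ ENNReal.ofReal
      (2 * Real.exp (-4 * Real.log (2 + |(p.1 : ℝ)| + |(p.2 : ℝ)|))) := by
    intro p
    by_cases hp : p.1 < p.2
    · have hpr : (0 : ℝ) < p.2 - p.1 := sub_pos.mpr (by exact_mod_cast hp)
      have h0 : 0 ≤ K * W p := by positivity
      have hexp : Real.exp (-(K * W p) ^ 2 / (2 * ((c * (p.2 - p.1).toNat : ℝ≥0) : ℝ))) =
          Real.exp (-4 * Real.log (2 + |(p.1 : ℝ)| + |(p.2 : ℝ)|)) := by
        congr 1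
        have hcast : (((p.2 - p.1).toNat : ℕ) : ℝ) = (p.2 : ℝ) - p.1 := by
          rw [← Int.cast_natCast (R := ℝ), Int.toNat_of_nonneg (by omega)]
          push_cast
          ring
        have hcr : (0 : ℝ) < c := hc
        rw [NNReal.coe_mul, NNReal.coe_natCast, hcast, mul_pow, hK, hW,
          Real.sq_sqrt (by positivity), Real.sq_sqrt (mul_nonneg hpr.le (hlog p).le)]
        field_simp
        ring
      have h1 := (hX p.1 p.2).measure_ge_le h0
      have h2 := (hX p.1 p.2).neg.measure_ge_le h0
      rw [hexp] at h1 h2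
      have hsub : s p ⊆ {ω | K * W p ≤ ∑ i ∈ Finset.Ico p.1 p.2, X i ω} ∪
          {ω | K * W p ≤ (-fun ω => ∑ i ∈ Finset.Ico p.1 p.2, X i ω) ω} := by
        rintro ω ⟨_, hω⟩
        rcases le_abs.mp hω with h | h
        · exact Or.inl h
        · exact Or.inr h
      rw [← ofReal_measureReal]
      apply ENNReal.ofReal_le_ofReal
      calc P.real (s p) ≤ _ := measureReal_mono hsub
        _ ≤ _ := measureReal_union_le _ _
        _ ≤ _ := by linarith
    · have : s p = ∅ := by ext ω; simp [hs, hp]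
      rw [this, measure_empty]
      exact zero_le
  have hsum : ∑' p, P (s p) ≠ ∞ :=
    ((ENNReal.tsum_le_tsum hmeas).trans_lt summable_int_prod_log.tsum_ofReal_lt_top).ne
  filter_upwards [ae_finite_setOfPred_mem hsum] with ω hω
  refine ⟨K + ∑ p ∈ hω.toFinset, |∑ i ∈ Finset.Ico p.1 p.2, X i ω| / W p,
    add_nonneg hK0 (Finset.sum_nonneg fun p _ => by positivity), fun m n hmn => ?_⟩
  rcases hmn.eq_or_lt with rfl | hlt
  · simp
  have hWpos : 0 < W (m, n) :=
    Real.sqrt_pos.mpr (mul_pos (sub_pos.mpr (by exact_mod_cast hlt)) (hlog (m, n)))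
  change |∑ i ∈ Finset.Ico m n, X i ω| ≤ _ * W (m, n)
  by_cases hmem : ω ∈ s (m, n)
  · rw [add_mul]
    have h1 := Finset.single_le_sum
      (f := fun p : ℤ × ℤ => |∑ i ∈ Finset.Ico p.1 p.2, X i ω| / W p)
      (fun p _ => by positivity) (hω.mem_toFinset.mpr hmem)
    have h2 := mul_le_mul_of_nonneg_right h1 hWpos.le
    simp only at h2
    rw [div_mul_cancel₀ _ hWpos.ne'] at h2
    have h3 : 0 ≤ K * W (m, n) := by positivity
    linarith
  · have h1 : |∑ i ∈ Finset.Ico m n, X i ω| < K * W (m, n) := by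
      by_contra hcon
      exact hmem ⟨hlt, not_lt.mp hcon⟩
    refine h1.le.trans (mul_le_mul_of_nonneg_right ?_ hWpos.le)
    exact le_add_of_nonneg_right (Finset.sum_nonneg fun p _ => by positivity)

theorem ae_controlledSums_of_iIndepFun [IsProbabilityMeasure P] {X : ℤ → Ω → ℝ}
    (hm : ∀ i, Measurable (X i)) (hi : iIndepFun X P) {b : ℝ} (hb : 0 < b)
    (hX : ∀ i, ∀ᵐ ω ∂P, |X i ω| ≤ b) (h0 : ∀ i, ∫ ω, X i ω ∂P = 0) :
    ∀ᵐ ω ∂P, ControlledSums (fun i => X i ω) := by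
  have hsg : ∀ i, HasSubgaussianMGF (X i) ((‖b - -b‖₊ / 2) ^ 2) P := fun i =>
    hasSubgaussianMGF_of_mem_Icc_of_integral_eq_zero (hm i).aemeasurable
      ((hX i).mono fun ω h => abs_le.mp h) (h0 i)
  refine ae_controlledSums_of_subgaussian (c := (‖b - -b‖₊ / 2) ^ 2) ?_ fun m n => ?_
  · have : b - -b ≠ 0 := by linarith
    exact pow_pos (div_pos (nnnorm_pos.mpr this) two_pos) 2
  · have := HasSubgaussianMGF.sum_of_iIndepFun hi (c := fun _ => (‖b - -b‖₊ / 2) ^ 2)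
      (s := Finset.Ico m n) (fun i _ => hsg i)
    rw [Finset.sum_const, Int.card_Ico, nsmul_eq_mul, mul_comm] at this
    exact this

/-- Neighbouring products share a factor. When no two elements of `s` are consecutive, the pairs
`{i, i + 1}` are disjoint, the products are independent, and their variance proxies add. -/
theorem hasSubgaussianMGF_sum_mul_succ {X : ℤ → Ω → ℝ} (hm : ∀ i, Measurable (X i))
    (hi : iIndepFun X P) {c : ℝ≥0} (hc : ∀ i, HasSubgaussianMGF (fun ω => X i ω * X (i + 1) ω) c P)
    (s : Finset ℤ) (hs : ∀ i ∈ s, i + 1 ∉ s) :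
    HasSubgaussianMGF (fun ω => ∑ i ∈ s, X i ω * X (i + 1) ω) (c * s.card) P := by
  have := hi.isProbabilityMeasure
  induction s using Finset.induction_on with
  | empty => simp
  | insert a s ha ih =>
    have hs' : ∀ i ∈ s, i + 1 ∉ s := fun i hi h =>
      hs i (Finset.mem_insert_of_mem hi) (Finset.mem_insert_of_mem h)
    set S : Finset ℤ := s ∪ s.image (· + 1) with hS
    set T : Finset ℤ := {a, a + 1} with hT
    have hdisj : Disjoint T S := by
      rw [Finset.disjoint_left]
      intro j hj hjS
      simp only [hT, Finset.mem_insert, Finset.mem_singleton] at hj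
      simp only [hS, Finset.mem_union, Finset.mem_image] at hjS
      rcases hj with rfl | rfl
      · rcases hjS with h | ⟨k, hk, hkj⟩
        · exact ha h
        · exact hs k (Finset.mem_insert_of_mem hk) (by rw [hkj]; exact Finset.mem_insert_self _ _)
      · rcases hjS with h | ⟨k, hk, hkj⟩
        · exact hs a (Finset.mem_insert_self _ _) (Finset.mem_insert_of_mem h)
        · have : k = a := by omega
          exact ha (this ▸ hk)
    have hind := hi.indepFun_finset T S hdisj hm
    have haT : a ∈ T := by simp [hT]
    have haT' : a + 1 ∈ T := by simp [hT]
    have hsS : ∀ i ∈ s, i ∈ S := fun i hi => by simp [hS, hi]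
    have hsS' : ∀ i ∈ s, i + 1 ∈ S := fun i hi => by simp [hS, hi]
    have hind2 := hind.comp (φ := fun x : T → ℝ => x ⟨a, haT⟩ * x ⟨a + 1, haT'⟩)
      (ψ := fun x : S → ℝ => ∑ i : s, x ⟨i, hsS i i.2⟩ * x ⟨i + 1, hsS' i i.2⟩)
      (by fun_prop) (by fun_prop)
    have hsum : (fun x : S → ℝ => ∑ i : s, x ⟨i, hsS i i.2⟩ * x ⟨i + 1, hsS' i i.2⟩) ∘
        (fun ω (i : S) => X i ω) = fun ω => ∑ i ∈ s, X i ω * X (i + 1) ω := by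
      funext ω
      exact Finset.sum_coe_sort s (fun i => X i ω * X (i + 1) ω)
    rw [hsum] at hind2
    have h1 := (hc a).add_of_indepFun (ih hs') hind2
    have h2 : HasSubgaussianMGF (fun ω => ∑ i ∈ insert a s, X i ω * X (i + 1) ω)
        (c + c * s.card) P := by
      refine h1.congr (ae_of_all _ fun ω => ?_)
      exact (Finset.sum_insert (f := fun i => X i ω * X (i + 1) ω) ha).symm
    rw [Finset.card_insert_of_notMem ha]
    push_cast
    rwa [mul_add, mul_one, add_comm (c * _)]

/-- The sum is split into even and odd indices, and neither class contains consecutive integers. -/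
theorem ae_controlledSums_mul_succ [IsProbabilityMeasure P] {X : ℤ → Ω → ℝ}
    (hm : ∀ i, Measurable (X i)) (hi : iIndepFun X P) {b : ℝ} (hb : 0 < b)
    (hX : ∀ i, ∀ᵐ ω ∂P, |X i ω| ≤ b) (h0 : ∀ i, ∫ ω, X i ω ∂P = 0) :
    ∀ᵐ ω ∂P, ControlledSums (fun i => X i ω * X (i + 1) ω) := by
  have hbb : 0 < b * b := by positivity
  set c : ℝ≥0 := (‖b * b - -(b * b)‖₊ / 2) ^ 2
  have hcpos : 0 < c := by
    have : b * b - -(b * b) ≠ 0 := by linarith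
    exact pow_pos (div_pos (nnnorm_pos.mpr this) two_pos) 2
  have hsg : ∀ i, HasSubgaussianMGF (fun ω => X i ω * X (i + 1) ω) c P := by
    intro i
    refine hasSubgaussianMGF_of_mem_Icc_of_integral_eq_zero
      ((hm i).mul (hm (i + 1))).aemeasurable ?_ ?_
    · filter_upwards [hX i, hX (i + 1)] with ω h1 h2
      apply abs_le.mp
      rw [abs_mul]
      exact mul_le_mul h1 h2 (abs_nonneg _) hb.le
    · rw [(hi.indepFun (by omega : i ≠ i + 1)).integral_fun_mul_eq_mul_integral
        (hm i).aestronglyMeasurable (hm (i + 1)).aestronglyMeasurable, h0, zero_mul]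
  have half : ∀ p : ℤ → Prop, ∀ _ : DecidablePred p, (∀ i, p i → ¬ p (i + 1)) →
      ∀ᵐ ω ∂P, ControlledSums (fun i => if p i then X i ω * X (i + 1) ω else 0) := by
    intro p _ hp
    refine ae_controlledSums_of_subgaussian (X := fun i ω => if p i then X i ω * X (i + 1) ω else 0)
      hcpos fun m n => ?_
    have h1 := hasSubgaussianMGF_sum_mul_succ hm hi hsg ((Finset.Ico m n).filter p) fun i hi hi' =>
      hp i (Finset.mem_filter.mp hi).2 (Finset.mem_filter.mp hi').2
    simp only [Finset.sum_filter] at h1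
    refine HasSubgaussianMGF.mono h1 ?_
    gcongr
    rw [← Int.card_Ico]
    exact Finset.card_filter_le _ _
  filter_upwards [half (fun i => Even i) inferInstance (fun i h => by simp [h, parity_simps]),
    half (fun i => ¬ Even i) inferInstance (fun i h => by simp [h, parity_simps])] with ω h1 h2
  convert h1.add h2 using 1
  ext i
  by_cases h : Even i <;> simp [h]

end

/-! ### Autoregressive recursions -/

/-- Let `A = α/(1 - r)`. Above this level the damping removes at least `α` per step, so from the
last time `m` at or below `A` onwards `x` exceeds `A` by at most the sum of the forcing minus `α (n
- m)`, and this is at most `β`. -/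
theorem le_of_autoregressive {r s α β : ℝ} {x z : ℕ → ℝ} (hr0 : 0 ≤ r) (hr1 : r < 1)
    (hα : 0 ≤ α) (h0 : x 0 = 0) (hx : ∀ n, x (n + 1) = r * x n + s * z n) {N : ℕ}
    (hz : ∀ m n, m ≤ n → n ≤ N →
      s * (∑ i ∈ Finset.range n, z i - ∑ i ∈ Finset.range m, z i) ≤ α * (n - m) + β) :
    ∀ n ≤ N, x n ≤ α / (1 - r) + β := by
  have h1r : 0 < 1 - r := by linarith
  set A := α / (1 - r) with hA
  have hA0 : 0 ≤ A := by positivity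
  have hrA : r * A = A - α := by rw [hA]; field_simp; ring
  have key : ∀ n, ∃ m ≤ n, x n ≤ A - α * (n - m) +
      s * (∑ i ∈ Finset.range n, z i - ∑ i ∈ Finset.range m, z i) := by
    intro n
    induction n with
    | zero => exact ⟨0, le_rfl, by simp [h0, hA0]⟩
    | succ n ih =>
      by_cases h : x (n + 1) ≤ A
      · exact ⟨n + 1, le_rfl, by simpa using h⟩
      by_cases h' : x n ≤ A
      · refine ⟨n, Nat.le_succ n, ?_⟩
        rw [hx, Finset.sum_range_succ]
        push_cast
        nlinarith [mul_le_mul_of_nonneg_left h' hr0]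
      · obtain ⟨m, hm, hxm⟩ := ih
        refine ⟨m, hm.trans (Nat.le_succ n), ?_⟩
        rw [hx, Finset.sum_range_succ]
        push_cast
        have : r * x n ≤ x n - α := by
          have : α ≤ (1 - r) * x n := by
            rw [hA] at h'
            rw [mul_comm]
            exact ((div_lt_iff₀ h1r).mp (not_le.mp h')).le
          linarith
        nlinarith
  intro n hn
  obtain ⟨m, hm, hxm⟩ := key n
  linarith [hz m n hm hn]

/-- With `l = √(1 - r)`, the inequality `√k ≤ l k/2 + 1/(2l)` turns square root growth of the sums
into a drift `α = L l/2` and an offset `β = L/(2l)`. Then `α/(1 - r)` equals `β`, and the total is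
`L/l`. The lower bound is the same statement for `-x`. -/
theorem abs_le_of_autoregressive {r s L : ℝ} {x z : ℕ → ℝ} (hr0 : 0 ≤ r) (hr1 : r < 1)
    (hs : |s| ≤ 1) (hL : 0 ≤ L) (h0 : x 0 = 0) (hx : ∀ n, x (n + 1) = r * x n + s * z n) {N : ℕ}
    (hz : ∀ m n, m ≤ n → n ≤ N →
      |∑ i ∈ Finset.range n, z i - ∑ i ∈ Finset.range m, z i| ≤ L * √((n : ℝ) - m)) :
    ∀ n ≤ N, |x n| ≤ L / √(1 - r) := by
  have h1r : 0 < 1 - r := by linarith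
  set l := √(1 - r) with hl
  have hl0 : 0 < l := Real.sqrt_pos.mpr h1r
  have hll : l * l = 1 - r := Real.mul_self_sqrt h1r.le
  have hb : ∀ m n, m ≤ n → n ≤ N →
      |s * (∑ i ∈ Finset.range n, z i - ∑ i ∈ Finset.range m, z i)| ≤
        L * l / 2 * (n - m) + L / (2 * l) := by
    intro m n hm hn
    have hnm : (0 : ℝ) ≤ (n : ℝ) - m := sub_nonneg.mpr (by exact_mod_cast hm)
    rw [abs_mul]
    have h1 := hz m n hm hn
    have h2 : √((n : ℝ) - m) ≤ l / 2 * (n - m) + 1 / (2 * l) := by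
      have h3 := Real.sq_sqrt hnm
      have h4 : l / 2 * ((n : ℝ) - m) + 1 / (2 * l) - √((n : ℝ) - m)
          = (l * √((n : ℝ) - m) - 1) ^ 2 / (2 * l) := by
        calc _ = l / 2 * √((n : ℝ) - m) ^ 2 + 1 / (2 * l) - √((n : ℝ) - m) := by rw [h3]
          _ = _ := by field_simp; ring
      have : 0 ≤ (l * √((n : ℝ) - m) - 1) ^ 2 / (2 * l) := by positivity
      linarith
    calc _ ≤ 1 * (L * √((n : ℝ) - m)) := by gcongr
      _ ≤ 1 * (L * (l / 2 * (n - m) + 1 / (2 * l))) := by gcongr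
      _ = _ := by ring
  have hfin : L * l / 2 / (1 - r) + L / (2 * l) = L / l := by
    rw [← hll]; field_simp; ring
  intro n hn
  rw [abs_le, ← hfin]
  constructor
  · have := le_of_autoregressive (x := fun n => -x n) (s := -s) (z := z) (β := L / (2 * l)) hr0 hr1
      (by positivity : 0 ≤ L * l / 2) (by simp [h0])
      (fun n => by rw [hx]; ring) (fun m n hm hn => by
        have := (abs_le.mp (hb m n hm hn)).1
        rw [neg_mul]; linarith) n hn
    linarith
  · exact le_of_autoregressive (β := L / (2 * l)) hr0 hr1
      (by positivity : 0 ≤ L * l / 2) h0 hx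
      (fun m n hm hn => (le_abs_self _).trans (hb m n hm hn)) n hn

theorem abs_le_of_autoregressive_bounded {r s B : ℝ} {x z : ℕ → ℝ} (hr0 : 0 ≤ r) (hr1 : r < 1)
    (hs : |s| ≤ 1) (h0 : x 0 = 0) (hx : ∀ n, x (n + 1) = r * x n + s * z n)
    (hz : ∀ n, |z n| ≤ B) (n : ℕ) : |x n| ≤ B / (1 - r) := by
  have h1r : 0 < 1 - r := by linarith
  have hB : 0 ≤ B := (abs_nonneg _).trans (hz 0)
  induction n with
  | zero => rw [h0, abs_zero]; positivity
  | succ n ih =>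
    rw [hx]
    calc |r * x n + s * z n| ≤ r * |x n| + |s| * |z n| := by
          refine (abs_add_le _ _).trans_eq ?_
          rw [abs_mul, abs_mul, abs_of_nonneg hr0]
      _ ≤ r * (B / (1 - r)) + 1 * B := by gcongr; exact hz n
      _ = B / (1 - r) := by field_simp; ring

/-- A two-sided autoregressive process driven by `w`, with rate at least `ε / 2`. -/
structure IsTwoSidedAR (ε : ℝ) (w γ : ℤ → ℝ) : Prop where
  zero : γ 0 = 0
  right : ∃ r s : ℝ, 0 ≤ r ∧ ε / 2 ≤ 1 - r ∧ |s| ≤ 1 ∧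
    ∀ n : ℕ, γ (n + 1) = r * γ n + s * w n
  left : ∃ r s : ℝ, 0 ≤ r ∧ ε / 2 ≤ 1 - r ∧ |s| ≤ 1 ∧
    ∀ n : ℕ, γ (-(n + 1)) = r * γ (-n) + s * w (-n - 1)

namespace IsTwoSidedAR

variable {ε : ℝ} {w γ : ℤ → ℝ}

/-- The crude bound, uniform over all sites and with no logarithm; it uses only that the drive is
bounded. -/
theorem abs_le (h : IsTwoSidedAR ε w γ) (hε : 0 < ε) {B : ℝ} (hw : ∀ j, |w j| ≤ B) (j : ℤ) :
    |γ j| ≤ 2 * B / ε := by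
  have hB : 0 ≤ B := (abs_nonneg _).trans (hw 0)
  have hfin : ∀ r : ℝ, ε / 2 ≤ 1 - r → B / (1 - r) ≤ 2 * B / ε := fun r hr => by
    rw [div_le_div_iff₀ (by linarith) hε]; nlinarith
  obtain ⟨n, rfl | rfl⟩ := j.eq_nat_or_neg
  · obtain ⟨r, s, hr0, hr1, hs, hx⟩ := h.right
    exact (abs_le_of_autoregressive_bounded (x := fun n => γ n) (z := fun n => w n) hr0
      (by linarith) hs (by simpa using h.zero) (fun n => by simpa using hx n) (fun n => hw n)
      n).trans (hfin r hr1)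
  · obtain ⟨r, s, hr0, hr1, hs, hx⟩ := h.left
    exact (abs_le_of_autoregressive_bounded (x := fun n => γ (-n)) (z := fun n => w (-n - 1)) hr0
      (by linarith) hs (by simpa using h.zero) (fun n => by simpa using hx n) (fun n => hw _)
      n).trans (hfin r hr1)

/-- Up to the site `j` only sums over intervals inside `[-|j|, |j|]` enter, so the logarithm can be
frozen at `2 + 2|j|`; the rate at least `ε/2` produces the factor `2/ε`. -/
theorem sq_le_log {C : ℝ} (hC : 0 ≤ C)
    (hw : ∀ m n : ℤ, m ≤ n → |∑ i ∈ Finset.Ico m n, w i| ≤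
      C * √((n - m) * Real.log (2 + |(m : ℝ)| + |(n : ℝ)|)))
    (h : IsTwoSidedAR ε w γ) (hε : 0 < ε) (j : ℤ) :
    γ j ^ 2 ≤ 2 * C ^ 2 * Real.log (2 + 2 * |(j : ℝ)|) / ε := by
  have hlog : ∀ N : ℕ, 0 ≤ Real.log (2 + 2 * N) := fun N =>
    Real.log_nonneg (by have : (0 : ℝ) ≤ N := N.cast_nonneg; linarith)
  have hL : ∀ N m n : ℕ, m ≤ n → n ≤ N →
      C * √(((n : ℝ) - m) * Real.log (2 + |(m : ℝ)| + |(n : ℝ)|)) ≤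
        C * √(Real.log (2 + 2 * N)) * √((n : ℝ) - m) := by
    intro N m n hm hn
    have hm' : (m : ℝ) ≤ n := by exact_mod_cast hm
    have hn' : (n : ℝ) ≤ N := by exact_mod_cast hn
    rw [mul_assoc, ← Real.sqrt_mul (hlog N), mul_comm (Real.log _)]
    rw [Nat.abs_cast, Nat.abs_cast]
    have : (0 : ℝ) ≤ m := m.cast_nonneg
    refine mul_le_mul_of_nonneg_left (Real.sqrt_le_sqrt (mul_le_mul_of_nonneg_left
      (Real.log_le_log (by linarith) (by linarith)) (by linarith))) hC
  have hfin : ∀ (N : ℕ) (r y : ℝ), ε / 2 ≤ 1 - r →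
      |y| ≤ C * √(Real.log (2 + 2 * N)) / √(1 - r) →
      y ^ 2 ≤ 2 * C ^ 2 * Real.log (2 + 2 * N) / ε := by
    intro N r y hr hy
    have h1r : 0 < 1 - r := by linarith
    have h1 := pow_le_pow_left₀ (abs_nonneg y) hy 2
    rw [sq_abs, div_pow, mul_pow, Real.sq_sqrt (hlog N), Real.sq_sqrt h1r.le] at h1
    refine h1.trans ?_
    rw [div_le_div_iff₀ h1r hε]
    have := mul_nonneg (sq_nonneg C) (hlog N)
    nlinarith
  obtain ⟨n, rfl | rfl⟩ := j.eq_nat_or_neg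
  · obtain ⟨r, s, hr0, hr1, hs, hx⟩ := h.right
    have := abs_le_of_autoregressive (x := fun n => γ n) (z := fun n => w n) (N := n)
      (L := C * √(Real.log (2 + 2 * n))) hr0
      (by linarith) hs (by positivity) (by simpa using h.zero) (fun n => by simpa using hx n)
      (fun a b hab hb => by
        rw [← Finset.sum_Ico_eq_sub _ hab]
        have e : ∑ i ∈ Finset.Ico a b, w i = ∑ i ∈ Finset.Ico (a : ℤ) b, w i := by
          refine Finset.sum_nbij (fun i => (i : ℤ)) (fun i hi => ?_) (fun i _ j _ hij => ?_)
            (fun i hi => ?_) (fun i _ => rfl)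
          · simp only [Finset.mem_Ico] at hi ⊢; omega
          · simpa using hij
          · simp only [Finset.coe_Ico, mem_Ico] at hi
            exact ⟨i.toNat, by simp only [Finset.coe_Ico, mem_Ico]; omega, by
              simp only; omega⟩
        rw [e]
        have := hw a b (by exact_mod_cast hab)
        push_cast at this
        exact this.trans (hL n a b hab hb)) n le_rfl
    simpa using hfin n r _ hr1 this
  · obtain ⟨r, s, hr0, hr1, hs, hx⟩ := h.left
    have := abs_le_of_autoregressive (x := fun n => γ (-n)) (z := fun n => w (-n - 1)) (N := n)
      (L := C * √(Real.log (2 + 2 * n))) hr0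
      (by linarith) hs (by positivity) (by simpa using h.zero) (fun n => by simpa using hx n)
      (fun a b hab hb => by
        rw [← Finset.sum_Ico_eq_sub _ hab]
        -- The reflection `i ↦ -i - 1` turns a sum along the left half-line into one over an
        -- interval to which the hypothesis applies.
        have e : ∑ i ∈ Finset.Ico a b, w (-i - 1) = ∑ i ∈ Finset.Ico (-b : ℤ) (-a), w i := by
          refine Finset.sum_nbij (fun i => (-i - 1 : ℤ)) (fun i hi => ?_) (fun i _ j _ hij => ?_)
            (fun i hi => ?_) (fun i _ => rfl)
          · simp only [Finset.mem_Ico] at hi ⊢; omega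
          · simpa using hij
          · simp only [Finset.coe_Ico, mem_Ico] at hi
            exact ⟨(-i - 1).toNat, by simp only [Finset.coe_Ico, mem_Ico]; omega, by
              simp only; omega⟩
        rw [e]
        have := hw (-b) (-a) (by omega)
        push_cast at this
        rw [abs_neg, abs_neg, neg_sub_neg, add_assoc, add_comm |(b : ℝ)|, ← add_assoc] at this
        exact this.trans (hL n a b hab hb)) n le_rfl
    simpa using hfin n r _ hr1 this

/-- Here `s` stands for the centre `±εt` of a wave. Since `|j| ≤ (|εj - s| + T₀/ε²)/ε`, the
logarithm is at most `3 |ln ε|` plus a term linear in `|εj - s|`, which the weight absorbs; taking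
`ε < 1/2` keeps `|ln ε|` above `log 2`, so that constants are absorbed too. -/
theorem exists_sq_le {γ : ℝ → ℤ → ℝ} (hw : ControlledSums w)
    (h : ∀ ε ∈ Ioo (0 : ℝ) 1, IsTwoSidedAR ε w (γ ε)) {T₀ : ℝ} (hT₀ : 0 < T₀) :
    ∃ C, 0 < C ∧ ∀ ε ∈ Ioo (0 : ℝ) (1 / 2), ∀ s, |s| ≤ T₀ / ε ^ 2 → ∀ j : ℤ,
      γ ε j ^ 2 ≤ C * (|Real.log ε| / ε) * (1 + (ε * j - s) ^ 2) := by
  obtain ⟨C, hC0, hC⟩ := hw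
  have hl2 : 0 < Real.log 2 := Real.log_pos one_lt_two
  refine ⟨2 * C ^ 2 * (3 + (3 + 2 * T₀) / Real.log 2) + 1, by positivity, ?_⟩
  intro ε hε s hs j
  have hε0 := hε.1
  have h1 := sq_le_log hC0 hC (h ε ⟨hε.1, hε.2.trans (by norm_num)⟩) hε0 j
  set X := ε * j - s with hX
  set l := |Real.log ε| with hldef
  have hlneg : Real.log ε ≤ -Real.log 2 := by
    rw [← Real.log_inv]
    exact Real.log_le_log hε0 (by have := hε.2; norm_num at this ⊢; linarith)
  have hl : l = -Real.log ε := abs_of_neg (by linarith)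
  have hl2l : Real.log 2 ≤ l := by rw [hl]; linarith
  have hε1 : ε < 1 := hε.2.trans (by norm_num)
  have hj : |(j : ℝ)| ≤ (|X| + T₀ / ε ^ 2) / ε := by
    rw [le_div_iff₀ hε0]
    have : (j : ℝ) * ε = X + s := by rw [hX]; ring
    calc |(j : ℝ)| * ε = |(j : ℝ) * ε| := by rw [abs_mul, abs_of_pos hε0]
      _ ≤ |X| + |s| := by rw [this]; exact abs_add_le _ _
      _ ≤ _ := by linarith
  have hlog : Real.log (2 + 2 * |(j : ℝ)|) ≤ (3 + (3 + 2 * T₀) / Real.log 2) * l * (1 + X ^ 2) := by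
    have hle : 2 + 2 * |(j : ℝ)| ≤ (2 + 2 * |X| + 2 * T₀) * (ε ^ 3)⁻¹ := by
      rw [← div_eq_mul_inv, le_div_iff₀ (by positivity)]
      rw [le_div_iff₀ hε0] at hj
      have e : T₀ / ε ^ 2 * ε ^ 2 = T₀ := div_mul_cancel₀ _ (by positivity)
      have h3 : ε ^ 3 ≤ 1 := pow_le_one₀ hε0.le hε1.le
      have h2 : ε ^ 2 ≤ 1 := pow_le_one₀ hε0.le hε1.le
      have h4 : |(j : ℝ)| * ε * ε ^ 2 ≤ |X| + T₀ := by
        calc |(j : ℝ)| * ε * ε ^ 2 ≤ (|X| + T₀ / ε ^ 2) * ε ^ 2 := by gcongr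
          _ = |X| * ε ^ 2 + T₀ := by rw [add_mul, e]
          _ ≤ |X| * 1 + T₀ := by gcongr
          _ = _ := by ring
      nlinarith
    have hX0 := abs_nonneg X
    have h5 : Real.log (2 + 2 * |(j : ℝ)|) ≤ (1 + 2 * |X| + 2 * T₀) + 3 * l := by
      refine (Real.log_le_log (by positivity) hle).trans ?_
      rw [Real.log_mul (by positivity) (by positivity), Real.log_inv, Real.log_pow, hl]
      have := Real.log_le_sub_one_of_pos (by positivity : 0 < 2 + 2 * |X| + 2 * T₀)
      push_cast
      linarith
    have h6 : 2 * |X| ≤ 1 + X ^ 2 := by rw [← sq_abs]; nlinarith [sq_nonneg (|X| - 1)]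
    have h7 : 1 + 2 * |X| + 2 * T₀ ≤ (3 + 2 * T₀) * (1 + X ^ 2) := by nlinarith [sq_nonneg X]
    have h8 : 3 + 2 * T₀ ≤ (3 + 2 * T₀) / Real.log 2 * l := by
      rw [div_mul_eq_mul_div, le_div_iff₀ hl2]
      gcongr
    have hl0 : 0 < l := hl2.trans_le hl2l
    calc _ ≤ _ := h5
      _ ≤ ((3 + 2 * T₀) / Real.log 2 * l) * (1 + X ^ 2) + 3 * l * (1 + X ^ 2) := by
          refine add_le_add (h7.trans (by gcongr)) ?_
          nlinarith [mul_nonneg hl0.le (sq_nonneg X)]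
      _ = _ := by ring
  refine h1.trans ?_
  have hl0 : 0 < l := hl2.trans_le hl2l
  calc 2 * C ^ 2 * Real.log (2 + 2 * |(j : ℝ)|) / ε
      ≤ 2 * C ^ 2 * ((3 + (3 + 2 * T₀) / Real.log 2) * l * (1 + X ^ 2)) / ε := by gcongr
    _ = 2 * C ^ 2 * (3 + (3 + 2 * T₀) / Real.log 2) * (l / ε) * (1 + X ^ 2) := by ring
    _ ≤ _ := by gcongr; linarith

end IsTwoSidedAR

/-- To the right the equation is an explicit recursion with factor `1 - ε`. To the left it is solved
for the far site and has factor `1/(1 + ε)`, whose rate `ε/(1 + ε)` is at least `ε/2`. -/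
theorem isTwoSidedAR_of_isAutoregressive₁ {ε : ℝ} (hε : ε ∈ Ioo (0 : ℝ) 1) {ζ γ : ℤ → ℝ}
    (h : IsAutoregressive₁ ε ζ γ) : IsTwoSidedAR ε (fun j => ζ j + ζ (j + 1)) γ := by
  obtain ⟨h0, h⟩ := h
  have hε0 := hε.1
  have hε1 := hε.2
  refine ⟨h0, ⟨1 - ε, -1, by linarith, by linarith, by simp, fun n => ?_⟩,
    ⟨1 / (1 + ε), 1 / (1 + ε), by positivity, ?_, ?_, fun n => ?_⟩⟩
  · have := h n
    rw [deltaPlus] at this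
    -- At the origin the sign is zero and there is no damping, but `γ 0 = 0`, so the factor there is
    -- immaterial.
    rcases Nat.eq_zero_or_pos n with rfl | hn
    · simp only [Nat.cast_zero, h0] at this ⊢
      linarith
    · rw [Int.sign_eq_one_of_pos (by exact_mod_cast hn)] at this
      push_cast at this
      linarith
  · rw [one_sub_div (by linarith), div_le_div_iff₀ (by norm_num) (by linarith)]
    nlinarith
  · rw [abs_of_pos (by positivity), div_le_one (by linarith)]
    linarith
  · have := h (-n - 1)
    rw [deltaPlus, Int.sign_eq_neg_one_of_neg (by omega)] at this
    simp only [sub_add_cancel] at this ⊢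
    rw [show (-((n : ℤ) + 1)) = -n - 1 by ring]
    push_cast at this
    field_simp
    linarith

/-- The left difference exchanges the roles of the two half-lines, and the step from `j` to `j + 1`
is driven by the noise read at `j + 1`. -/
theorem isTwoSidedAR_of_isAutoregressive₂ {σ ε : ℝ} (hε : ε ∈ Ioo (0 : ℝ) 1) {ζ γ : ℤ → ℝ}
    (h : IsAutoregressive₂ σ ε ζ γ) : IsTwoSidedAR ε (fun j => ζ (j + 1) + ζ (j + 1 - 1)
      + ζ (j + 1) * deltaPlus (deltaMinus ζ) (j + 1) + 2 * σ ^ 2) γ := by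
  obtain ⟨h0, h⟩ := h
  have hε0 := hε.1
  have hε1 := hε.2
  refine ⟨h0, ⟨1 / (1 + ε), 1 / (1 + ε), by positivity, ?_, ?_, fun n => ?_⟩,
    ⟨1 - ε, -1, by linarith, by linarith, by simp, fun n => ?_⟩⟩
  · rw [one_sub_div (by linarith), div_le_div_iff₀ (by norm_num) (by linarith)]
    nlinarith
  · rw [abs_of_pos (by positivity), div_le_one (by linarith)]
    linarith
  · have := h (n + 1)
    rw [deltaMinus, Int.sign_eq_one_of_pos (by omega)] at this
    simp only [add_sub_cancel_right] at this ⊢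
    push_cast at this
    field_simp
    linarith
  · have := h (-n)
    rw [deltaMinus] at this
    simp only [sub_add_cancel] at this ⊢
    rw [show (-((n : ℤ) + 1)) = -n - 1 by ring]
    rcases Nat.eq_zero_or_pos n with rfl | hn
    · simp only [Nat.cast_zero, neg_zero, h0] at this ⊢
      linarith
    · rw [Int.sign_eq_neg_one_of_neg (by omega)] at this
      push_cast at this
      linarith

/-! ### Almost sure properties of the noise -/

/-- Compactness gives a strict margin; it is what bounds the masses below by `1 - 4a > 0`. -/
theorem exists_subset_Icc_of_isClosed_subset_Ioo {S : Set ℝ} (hS : IsClosed S) {b : ℝ} (hb : 0 < b)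
    (h : S ⊆ Ioo (-b) b) : ∃ a, 0 ≤ a ∧ a < b ∧ ∀ x ∈ S, |x| ≤ a := by
  have hc : IsCompact S :=
    isCompact_Icc.of_isClosed_subset hS (h.trans Ioo_subset_Icc_self)
  rcases S.eq_empty_or_nonempty with rfl | hne
  · exact ⟨0, le_rfl, hb, by simp⟩
  · obtain ⟨y, hy, hmax⟩ := hc.exists_isMaxOn hne continuous_abs.continuousOn
    exact ⟨|y|, abs_nonneg y, abs_lt.mpr (h hy), fun x hx => hmax hx⟩

section

variable {Ω : Type*} [MeasurableSpace Ω] {P : Measure Ω}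

/-- The almost sure properties of the noise. -/
theorem TransparentFPUT.IsTransparentNoise.ae_properties [IsProbabilityMeasure P]
    {ζ : ℤ → Ω → ℝ} {σ : ℝ} (h : IsTransparentNoise P ζ σ) :
    ∃ a < (1 / 4 : ℝ), ∀ᵐ ω ∂P, (∀ j, |ζ j ω| ≤ a) ∧
      ControlledSums (fun j => ζ j ω + ζ (j + 1) ω) ∧
      ControlledSums (fun j => ζ (j + 1) ω + ζ (j + 1 - 1) ω
        + ζ (j + 1) ω * deltaPlus (deltaMinus fun i => ζ i ω) (j + 1) + 2 * σ ^ 2) := by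
  obtain ⟨a, ha0, ha, hbd⟩ := exists_subset_Icc_of_isClosed_subset_Ioo
    (Measure.isClosed_support (μ := P.map (ζ 0))) (by norm_num) (h.support_subset 0)
  have hmap : ∀ j, P.map (ζ j) = P.map (ζ 0) := fun j => (h.identDistrib j 0).map_eq
  have hae : ∀ j, ∀ᵐ ω ∂P, |ζ j ω| ≤ a := fun j => by
    have h1 : ∀ᵐ x ∂(P.map (ζ j)), x ∈ (P.map (ζ j)).support := Measure.support_mem_ae
    have h2 := ae_of_ae_map (h.measurable j).aemeasurable h1
    filter_upwards [h2] with ω hω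
    rw [hmap j] at hω
    exact hbd _ hω
  have hquarter : ∀ j, ∀ᵐ ω ∂P, |ζ j ω| ≤ 1 / 4 := fun j =>
    (hae j).mono fun ω hω => hω.trans ha.le
  have hint : ∀ j, Integrable (ζ j) P := fun j =>
    Integrable.of_bound (h.measurable j).aestronglyMeasurable (1 / 4) (hquarter j)
  have hsqint : ∀ j, Integrable (fun ω => ζ j ω ^ 2) P := fun j =>
    Integrable.of_bound ((h.measurable j).pow_const 2).aestronglyMeasurable (1 / 4)
      ((hquarter j).mono fun ω hω => by
        rw [Real.norm_eq_abs, abs_pow]; nlinarith [abs_nonneg (ζ j ω)])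
  have hsq : ∀ j, ∫ ω, (ζ j ω ^ 2 - σ ^ 2) ∂P = 0 := fun j => by
    have hv := h.variance_eq j
    rw [variance_of_integral_eq_zero (h.measurable j).aemeasurable (h.mean_zero j)] at hv
    rw [integral_sub (hsqint j) (integrable_const _), hv]
    simp
  have c1 := ae_controlledSums_of_iIndepFun h.measurable h.indep (by norm_num : (0 : ℝ) < 1 / 4)
    hquarter h.mean_zero
  have c2 := ae_controlledSums_mul_succ h.measurable h.indep (by norm_num : (0 : ℝ) < 1 / 4)
    hquarter h.mean_zero
  have c3 := ae_controlledSums_of_iIndepFun (X := fun j ω => ζ j ω ^ 2 - σ ^ 2)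
    (fun j => ((h.measurable j).pow_const 2).sub_const _)
    (h.indep.comp (fun _ x => x ^ 2 - σ ^ 2) fun _ => by fun_prop)
    (by positivity : (0 : ℝ) < 1 + σ ^ 2)
    (fun j => (hquarter j).mono fun ω hω => by
      have h1 : |ζ j ω| ^ 2 ≤ 1 := by nlinarith [abs_nonneg (ζ j ω)]
      rw [sq_abs] at h1
      rw [abs_le]
      constructor <;> nlinarith [sq_nonneg (ζ j ω), sq_nonneg σ]) hsq
  refine ⟨a, ha, ?_⟩
  filter_upwards [ae_all_iff.mpr hae, c1, c2, c3] with ω h1 h2 h3 h4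
  refine ⟨h1, h2.add (h2.shift (r := 1) (by simp)), ?_⟩
  have s2 := h2.shift (r := 1) (by simp)
  have s3 := h3.shift (r := 1) (by simp)
  have s4 := h4.shift (r := 1) (by simp)
  -- The quadratic part of the drive is a sum of two neighbouring products minus `2(ζ² - σ²)`, all
  -- of mean zero; the `2σ²` of the drive is exactly what centres the square.
  convert ((s2.add h2).add (s3.add h3)).add (s4.const_mul (-2)) using 1
  ext j
  simp only [deltaPlus, deltaMinus, add_sub_cancel_right]
  ring

end

/-! ### Functions of `(X, τ, T)` with dominated derivatives -/

/-- A time `t`, a scale `ε`, a site `j` and a point `y` near `ε j`. -/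
structure Pt where
  ε : ℝ
  t : ℝ
  y : ℝ
  j : ℤ

/-- The points with `|t| ≤ T₀ / ε³` and `|y - ε j| ≤ 1`. -/
def Pt.near (T₀ : ℝ) : Set Pt :=
  {i | i.ε ∈ Ioo (0 : ℝ) 1 ∧ i.t ∈ timeInterval T₀ i.ε ∧ |i.y - i.ε * i.j| ≤ 1}

/-- The value of a function of `(X, τ, T)` at `X = y`, `τ = ε t`, `T = ε³ t`. -/
noncomputable def Pt.eval (Φ : ℝ → ℝ → ℝ → ℝ) (i : Pt) : ℝ := Φ i.y (i.ε * i.t) (i.ε ^ 3 * i.t)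

theorem mul_mem_Icc_of_mem_timeInterval {T₀ ε t : ℝ} (hε : 0 < ε) (ht : t ∈ timeInterval T₀ ε) :
    ε ^ 3 * t ∈ Icc (-T₀) T₀ := by
  have h3 : 0 < ε ^ 3 := by positivity
  obtain ⟨h1, h2⟩ := ht
  rw [← neg_div, div_le_iff₀ h3] at h1
  rw [le_div_iff₀ h3] at h2
  constructor <;> linarith

/-- A function `Φ` of `(X, τ, T)` with its partial derivatives, all bounded by multiples of `H`.
The derivative in `T` is only taken along paths of constant `X`. -/
structure WaveField (T₀ : ℝ) (H : Pt → ℝ) (Φ ΦX Φτ ΦT : ℝ → ℝ → ℝ → ℝ) : Prop where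
  dX : ∀ T ∈ Icc (-T₀) T₀, ∀ X τ, HasDerivAt (fun x => Φ x τ T) (ΦX X τ T) X
  dτ : ∀ T ∈ Icc (-T₀) T₀, ∀ X τ, HasDerivAt (fun s => Φ X s T) (Φτ X τ T) τ
  dt : ∀ ε ∈ Ioo (0 : ℝ) 1, ∀ t ∈ timeInterval T₀ ε, ∀ y,
    HasDerivWithinAt (fun s => Φ y (ε * s) (ε ^ 3 * s))
      (ε * Φτ y (ε * t) (ε ^ 3 * t) + ε ^ 3 * ΦT y (ε * t) (ε ^ 3 * t)) (timeInterval T₀ ε) t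
  dom : Dom (Pt.near T₀) H (Pt.eval Φ)
  domX : Dom (Pt.near T₀) H (Pt.eval ΦX)
  domτ : Dom (Pt.near T₀) H (Pt.eval Φτ)
  domT : Dom (Pt.near T₀) H (Pt.eval ΦT)

namespace WaveField

variable {T₀ : ℝ} {H : Pt → ℝ} {Φ ΦX Φτ ΦT Ψ ΨX Ψτ ΨT : ℝ → ℝ → ℝ → ℝ}

theorem congr {Φ' ΦX' Φτ' : ℝ → ℝ → ℝ → ℝ} (h : WaveField T₀ H Φ ΦX Φτ ΦT)
    (h0 : ∀ X τ T, Φ X τ T = Φ' X τ T) (hX : ∀ X τ T, ΦX X τ T = ΦX' X τ T)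
    (hτ : ∀ X τ T, Φτ X τ T = Φτ' X τ T) : WaveField T₀ H Φ' ΦX' Φτ' ΦT := by
  have e0 : Φ = Φ' := by funext X τ T; exact h0 X τ T
  have e1 : ΦX = ΦX' := by funext X τ T; exact hX X τ T
  have e2 : Φτ = Φτ' := by funext X τ T; exact hτ X τ T
  rwa [← e0, ← e1, ← e2]

theorem add (h : WaveField T₀ H Φ ΦX Φτ ΦT) (h' : WaveField T₀ H Ψ ΨX Ψτ ΨT) :
    WaveField T₀ H (fun X τ T => Φ X τ T + Ψ X τ T) (fun X τ T => ΦX X τ T + ΨX X τ T)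
      (fun X τ T => Φτ X τ T + Ψτ X τ T) (fun X τ T => ΦT X τ T + ΨT X τ T) where
  dX T hT X τ := (h.dX T hT X τ).add (h'.dX T hT X τ)
  dτ T hT X τ := (h.dτ T hT X τ).add (h'.dτ T hT X τ)
  dt ε hε t ht y := ((h.dt ε hε t ht y).add (h'.dt ε hε t ht y)).congr_deriv (by ring)
  dom := h.dom.add h'.dom
  domX := h.domX.add h'.domX
  domτ := h.domτ.add h'.domτ
  domT := h.domT.add h'.domT

theorem const_mul (c : ℝ) (h : WaveField T₀ H Φ ΦX Φτ ΦT) :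
    WaveField T₀ H (fun X τ T => c * Φ X τ T) (fun X τ T => c * ΦX X τ T)
      (fun X τ T => c * Φτ X τ T) (fun X τ T => c * ΦT X τ T) where
  dX T hT X τ := (h.dX T hT X τ).const_mul c
  dτ T hT X τ := (h.dτ T hT X τ).const_mul c
  dt ε hε t ht y := ((h.dt ε hε t ht y).const_mul c).congr_deriv (by ring)
  dom := h.dom.const_mul c
  domX := h.domX.const_mul c
  domτ := h.domτ.const_mul c
  domT := h.domT.const_mul c

theorem sub (h : WaveField T₀ H Φ ΦX Φτ ΦT) (h' : WaveField T₀ H Ψ ΨX Ψτ ΨT) :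
    WaveField T₀ H (fun X τ T => Φ X τ T - Ψ X τ T) (fun X τ T => ΦX X τ T - ΨX X τ T)
      (fun X τ T => Φτ X τ T - Ψτ X τ T) (fun X τ T => ΦT X τ T - ΨT X τ T) where
  dX T hT X τ := (h.dX T hT X τ).sub (h'.dX T hT X τ)
  dτ T hT X τ := (h.dτ T hT X τ).sub (h'.dτ T hT X τ)
  dt ε hε t ht y := ((h.dt ε hε t ht y).sub (h'.dt ε hε t ht y)).congr_deriv (by ring)
  dom := h.dom.sub h'.dom
  domX := h.domX.sub h'.domX
  domτ := h.domτ.sub h'.domτ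
  domT := h.domT.sub h'.domT

/-- Only one factor needs to decay. The other may be merely bounded, which admits the primitives of
the waves. -/
theorem mul (h : WaveField T₀ H Φ ΦX Φτ ΦT) (h' : WaveField T₀ (fun _ => 1) Ψ ΨX Ψτ ΨT) :
    WaveField T₀ H (fun X τ T => Φ X τ T * Ψ X τ T)
      (fun X τ T => ΦX X τ T * Ψ X τ T + Φ X τ T * ΨX X τ T)
      (fun X τ T => Φτ X τ T * Ψ X τ T + Φ X τ T * Ψτ X τ T)
      (fun X τ T => ΦT X τ T * Ψ X τ T + Φ X τ T * ΨT X τ T) where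
  dX T hT X τ := (h.dX T hT X τ).mul (h'.dX T hT X τ)
  dτ T hT X τ := (h.dτ T hT X τ).mul (h'.dτ T hT X τ)
  dt ε hε t ht y := ((h.dt ε hε t ht y).mul (h'.dt ε hε t ht y)).congr_deriv (by ring)
  dom := h.dom.mul_bd (bd_iff_dom_one.mpr h'.dom)
  domX := (h.domX.mul_bd (bd_iff_dom_one.mpr h'.dom)).add
    (h.dom.mul_bd (bd_iff_dom_one.mpr h'.domX))
  domτ := (h.domτ.mul_bd (bd_iff_dom_one.mpr h'.dom)).add
    (h.dom.mul_bd (bd_iff_dom_one.mpr h'.domτ))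
  domT := (h.domT.mul_bd (bd_iff_dom_one.mpr h'.dom)).add
    (h.dom.mul_bd (bd_iff_dom_one.mpr h'.domT))

theorem one (h : WaveField T₀ H Φ ΦX Φτ ΦT) (hH : Bd (Pt.near T₀) H) :
    WaveField T₀ (fun _ => 1) Φ ΦX Φτ ΦT :=
  { h with
    dom := bd_iff_dom_one.mp (h.dom.bd hH)
    domX := bd_iff_dom_one.mp (h.domX.bd hH)
    domτ := bd_iff_dom_one.mp (h.domτ.bd hH)
    domT := bd_iff_dom_one.mp (h.domT.bd hH) }

end WaveField

/-! ### Taylor expansion around a site -/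

/-- Induction on the order: the derivative in `s` of the remainder is the remainder of one order
less for the shifted sequence. The bound is not divided by `n!`, which is not needed. -/
theorem abs_sub_taylor_le {n : ℕ} {F : ℕ → ℝ → ℝ} {x r K : ℝ}
    (hF : ∀ k < n, ∀ y, HasDerivAt (F k) (F (k + 1) y) y)
    (hK : ∀ y, |y - x| ≤ r → |F n y| ≤ K) {s : ℝ} (hs : |s| ≤ r) :
    |F 0 (x + s) - ∑ k ∈ Finset.range n, s ^ k / k.factorial * F k x| ≤ K * |s| ^ n := by
  induction n generalizing F s with
  | zero => simpa using hK (x + s) (by simpa using hs)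
  | succ n ih =>
    have hK0 : 0 ≤ K := (abs_nonneg _).trans (hK (x + s) (by simpa using hs))
    set g : ℝ → ℝ := fun u => F 0 (x + u) - ∑ k ∈ Finset.range (n + 1), u ^ k / k.factorial * F k x
    have hg : ∀ u, HasDerivAt g
        (F 1 (x + u) - ∑ k ∈ Finset.range n, u ^ k / k.factorial * F (k + 1) x) u := by
      intro u
      have h1 : HasDerivAt (fun u => F 0 (x + u)) (F 1 (x + u)) u :=
        (hF 0 (Nat.succ_pos n) (x + u)).comp_const_add x u
      refine h1.sub ?_
      have h2 : ∀ k ∈ Finset.range n, HasDerivAt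
          (fun u : ℝ => u ^ (k + 1) / (k + 1).factorial * F (k + 1) x)
          (u ^ k / k.factorial * F (k + 1) x) u := by
        intro k _
        refine (((hasDerivAt_pow (k + 1) u).div_const _).mul_const _).congr_deriv ?_
        rw [Nat.factorial_succ]
        have : ((k : ℝ) + 1) ≠ 0 := by positivity
        have : (k.factorial : ℝ) ≠ 0 := by positivity
        push_cast
        field_simp
      have h3 := (HasDerivAt.fun_sum h2).add_const (F 0 x)
      refine h3.congr_of_eventuallyEq (Eventually.of_forall fun u => ?_)
      simp only [Finset.sum_range_succ']
      simp
    have hbd : ∀ u ∈ Icc (-|s|) |s|,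
        ‖F 1 (x + u) - ∑ k ∈ Finset.range n, u ^ k / k.factorial * F (k + 1) x‖ ≤ K * |s| ^ n := by
      intro u hu
      have hu' : |u| ≤ |s| := abs_le.mpr hu
      refine (ih (F := fun k => F (k + 1)) (fun k hk y => hF (k + 1) (by omega) y) hK
        (hu'.trans hs)).trans ?_
      gcongr
    have := (convex_Icc (-|s|) |s|).norm_image_sub_le_of_norm_hasDerivWithin_le
      (fun u _ => (hg u).hasDerivWithinAt) hbd (x := 0) (y := s) (by simp)
      ⟨neg_abs_le s, le_abs_self s⟩
    have hg0 : g 0 = 0 := by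
      simp [g, Finset.sum_range_succ', zero_pow]
    rw [hg0, sub_zero, sub_zero, Real.norm_eq_abs, Real.norm_eq_abs, mul_assoc, ← pow_succ] at this
    exact this

/-- The majorant depends on the site and not on `y`, so one value bounds the top derivative along
the whole segment from `εj` to `εj + s`. -/
theorem exists_taylor_bound {T₀ : ℝ} {H : Pt → ℝ}
    (hH : ∀ ε t y y' j, H ⟨ε, t, y, j⟩ = H ⟨ε, t, y', j⟩) (n : ℕ) {F : ℕ → ℝ → ℝ → ℝ → ℝ}
    (hF : ∀ k < n, ∀ T ∈ Icc (-T₀) T₀, ∀ X τ, HasDerivAt (fun x => F k x τ T) (F (k + 1) X τ T) X)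
    (hn : Dom (Pt.near T₀) H (Pt.eval (F n))) :
    ∃ C, 0 ≤ C ∧ ∀ ε ∈ Ioo (0 : ℝ) 1, ∀ t ∈ timeInterval T₀ ε, ∀ j : ℤ, ∀ s, |s| ≤ ε →
      |F 0 (ε * j + s) (ε * t) (ε ^ 3 * t)
        - ∑ k ∈ Finset.range n, s ^ k / k.factorial * F k (ε * j) (ε * t) (ε ^ 3 * t)| ≤
        C * ε ^ n * H ⟨ε, t, ε * j, j⟩ := by
  obtain ⟨C, hC0, hC⟩ := hn
  refine ⟨C, hC0, fun ε hε t ht j s hs => ?_⟩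
  have hT := mul_mem_Icc_of_mem_timeInterval hε.1 ht
  have hb : ∀ y, |y - ε * j| ≤ 1 →
      |F n y (ε * t) (ε ^ 3 * t)| ≤ C * H ⟨ε, t, ε * j, j⟩ := fun y hy => by
    have := hC ⟨ε, t, y, j⟩ ⟨hε, ht, hy⟩
    rwa [hH ε t y (ε * j) j] at this
  have h1 := abs_sub_taylor_le (F := fun k x => F k x (ε * t) (ε ^ 3 * t)) (x := ε * j) (r := 1)
    (fun k hk y => hF k hk _ hT y _) hb (hs.trans hε.2.le)
  refine h1.trans ?_
  have h0 : 0 ≤ C * H ⟨ε, t, ε * j, j⟩ := (abs_nonneg _).trans (hb (ε * j) (by simp))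
  calc _ ≤ C * H ⟨ε, t, ε * j, j⟩ * ε ^ n := by gcongr
    _ = _ := by ring

/-! ### Counterpropagating waves and their correctors -/

/-- A pair of counterpropagating KdV waves with uniform bounds. -/
structure KdVPair (c T₀ : ℝ) (A B : ℝ → ℝ → ℝ) (MA MB : ℝ) (hA hB : ℝ → ℝ → ℝ) : Prop where
  pos : 0 < T₀
  boundsA : WaveBounds T₀ A MA hA
  boundsB : WaveBounds T₀ B MB hB
  eqA : ∀ T ∈ Icc (-T₀) T₀, ∀ x,
    HasDerivWithinAt (fun s => A x s) (timeJet (-1) c A 0 x T) (Icc (-T₀) T₀) T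
  eqB : ∀ T ∈ Icc (-T₀) T₀, ∀ x,
    HasDerivWithinAt (fun s => B x s) (timeJet 1 c B 0 x T) (Icc (-T₀) T₀) T

/-- The majorant of a pair of waves near the site `j` at time `t`. -/
noncomputable def majorant (hA hB : ℝ → ℝ → ℝ) (i : Pt) : ℝ :=
  hA (i.ε ^ 3 * i.t) (i.ε * i.j - i.ε * i.t) + hB (i.ε ^ 3 * i.t) (i.ε * i.j + i.ε * i.t)

/-- The spatial derivatives of `Q₀ = A + B`. -/
noncomputable def waveSum (A B : ℝ → ℝ → ℝ) (k : ℕ) (X τ T : ℝ) : ℝ :=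
  jet A k (X - τ) T + jet B k (X + τ) T

/-- The spatial derivatives of `P₀ = -A + B`. -/
noncomputable def waveDiff (A B : ℝ → ℝ → ℝ) (k : ℕ) (X τ T : ℝ) : ℝ :=
  -jet A k (X - τ) T + jet B k (X + τ) T

/-- The slow time derivative of `waveSum`. -/
noncomputable def waveSumT (c : ℝ) (A B : ℝ → ℝ → ℝ) (k : ℕ) (X τ T : ℝ) : ℝ :=
  timeJet (-1) c A k (X - τ) T + timeJet 1 c B k (X + τ) T

/-- The slow time derivative of `waveDiff`. -/
noncomputable def waveDiffT (c : ℝ) (A B : ℝ → ℝ → ℝ) (k : ℕ) (X τ T : ℝ) : ℝ :=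
  -timeJet (-1) c A k (X - τ) T + timeJet 1 c B k (X + τ) T

/-- The corrector `A₂` in the variables `(X, τ, T)`. -/
noncomputable def corrA (σ : ℝ) (A B : ℝ → ℝ → ℝ) (X τ T : ℝ) : ℝ :=
  1 / 4 * ((1 / 4 - 2 * σ ^ 2) * jet B 2 (X + τ) T
    - (2 * (jet A 1 (X - τ) T * antideriv B (X + τ) T)
      + 2 * (jet A 0 (X - τ) T * jet B 0 (X + τ) T) + jet B 0 (X + τ) T * jet B 0 (X + τ) T))

/-- The derivative of `corrA` in `X`. -/
noncomputable def corrAX (σ : ℝ) (A B : ℝ → ℝ → ℝ) (X τ T : ℝ) : ℝ :=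
  1 / 4 * ((1 / 4 - 2 * σ ^ 2) * jet B 3 (X + τ) T
    - (2 * (jet A 2 (X - τ) T * antideriv B (X + τ) T)
      + 4 * (jet A 1 (X - τ) T * jet B 0 (X + τ) T)
      + 2 * (jet A 0 (X - τ) T * jet B 1 (X + τ) T)
      + 2 * (jet B 0 (X + τ) T * jet B 1 (X + τ) T)))

/-- The derivative of `corrA` in `τ`. -/
noncomputable def corrAτ (σ : ℝ) (A B : ℝ → ℝ → ℝ) (X τ T : ℝ) : ℝ :=
  1 / 4 * ((1 / 4 - 2 * σ ^ 2) * jet B 3 (X + τ) T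
    + 2 * (jet A 2 (X - τ) T * antideriv B (X + τ) T)
    - 2 * (jet A 0 (X - τ) T * jet B 1 (X + τ) T)
    - 2 * (jet B 0 (X + τ) T * jet B 1 (X + τ) T))

/-- The corrector `B₂` in the variables `(X, τ, T)`. -/
noncomputable def corrB (σ : ℝ) (A B : ℝ → ℝ → ℝ) (X τ T : ℝ) : ℝ :=
  1 / 4 * ((1 / 4 - 2 * σ ^ 2) * jet A 2 (X - τ) T
    - (jet A 0 (X - τ) T * jet A 0 (X - τ) T + 2 * (jet A 0 (X - τ) T * jet B 0 (X + τ) T)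
      + 2 * (jet B 1 (X + τ) T * antideriv A (X - τ) T)))

/-- The derivative of `corrB` in `X`. -/
noncomputable def corrBX (σ : ℝ) (A B : ℝ → ℝ → ℝ) (X τ T : ℝ) : ℝ :=
  1 / 4 * ((1 / 4 - 2 * σ ^ 2) * jet A 3 (X - τ) T
    - (2 * (jet A 0 (X - τ) T * jet A 1 (X - τ) T)
      + 2 * (jet A 1 (X - τ) T * jet B 0 (X + τ) T)
      + 4 * (jet A 0 (X - τ) T * jet B 1 (X + τ) T)
      + 2 * (jet B 2 (X + τ) T * antideriv A (X - τ) T)))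

/-- The derivative of `corrB` in `τ`. -/
noncomputable def corrBτ (σ : ℝ) (A B : ℝ → ℝ → ℝ) (X τ T : ℝ) : ℝ :=
  -1 / 4 * ((1 / 4 - 2 * σ ^ 2) * jet A 3 (X - τ) T
    - 2 * (jet A 0 (X - τ) T * jet A 1 (X - τ) T)
    - 2 * (jet A 1 (X - τ) T * jet B 0 (X + τ) T)
    + 2 * (jet B 2 (X + τ) T * antideriv A (X - τ) T))

/-- The factor of `δ⁺ζ` in `Q₃` that comes from `P₀` and `P₂`. -/
noncomputable def corrE (σ : ℝ) (A B : ℝ → ℝ → ℝ) (X τ T : ℝ) : ℝ :=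
  waveDiffT (1 / 12 + 2 * σ ^ 2) A B 0 X τ T - corrAτ σ A B X τ T + corrBτ σ A B X τ T

/-- The deterministic balance at order `ε⁵` in the first residual. The slow derivatives are already
expressed through the KdV equations, so it is a polynomial identity in the jets and primitives; this
is what determines `A₂`, `B₂` and the dispersion. -/
theorem corr_identity₁ (σ : ℝ) (A B : ℝ → ℝ → ℝ) (X τ T : ℝ) :
    1 / 6 * waveDiff A B 3 X τ T + (-corrAX σ A B X τ T + corrBX σ A B X τ T)
      - (corrAτ σ A B X τ T + corrBτ σ A B X τ T)
      - waveSumT (1 / 12 + 2 * σ ^ 2) A B 0 X τ T = 0 := by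
  simp only [waveDiff, corrAX, corrBX, corrAτ, corrBτ, waveSumT, timeJet]
  ring

/-- The same balance in the second residual, with the quadratic force. The coefficient `-1/12`
collects `1/6` from the Taylor expansion of `Q₀` and `-1/4` from that of `Q₁`; the `2σ²` is left
behind by the drive of `γ₂`. -/
theorem corr_identity₂ (σ : ℝ) (A B : ℝ → ℝ → ℝ) (X τ T : ℝ) :
    (-1 / 12 + 2 * σ ^ 2) * waveSum A B 3 X τ T + (corrAX σ A B X τ T + corrBX σ A B X τ T)
      + 2 * (waveSum A B 0 X τ T * waveSum A B 1 X τ T)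
      - (-corrAτ σ A B X τ T + corrBτ σ A B X τ T)
      - waveDiffT (1 / 12 + 2 * σ ^ 2) A B 0 X τ T = 0 := by
  simp only [waveSum, corrAX, corrBX, corrAτ, corrBτ, waveDiffT, timeJet]
  ring

namespace KdVPair

variable {c T₀ : ℝ} {A B : ℝ → ℝ → ℝ} {MA MB : ℝ} {hA hB : ℝ → ℝ → ℝ}

theorem mem_Icc {i : Pt} (hi : i ∈ Pt.near T₀) : i.ε ^ 3 * i.t ∈ Icc (-T₀) T₀ :=
  mul_mem_Icc_of_mem_timeInterval hi.1.1 hi.2.1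

theorem majorant_nonneg (K : KdVPair c T₀ A B MA MB hA hB) (i : Pt) : 0 ≤ majorant hA hB i :=
  add_nonneg (K.boundsA.nonneg _ _) (K.boundsB.nonneg _ _)

theorem bd_majorant (K : KdVPair c T₀ A B MA MB hA hB) : Bd (Pt.near T₀) (majorant hA hB) := by
  refine ⟨(MA + 1) + (MB + 1), by linarith [K.boundsA.pos, K.boundsB.pos], fun i hi => ?_⟩
  rw [abs_of_nonneg (K.majorant_nonneg i)]
  exact add_le_add (K.boundsA.majorant_le (mem_Icc hi) _) (K.boundsB.majorant_le (mem_Icc hi) _)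

theorem domA (K : KdVPair c T₀ A B MA MB hA hB) {k : ℕ} (hk : k ≤ 6) :
    Dom (Pt.near T₀) (majorant hA hB) (fun i => jet A k (i.y - i.ε * i.t) (i.ε ^ 3 * i.t)) := by
  refine ⟨1, zero_le_one, fun i hi => ?_⟩
  rw [one_mul]
  refine (K.boundsA.jet_le _ (mem_Icc hi) k hk (i.ε * i.j - i.ε * i.t) _ ?_).trans
    (le_add_of_nonneg_right (K.boundsB.nonneg _ _))
  rw [sub_sub_sub_cancel_right]
  exact hi.2.2

theorem domB (K : KdVPair c T₀ A B MA MB hA hB) {k : ℕ} (hk : k ≤ 6) :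
    Dom (Pt.near T₀) (majorant hA hB) (fun i => jet B k (i.y + i.ε * i.t) (i.ε ^ 3 * i.t)) := by
  refine ⟨1, zero_le_one, fun i hi => ?_⟩
  rw [one_mul]
  refine (K.boundsB.jet_le _ (mem_Icc hi) k hk (i.ε * i.j + i.ε * i.t) _ ?_).trans
    (le_add_of_nonneg_left (K.boundsA.nonneg _ _))
  rw [add_sub_add_right_eq_sub]
  exact hi.2.2

/-- Slow time derivatives cost three space derivatives, and six are available; hence `k ≤ 3`. -/
theorem fieldA (K : KdVPair c T₀ A B MA MB hA hB) {k : ℕ} (hk : k ≤ 3) :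
    WaveField T₀ (majorant hA hB) (fun X τ T => jet A k (X - τ) T)
      (fun X τ T => jet A (k + 1) (X - τ) T) (fun X τ T => -jet A (k + 1) (X - τ) T)
      (fun X τ T => timeJet (-1) c A k (X - τ) T) where
  dX T hT X τ := (K.boundsA.hasDerivAt T hT k (by omega) (X - τ)).comp_sub_const X τ
  dτ T hT X τ := (K.boundsA.hasDerivAt T hT k (by omega) (X - τ)).comp_const_sub X τ
  dt ε hε t ht y := by
    have hξ : HasDerivWithinAt (fun s => y - ε * s) (-ε) (timeInterval T₀ ε) t := by
      simpa using ((hasDerivAt_id t).const_mul ε).const_sub y |>.hasDerivWithinAt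
    have hτ : HasDerivWithinAt (fun s => ε ^ 3 * s) (ε ^ 3) (timeInterval T₀ ε) t := by
      simpa using ((hasDerivAt_id t).const_mul (ε ^ 3)).hasDerivWithinAt
    exact (K.boundsA.hasDerivWithinAt_jet_path K.eqA hk ht
      (fun s hs => mul_mem_Icc_of_mem_timeInterval hε.1 hs) hξ hτ).congr_deriv (by ring)
  dom := K.domA (by omega)
  domX := K.domA (by omega)
  domτ := (K.domA (by omega)).neg
  domT := by
    have h := fun k hk => K.domA (k := k) hk
    have h' := fun k hk => (K.domA (k := k) hk).bd K.bd_majorant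
    unfold Pt.eval
    interval_cases k <;> simp only [timeJet] <;>
    repeat' first
      | exact h _ (by norm_num)
      | exact h' _ (by norm_num)
      | apply Dom.add
      | apply Dom.const_mul
      | apply Dom.mul_bd

theorem fieldB (K : KdVPair c T₀ A B MA MB hA hB) {k : ℕ} (hk : k ≤ 3) :
    WaveField T₀ (majorant hA hB) (fun X τ T => jet B k (X + τ) T)
      (fun X τ T => jet B (k + 1) (X + τ) T) (fun X τ T => jet B (k + 1) (X + τ) T)
      (fun X τ T => timeJet 1 c B k (X + τ) T) where
  dX T hT X τ := (K.boundsB.hasDerivAt T hT k (by omega) (X + τ)).comp_add_const X τ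
  dτ T hT X τ := (K.boundsB.hasDerivAt T hT k (by omega) (X + τ)).comp_const_add X τ
  dt ε hε t ht y := by
    have hξ : HasDerivWithinAt (fun s => y + ε * s) ε (timeInterval T₀ ε) t := by
      simpa using ((hasDerivAt_id t).const_mul ε).const_add y |>.hasDerivWithinAt
    have hτ : HasDerivWithinAt (fun s => ε ^ 3 * s) (ε ^ 3) (timeInterval T₀ ε) t := by
      simpa using ((hasDerivAt_id t).const_mul (ε ^ 3)).hasDerivWithinAt
    exact (K.boundsB.hasDerivWithinAt_jet_path K.eqB hk ht
      (fun s hs => mul_mem_Icc_of_mem_timeInterval hε.1 hs) hξ hτ).congr_deriv (by ring)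
  dom := K.domB (by omega)
  domX := K.domB (by omega)
  domτ := K.domB (by omega)
  domT := by
    have h := fun k hk => K.domB (k := k) hk
    have h' := fun k hk => (K.domB (k := k) hk).bd K.bd_majorant
    unfold Pt.eval
    interval_cases k <;> simp only [timeJet] <;>
    repeat' first
      | exact h _ (by norm_num)
      | exact h' _ (by norm_num)
      | apply Dom.add
      | apply Dom.const_mul
      | apply Dom.mul_bd

theorem fieldPrimA (K : KdVPair c T₀ A B MA MB hA hB) :
    WaveField T₀ (fun _ => 1) (fun X τ T => antideriv A (X - τ) T)
      (fun X τ T => jet A 0 (X - τ) T) (fun X τ T => -jet A 0 (X - τ) T)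
      (fun X τ T => primTimeJet (-1) c A (X - τ) T) where
  dX T hT X τ := (K.boundsA.hasDerivAt_antideriv hT (X - τ)).comp_sub_const X τ
  dτ T hT X τ := (K.boundsA.hasDerivAt_antideriv hT (X - τ)).comp_const_sub X τ
  dt ε hε t ht y := by
    have hξ : HasDerivWithinAt (fun s => y - ε * s) (-ε) (timeInterval T₀ ε) t := by
      simpa using ((hasDerivAt_id t).const_mul ε).const_sub y |>.hasDerivWithinAt
    have hτ : HasDerivWithinAt (fun s => ε ^ 3 * s) (ε ^ 3) (timeInterval T₀ ε) t := by
      simpa using ((hasDerivAt_id t).const_mul (ε ^ 3)).hasDerivWithinAt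
    exact (K.boundsA.hasDerivWithinAt_antideriv_path K.eqA ht
      (fun s hs => mul_mem_Icc_of_mem_timeInterval hε.1 hs) hξ hτ).congr_deriv (by ring)
  dom := ⟨MA, K.boundsA.pos.le, fun i hi => by
    rw [mul_one]; exact K.boundsA.primitive_le _ (mem_Icc hi) _⟩
  domX := bd_iff_dom_one.mp ((K.domA (by omega)).bd K.bd_majorant)
  domτ := bd_iff_dom_one.mp ((K.domA (by omega)).neg.bd K.bd_majorant)
  domT := by
    obtain ⟨C, hC0, hC⟩ := K.boundsA.bd_primTimeJet (-1) c
    exact ⟨C, hC0, fun i hi => by rw [mul_one]; exact hC (_, _) (mem_Icc hi)⟩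

theorem fieldPrimB (K : KdVPair c T₀ A B MA MB hA hB) :
    WaveField T₀ (fun _ => 1) (fun X τ T => antideriv B (X + τ) T)
      (fun X τ T => jet B 0 (X + τ) T) (fun X τ T => jet B 0 (X + τ) T)
      (fun X τ T => primTimeJet 1 c B (X + τ) T) where
  dX T hT X τ := (K.boundsB.hasDerivAt_antideriv hT (X + τ)).comp_add_const X τ
  dτ T hT X τ := (K.boundsB.hasDerivAt_antideriv hT (X + τ)).comp_const_add X τ
  dt ε hε t ht y := by
    have hξ : HasDerivWithinAt (fun s => y + ε * s) ε (timeInterval T₀ ε) t := by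
      simpa using ((hasDerivAt_id t).const_mul ε).const_add y |>.hasDerivWithinAt
    have hτ : HasDerivWithinAt (fun s => ε ^ 3 * s) (ε ^ 3) (timeInterval T₀ ε) t := by
      simpa using ((hasDerivAt_id t).const_mul (ε ^ 3)).hasDerivWithinAt
    exact (K.boundsB.hasDerivWithinAt_antideriv_path K.eqB ht
      (fun s hs => mul_mem_Icc_of_mem_timeInterval hε.1 hs) hξ hτ).congr_deriv (by ring)
  dom := ⟨MB, K.boundsB.pos.le, fun i hi => by
    rw [mul_one]; exact K.boundsB.primitive_le _ (mem_Icc hi) _⟩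
  domX := bd_iff_dom_one.mp ((K.domB (by omega)).bd K.bd_majorant)
  domτ := bd_iff_dom_one.mp ((K.domB (by omega)).bd K.bd_majorant)
  domT := by
    obtain ⟨C, hC0, hC⟩ := K.boundsB.bd_primTimeJet 1 c
    exact ⟨C, hC0, fun i hi => by rw [mul_one]; exact hC (_, _) (mem_Icc hi)⟩

theorem fieldSum (K : KdVPair c T₀ A B MA MB hA hB) {k : ℕ} (hk : k ≤ 3) :
    WaveField T₀ (majorant hA hB) (waveSum A B k) (waveSum A B (k + 1)) (waveDiff A B (k + 1))
      (waveSumT c A B k) :=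
  (K.fieldA hk).add (K.fieldB hk)

theorem fieldDiff (K : KdVPair c T₀ A B MA MB hA hB) {k : ℕ} (hk : k ≤ 3) :
    WaveField T₀ (majorant hA hB) (waveDiff A B k) (waveDiff A B (k + 1)) (waveSum A B (k + 1))
      (waveDiffT c A B k) := by
  have h := ((K.fieldA hk).const_mul (-1)).add (K.fieldB hk)
  simp only [neg_mul, one_mul, neg_neg] at h
  exact h

theorem fieldCorrA (K : KdVPair c T₀ A B MA MB hA hB) (σ : ℝ) : ∃ ΦT,
    WaveField T₀ (majorant hA hB) (corrA σ A B) (corrAX σ A B) (corrAτ σ A B) ΦT := by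
  have a := fun k hk => K.fieldA (k := k) hk
  have b := fun k hk => K.fieldB (k := k) hk
  have b1 := fun k hk => (K.fieldB (k := k) hk).one K.bd_majorant
  refine ⟨_, ((((b 2 (by norm_num)).const_mul (1 / 4 - 2 * σ ^ 2)).sub
    (((((a 1 (by norm_num)).mul K.fieldPrimB).const_mul 2).add
      (((a 0 (by norm_num)).mul (b1 0 (by norm_num))).const_mul 2)).add
      ((b 0 (by norm_num)).mul (b1 0 (by norm_num))))).const_mul (1 / 4)).congr
    (fun X τ T => rfl) (fun X τ T => ?_) (fun X τ T => ?_)⟩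
  · simp only [corrAX]; ring
  · simp only [corrAτ]; ring

theorem fieldCorrB (K : KdVPair c T₀ A B MA MB hA hB) (σ : ℝ) : ∃ ΦT,
    WaveField T₀ (majorant hA hB) (corrB σ A B) (corrBX σ A B) (corrBτ σ A B) ΦT := by
  have a := fun k hk => K.fieldA (k := k) hk
  have b := fun k hk => K.fieldB (k := k) hk
  have a1 := fun k hk => (K.fieldA (k := k) hk).one K.bd_majorant
  have b1 := fun k hk => (K.fieldB (k := k) hk).one K.bd_majorant
  refine ⟨_, ((((a 2 (by norm_num)).const_mul (1 / 4 - 2 * σ ^ 2)).sub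
    ((((a 0 (by norm_num)).mul (a1 0 (by norm_num))).add
      (((a 0 (by norm_num)).mul (b1 0 (by norm_num))).const_mul 2)).add
      (((b 1 (by norm_num)).mul K.fieldPrimA).const_mul 2))).const_mul (1 / 4)).congr
    (fun X τ T => rfl) (fun X τ T => ?_) (fun X τ T => ?_)⟩
  · simp only [corrBX]; ring
  · simp only [corrBτ]; ring

/-- Second order Taylor expansion of the corrector in the residuals needs its second `X` derivative
dominated. -/
theorem fieldCorrAX (K : KdVPair c T₀ A B MA MB hA hB) (σ : ℝ) : ∃ ΦX Φτ ΦT,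
    WaveField T₀ (majorant hA hB) (corrAX σ A B) ΦX Φτ ΦT := by
  have a := fun k hk => K.fieldA (k := k) hk
  have b := fun k hk => K.fieldB (k := k) hk
  have b1 := fun k hk => (K.fieldB (k := k) hk).one K.bd_majorant
  exact ⟨_, _, _, (((b 3 (by norm_num)).const_mul (1 / 4 - 2 * σ ^ 2)).sub
    ((((((a 2 (by norm_num)).mul K.fieldPrimB).const_mul 2).add
      (((a 1 (by norm_num)).mul (b1 0 (by norm_num))).const_mul 4)).add
      (((a 0 (by norm_num)).mul (b1 1 (by norm_num))).const_mul 2)).add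
      (((b 0 (by norm_num)).mul (b1 1 (by norm_num))).const_mul 2))).const_mul (1 / 4)⟩

theorem fieldCorrBX (K : KdVPair c T₀ A B MA MB hA hB) (σ : ℝ) : ∃ ΦX Φτ ΦT,
    WaveField T₀ (majorant hA hB) (corrBX σ A B) ΦX Φτ ΦT := by
  have a := fun k hk => K.fieldA (k := k) hk
  have b := fun k hk => K.fieldB (k := k) hk
  have a1 := fun k hk => (K.fieldA (k := k) hk).one K.bd_majorant
  have b1 := fun k hk => (K.fieldB (k := k) hk).one K.bd_majorant
  exact ⟨_, _, _, (((a 3 (by norm_num)).const_mul (1 / 4 - 2 * σ ^ 2)).sub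
    ((((((a 0 (by norm_num)).mul (a1 1 (by norm_num))).const_mul 2).add
      (((a 1 (by norm_num)).mul (b1 0 (by norm_num))).const_mul 2)).add
      (((a 0 (by norm_num)).mul (b1 1 (by norm_num))).const_mul 4)).add
      (((b 2 (by norm_num)).mul K.fieldPrimA).const_mul 2))).const_mul (1 / 4)⟩

theorem fieldCorrE (K : KdVPair c T₀ A B MA MB hA hB) (σ : ℝ) : ∃ ΦX Φτ ΦT,
    WaveField T₀ (majorant hA hB) (corrE σ A B) ΦX Φτ ΦT := by
  have a := fun k hk => K.fieldA (k := k) hk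
  have b := fun k hk => K.fieldB (k := k) hk
  have a1 := fun k hk => (K.fieldA (k := k) hk).one K.bd_majorant
  have b1 := fun k hk => (K.fieldB (k := k) hk).one K.bd_majorant
  set c' := 1 / 12 + 2 * σ ^ 2 with hc'
  have tA := (((a 3 (by norm_num)).const_mul c').add
    (((a 0 (by norm_num)).mul (a1 1 (by norm_num))).const_mul 2)).const_mul (1 / 2)
  have tB := (((b 3 (by norm_num)).const_mul c').add
    (((b 0 (by norm_num)).mul (b1 1 (by norm_num))).const_mul 2)).const_mul (1 / 2)
  have cA := (((((b 3 (by norm_num)).const_mul (1 / 4 - 2 * σ ^ 2)).add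
    (((a 2 (by norm_num)).mul K.fieldPrimB).const_mul 2)).sub
    (((a 0 (by norm_num)).mul (b1 1 (by norm_num))).const_mul 2)).sub
    (((b 0 (by norm_num)).mul (b1 1 (by norm_num))).const_mul 2)).const_mul (1 / 4)
  have cB := (((((a 3 (by norm_num)).const_mul (1 / 4 - 2 * σ ^ 2)).sub
    (((a 0 (by norm_num)).mul (a1 1 (by norm_num))).const_mul 2)).sub
    (((a 1 (by norm_num)).mul (b1 0 (by norm_num))).const_mul 2)).add
    (((b 2 (by norm_num)).mul K.fieldPrimA).const_mul 2)).const_mul (-1 / 4)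
  refine ⟨_, _, _, (((tA.add tB).sub cA).add cB).congr (fun X τ T => ?_)
    (fun X τ T => rfl) (fun X τ T => rfl)⟩
  simp only [corrE, corrAτ, corrBτ, waveDiffT, timeJet]
  ring

end KdVPair

/-! ### The approximators and their time derivatives -/

/-- The approximator `q̃` in terms of the waves; `z`, `d`, `g` are the values of `ζ`, `δ⁺ζ`, `γ₂`. -/
noncomputable def qForm (σ : ℝ) (A B : ℝ → ℝ → ℝ) (z d g ε X τ T : ℝ) : ℝ :=
  ε ^ 2 * waveSum A B 0 X τ T + ε ^ 3 * ((1 / 2 + d) * waveSum A B 1 X τ T)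
    + ε ^ 4 * (corrA σ A B X τ T + corrB σ A B X τ T - z * waveSum A B 2 X τ T)
    + ε ^ 5 * ((g + 1 / 2 * z) * waveSum A B 3 X τ T
      - d * (2 * (waveSum A B 0 X τ T * waveSum A B 1 X τ T)) + d * corrE σ A B X τ T)

/-- The approximator `p̃` in terms of the waves; `z`, `g` are the values of `ζ`, `γ₁`. -/
noncomputable def pForm (σ : ℝ) (A B : ℝ → ℝ → ℝ) (z g ε X τ T : ℝ) : ℝ :=
  ε ^ 2 * waveDiff A B 0 X τ T
    + ε ^ 4 * (-corrA σ A B X τ T + corrB σ A B X τ T + z * waveDiff A B 2 X τ T)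
    + ε ^ 5 * (g * waveDiff A B 3 X τ T)

/-- The explicit part of the time derivative of `qForm`. -/
noncomputable def qFormT (σ : ℝ) (A B : ℝ → ℝ → ℝ) (z d ε X τ T : ℝ) : ℝ :=
  ε ^ 3 * waveDiff A B 1 X τ T + ε ^ 4 * ((1 / 2 + d) * waveDiff A B 2 X τ T)
    + ε ^ 5 * (corrAτ σ A B X τ T + corrBτ σ A B X τ T - z * waveDiff A B 3 X τ T
      + waveSumT (1 / 12 + 2 * σ ^ 2) A B 0 X τ T)

/-- The explicit part of the time derivative of `pForm`. -/
noncomputable def pFormT (σ : ℝ) (A B : ℝ → ℝ → ℝ) (z ε X τ T : ℝ) : ℝ :=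
  ε ^ 3 * waveSum A B 1 X τ T
    + ε ^ 5 * (-corrAτ σ A B X τ T + corrBτ σ A B X τ T + z * waveSum A B 3 X τ T
      + waveDiffT (1 / 12 + 2 * σ ^ 2) A B 0 X τ T)

/-- A point with bounded values `z`, `d` and an arbitrary value `g`. -/
structure Config where
  pt : Pt
  z : ℝ
  d : ℝ
  g : ℝ

def Config.near (T₀ : ℝ) : Set Config := {x | x.pt ∈ Pt.near T₀ ∧ |x.z| ≤ 1 ∧ |x.d| ≤ 1}

noncomputable def Config.maj (H : Pt → ℝ) (x : Config) : ℝ := (1 + |x.g|) * H x.pt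

section Config

variable {T₀ : ℝ} {H : Pt → ℝ} {f : Pt → ℝ}

theorem Dom.config (hH : ∀ i, 0 ≤ H i) (h : Dom (Pt.near T₀) H f) :
    Dom (Config.near T₀) (Config.maj H) (fun x => f x.pt) := by
  obtain ⟨C, hC0, hC⟩ := h
  refine ⟨C, hC0, fun x hx => (hC _ hx.1).trans ?_⟩
  refine mul_le_mul_of_nonneg_left ?_ hC0
  rw [Config.maj, add_mul, one_mul]
  exact le_add_of_nonneg_right (mul_nonneg (abs_nonneg _) (hH _))

theorem Dom.config_mul (hH : ∀ i, 0 ≤ H i) (h : Dom (Pt.near T₀) H f) :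
    Dom (Config.near T₀) (Config.maj H) (fun x => x.g * f x.pt) := by
  obtain ⟨C, hC0, hC⟩ := h
  refine ⟨C, hC0, fun x hx => ?_⟩
  rw [abs_mul]
  calc |x.g| * |f x.pt| ≤ |x.g| * (C * H x.pt) :=
        mul_le_mul_of_nonneg_left (hC _ hx.1) (abs_nonneg _)
    _ = C * (|x.g| * H x.pt) := by ring
    _ ≤ C * ((1 + |x.g|) * H x.pt) := by
        refine mul_le_mul_of_nonneg_left (mul_le_mul_of_nonneg_right ?_ (hH _)) hC0
        linarith

theorem bd_config_z : Bd (Config.near T₀) (fun x => x.z) := ⟨1, zero_le_one, fun _ hx => hx.2.1⟩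

theorem bd_config_d : Bd (Config.near T₀) (fun x => x.d) := ⟨1, zero_le_one, fun _ hx => hx.2.2⟩

theorem bd_config_ε : Bd (Config.near T₀) (fun x => x.pt.ε) :=
  ⟨1, zero_le_one, fun _ hx => by rw [abs_of_pos hx.1.1.1]; exact hx.1.1.2.le⟩

end Config

namespace KdVPair

variable {c T₀ : ℝ} {A B : ℝ → ℝ → ℝ} {MA MB : ℝ} {hA hB : ℝ → ℝ → ℝ}

theorem fieldSumMul (K : KdVPair c T₀ A B MA MB hA hB) : ∃ ΦT,
    WaveField T₀ (majorant hA hB) (fun X τ T => waveSum A B 0 X τ T * waveSum A B 1 X τ T)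
      (fun X τ T => waveSum A B 1 X τ T * waveSum A B 1 X τ T
        + waveSum A B 0 X τ T * waveSum A B 2 X τ T)
      (fun X τ T => waveDiff A B 1 X τ T * waveSum A B 1 X τ T
        + waveSum A B 0 X τ T * waveDiff A B 2 X τ T) ΦT :=
  ⟨_, (K.fieldSum (k := 0) (by norm_num)).mul
    ((K.fieldSum (k := 1) (by norm_num)).one K.bd_majorant)⟩

/-- The constant is uniform in `z`, `d`, `g`, hence in the site and in the noise. The autoregressive
value `g` first enters at `ε⁵ · ε`, so it is absent from `qFormT` and appears only in the remainder.
-/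
theorem exists_hasDerivWithinAt_qForm {σ : ℝ}
    (K : KdVPair (1 / 12 + 2 * σ ^ 2) T₀ A B MA MB hA hB) :
    ∃ C, 0 ≤ C ∧ ∀ x ∈ Config.near T₀, ∃ R, |R| ≤ C * Config.maj (majorant hA hB) x ∧
      HasDerivWithinAt
        (fun s => qForm σ A B x.z x.d x.g x.pt.ε x.pt.y (x.pt.ε * s) (x.pt.ε ^ 3 * s))
        (Pt.eval (qFormT σ A B x.z x.d x.pt.ε) x.pt + x.pt.ε ^ 6 * R)
        (timeInterval T₀ x.pt.ε) x.pt.t := by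
  have s := fun k hk => K.fieldSum (k := k) hk
  have s0 := s 0 (by norm_num)
  have s1 := s 1 (by norm_num)
  have s2 := s 2 (by norm_num)
  have s3 := s 3 (by norm_num)
  obtain ⟨AT, fA⟩ := K.fieldCorrA σ
  obtain ⟨BT, fB⟩ := K.fieldCorrB σ
  obtain ⟨EX, Eτ, ET, fE⟩ := K.fieldCorrE σ
  obtain ⟨MT, fM⟩ := K.fieldSumMul
  have hH := K.majorant_nonneg
  have key : Dom (Config.near T₀) (Config.maj (majorant hA hB)) (fun x =>
      (1 / 2 + x.d) * Pt.eval (waveSumT (1 / 12 + 2 * σ ^ 2) A B 1) x.pt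
      + x.pt.ε * (Pt.eval AT x.pt + Pt.eval BT x.pt
        - x.z * Pt.eval (waveSumT (1 / 12 + 2 * σ ^ 2) A B 2) x.pt)
      + (x.g * Pt.eval (waveDiff A B 4) x.pt + (1 / 2) * (x.z * Pt.eval (waveDiff A B 4) x.pt)
        - x.d * (2 * Pt.eval (fun X τ T => waveDiff A B 1 X τ T * waveSum A B 1 X τ T
        + waveSum A B 0 X τ T * waveDiff A B 2 X τ T) x.pt) + x.d * Pt.eval Eτ x.pt)
      + x.pt.ε * (x.pt.ε * (x.g * Pt.eval (waveSumT (1 / 12 + 2 * σ ^ 2) A B 3) x.pt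
        + (1 / 2) * (x.z * Pt.eval (waveSumT (1 / 12 + 2 * σ ^ 2) A B 3) x.pt)
        - x.d * (2 * Pt.eval MT x.pt) + x.d * Pt.eval ET x.pt))) := by
    repeat' first
      | exact s1.domT.config hH
      | exact s2.domT.config hH
      | exact s3.domT.config hH
      | exact s3.domτ.config hH
      | exact fA.domT.config hH
      | exact fB.domT.config hH
      | exact fE.domτ.config hH
      | exact fE.domT.config hH
      | exact fM.domτ.config hH
      | exact fM.domT.config hH
      | exact s3.domT.config_mul hH
      | exact s3.domτ.config_mul hH
      | exact bd_config_z
      | exact bd_config_d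
      | exact bd_config_ε
      | exact Bd.const _
      | apply Dom.sub
      | apply Dom.add
      | apply Dom.const_mul
      | apply Dom.bd_mul
      | apply Bd.add
  obtain ⟨C, hC0, hC⟩ := key
  refine ⟨C, hC0, fun x hx => ⟨_, hC x hx, ?_⟩⟩
  obtain ⟨⟨hε, ht, hy⟩, hz, hd⟩ := hx
  have d0 := s0.dt _ hε _ ht x.pt.y
  have d1 := s1.dt _ hε _ ht x.pt.y
  have d2 := s2.dt _ hε _ ht x.pt.y
  have d3 := s3.dt _ hε _ ht x.pt.y
  have dA := fA.dt _ hε _ ht x.pt.y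
  have dB := fB.dt _ hε _ ht x.pt.y
  have dE := fE.dt _ hε _ ht x.pt.y
  have dM := fM.dt _ hε _ ht x.pt.y
  refine ((((d0.const_mul (x.pt.ε ^ 2)).add ((d1.const_mul (1 / 2 + x.d)).const_mul
    (x.pt.ε ^ 3))).add (((dA.add dB).sub (d2.const_mul x.z)).const_mul (x.pt.ε ^ 4))).add
    ((((d3.const_mul (x.g + 1 / 2 * x.z)).sub ((dM.const_mul 2).const_mul x.d)).add
      (dE.const_mul x.d)).const_mul (x.pt.ε ^ 5))).congr_deriv ?_
  simp only [Pt.eval, qFormT, Nat.reduceAdd]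
  ring

theorem exists_hasDerivWithinAt_pForm {σ : ℝ}
    (K : KdVPair (1 / 12 + 2 * σ ^ 2) T₀ A B MA MB hA hB) :
    ∃ C, 0 ≤ C ∧ ∀ x ∈ Config.near T₀, ∃ R, |R| ≤ C * Config.maj (majorant hA hB) x ∧
      HasDerivWithinAt
        (fun s => pForm σ A B x.z x.g x.pt.ε x.pt.y (x.pt.ε * s) (x.pt.ε ^ 3 * s))
        (Pt.eval (pFormT σ A B x.z x.pt.ε) x.pt + x.pt.ε ^ 6 * R)
        (timeInterval T₀ x.pt.ε) x.pt.t := by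
  have s := fun k hk => K.fieldDiff (k := k) hk
  have s0 := s 0 (by norm_num)
  have s2 := s 2 (by norm_num)
  have s3 := s 3 (by norm_num)
  obtain ⟨AT, fA⟩ := K.fieldCorrA σ
  obtain ⟨BT, fB⟩ := K.fieldCorrB σ
  have hH := K.majorant_nonneg
  have key : Dom (Config.near T₀) (Config.maj (majorant hA hB)) (fun x =>
      x.pt.ε * (-Pt.eval AT x.pt + Pt.eval BT x.pt
        + x.z * Pt.eval (waveDiffT (1 / 12 + 2 * σ ^ 2) A B 2) x.pt)
      + x.g * Pt.eval (waveSum A B 4) x.pt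
      + x.pt.ε * (x.pt.ε * (x.g * Pt.eval (waveDiffT (1 / 12 + 2 * σ ^ 2) A B 3) x.pt))) := by
    repeat' first
      | exact s2.domT.config hH
      | exact fA.domT.config hH
      | exact fB.domT.config hH
      | exact s3.domT.config_mul hH
      | exact s3.domτ.config_mul hH
      | exact bd_config_z
      | exact bd_config_ε
      | apply Dom.add
      | apply Dom.neg
      | apply Dom.bd_mul
  obtain ⟨C, hC0, hC⟩ := key
  refine ⟨C, hC0, fun x hx => ⟨_, hC x hx, ?_⟩⟩
  obtain ⟨⟨hε, ht, hy⟩, hz, hd⟩ := hx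
  have d0 := s0.dt _ hε _ ht x.pt.y
  have d2 := s2.dt _ hε _ ht x.pt.y
  have d3 := s3.dt _ hε _ ht x.pt.y
  have dA := fA.dt _ hε _ ht x.pt.y
  have dB := fB.dt _ hε _ ht x.pt.y
  refine (((d0.const_mul (x.pt.ε ^ 2)).add (((dA.neg.add dB).add (d2.const_mul x.z)).const_mul
    (x.pt.ε ^ 4))).add ((d3.const_mul x.g).const_mul (x.pt.ε ^ 5))).congr_deriv ?_
  simp only [Pt.eval, pFormT, Nat.reduceAdd]
  ring

theorem iteratedDeriv_waveSum (K : KdVPair c T₀ A B MA MB hA hB) {T : ℝ}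
    (hT : T ∈ Icc (-T₀) T₀) {k : ℕ} (hk : k ≤ 4) (X τ : ℝ) :
    iteratedDeriv k (fun X' => waveSum A B 0 X' τ T) X = waveSum A B k X τ T :=
  congrFun (hasDerivAt_iteratedDeriv_of_chain (n := 4) (u := fun k X => waveSum A B k X τ T)
    (fun k hk X => (K.fieldSum (k := k) (by omega)).dX T hT X τ) k hk) X

theorem iteratedDeriv_waveDiff (K : KdVPair c T₀ A B MA MB hA hB) {T : ℝ}
    (hT : T ∈ Icc (-T₀) T₀) {k : ℕ} (hk : k ≤ 4) (X τ : ℝ) :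
    iteratedDeriv k (fun X' => waveDiff A B 0 X' τ T) X = waveDiff A B k X τ T :=
  congrFun (hasDerivAt_iteratedDeriv_of_chain (n := 4) (u := fun k X => waveDiff A B k X τ T)
    (fun k hk X => (K.fieldDiff (k := k) (by omega)).dX T hT X τ) k hk) X

theorem Q₀_eq (A B : ℝ → ℝ → ℝ) : Q₀ A B = waveSum A B 0 := by
  funext X τ T; simp [Q₀, waveSum, jet]

theorem P₀_eq (A B : ℝ → ℝ → ℝ) : P₀ A B = waveDiff A B 0 := by
  funext X τ T; simp [P₀, waveDiff, jet]

theorem A₂_eq (σ : ℝ) (A B : ℝ → ℝ → ℝ) (X τ T : ℝ) :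
    A₂ σ A B (X - τ) (X + τ) T = corrA σ A B X τ T := by
  simp only [A₂, corrA, jet, iteratedDeriv_zero, iteratedDeriv_one]; ring

theorem B₂_eq (σ : ℝ) (A B : ℝ → ℝ → ℝ) (X τ T : ℝ) :
    B₂ σ A B (X - τ) (X + τ) T = corrB σ A B X τ T := by
  simp only [B₂, corrB, jet, iteratedDeriv_zero, iteratedDeriv_one]; ring

theorem slowDeriv_waveDiff (K : KdVPair c T₀ A B MA MB hA hB) {T : ℝ}
    (hT : T ∈ Icc (-T₀) T₀) (X τ : ℝ) :
    slowDeriv T₀ (fun s => waveDiff A B 0 X τ s) T = waveDiffT c A B 0 X τ T := by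
  have h := ((K.boundsA.hasDerivWithinAt_jet K.eqA (k := 0) (by norm_num) hT (X - τ)).neg).add
    (K.boundsB.hasDerivWithinAt_jet K.eqB (k := 0) (by norm_num) hT (X + τ))
  exact h.derivWithin (uniqueDiffOn_Icc (by linarith [K.pos]) T hT)

theorem qApprox_eq {σ : ℝ} (K : KdVPair (1 / 12 + 2 * σ ^ 2) T₀ A B MA MB hA hB)
    (ζ γ : ℤ → ℝ) {ε : ℝ} (hε : ε ∈ Ioo (0 : ℝ) 1) (j : ℤ) {t : ℝ} (ht : t ∈ timeInterval T₀ ε) :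
    qApprox σ T₀ A B ζ γ ε j t =
      qForm σ A B (ζ j) (deltaPlus ζ j) (γ j) ε (ε * j) (ε * t) (ε ^ 3 * t) := by
  have hT := mul_mem_Icc_of_mem_timeInterval hε.1 ht
  obtain ⟨AT, fA⟩ := K.fieldCorrA σ
  obtain ⟨BT, fB⟩ := K.fieldCorrB σ
  have s0 := K.fieldSum (k := 0) (by norm_num)
  have p0 := K.fieldDiff (k := 0) (by norm_num)
  have e1 := (s0.dX _ hT (ε * j) (ε * t)).deriv
  have e2 := (p0.dτ _ hT (ε * j) (ε * t)).deriv
  have e3 := ((s0.dX _ hT (ε * j) (ε * t)).pow 2).deriv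
  have e3' : deriv (fun X' => waveSum A B 0 X' (ε * t) (ε ^ 3 * t) ^ 2) (ε * j) =
      2 * (waveSum A B 0 (ε * j) (ε * t) (ε ^ 3 * t) * waveSum A B 1 (ε * j) (ε * t) (ε ^ 3 * t)) := by
    refine e3.trans ?_
    push_cast
    ring
  have e4 := (fA.dτ _ hT (ε * j) (ε * t)).deriv
  have e5 := (fB.dτ _ hT (ε * j) (ε * t)).deriv
  simp only [qApprox, Q₁, Q₂, Q₃, Q₀_eq, P₀_eq, A₂_eq, B₂_eq,
    K.iteratedDeriv_waveSum hT (show 2 ≤ 4 by norm_num),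
    K.iteratedDeriv_waveSum hT (show 3 ≤ 4 by norm_num), K.slowDeriv_waveDiff hT, e1, e2, e3', e4,
    e5, qForm, corrE]
  ring

theorem pApprox_eq {σ : ℝ} (K : KdVPair (1 / 12 + 2 * σ ^ 2) T₀ A B MA MB hA hB)
    (ζ γ : ℤ → ℝ) {ε : ℝ} (hε : ε ∈ Ioo (0 : ℝ) 1) (j : ℤ) {t : ℝ} (ht : t ∈ timeInterval T₀ ε) :
    pApprox σ A B ζ γ ε j t =
      pForm σ A B (ζ j) (γ j) ε (ε * j) (ε * t) (ε ^ 3 * t) := by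
  have hT := mul_mem_Icc_of_mem_timeInterval hε.1 ht
  simp only [pApprox, P₁, P₂, P₃, P₀_eq, A₂_eq, B₂_eq,
    K.iteratedDeriv_waveDiff hT (show 2 ≤ 4 by norm_num),
    K.iteratedDeriv_waveDiff hT (show 3 ≤ 4 by norm_num), pForm]
  ring

end KdVPair

/-! ### Realizations of the noise and expansions at sites -/

/-- The points of `Pt.near` that lie on their site. -/
def Pt.onSite (T₀ : ℝ) : Set Pt := {i | i ∈ Pt.near T₀ ∧ i.y = i.ε * i.j}

def Pt.shift (s : ℝ) (i : Pt) : Pt := { i with y := i.y + s * i.ε }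

/-- A realization of the noise with its autoregressive processes. -/
structure Environment (σ : ℝ) (ζ : ℤ → ℝ) (γ₁ γ₂ : ℝ → ℤ → ℝ) : Prop where
  noise_le : ∀ j, |ζ j| ≤ 1 / 4
  mass_pos : ∃ b > 0, ∀ j, b ≤ mass ζ j
  ar₁ : ∀ ε ∈ Ioo (0 : ℝ) 1, IsAutoregressive₁ ε ζ (γ₁ ε)
  ar₂ : ∀ ε ∈ Ioo (0 : ℝ) 1, IsAutoregressive₂ σ ε ζ (γ₂ ε)
  bd₁ : ∃ C, 0 ≤ C ∧ ∀ ε ∈ Ioo (0 : ℝ) 1, ∀ j, |ε * γ₁ ε j| ≤ C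
  bd₂ : ∃ C, 0 ≤ C ∧ ∀ ε ∈ Ioo (0 : ℝ) 1, ∀ j, |ε * γ₂ ε j| ≤ C

/-- One plus the autoregressive processes at the sites that enter the residuals at `j`. -/
noncomputable def arWeight (γ₁ γ₂ : ℝ → ℤ → ℝ) (ε : ℝ) (j : ℤ) : ℝ :=
  1 + |γ₁ ε j| + |γ₁ ε (j + 1)| + |γ₂ ε j| + |γ₂ ε (j - 1)|

noncomputable def siteMaj (γ₁ γ₂ : ℝ → ℤ → ℝ) (H : Pt → ℝ) (i : Pt) : ℝ :=
  arWeight γ₁ γ₂ i.ε i.j * H i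

theorem Dom.comp {ι κ : Type*} {S : Set ι} {H f : ι → ℝ} (h : Dom S H f) {S' : Set κ} {φ : κ → ι}
    {H' : κ → ℝ} (hφ : ∀ x ∈ S', φ x ∈ S) (hH : ∀ x ∈ S', H (φ x) ≤ H' x) :
    Dom S' H' (fun x => f (φ x)) := by
  obtain ⟨C, hC0, hC⟩ := h
  exact ⟨C, hC0, fun x hx => (hC _ (hφ x hx)).trans (mul_le_mul_of_nonneg_left (hH x hx) hC0)⟩

theorem Dom.weight_mul {ι : Type*} {S : Set ι} {H f g w : ι → ℝ} (h : Dom S H f)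
    (hg : ∀ i, |g i| ≤ w i) :
    Dom S (fun i => w i * H i) (fun i => g i * f i) := by
  obtain ⟨C, hC0, hC⟩ := h
  refine ⟨C, hC0, fun i hi => ?_⟩
  rw [abs_mul]
  calc |g i| * |f i| ≤ w i * (C * H i) :=
        mul_le_mul (hg i) (hC i hi) (abs_nonneg _) ((abs_nonneg _).trans (hg i))
    _ = C * (w i * H i) := by ring

section Taylor

variable {T₀ : ℝ} {H : Pt → ℝ}

/-- The Taylor remainder divided by `εⁿ` becomes a function of the point, so that it can enter exact
identities and be estimated by the domination calculus afterwards. -/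
theorem exists_taylor (hH : ∀ ε t y y' j, H ⟨ε, t, y, j⟩ = H ⟨ε, t, y', j⟩) (n : ℕ)
    {F : ℕ → ℝ → ℝ → ℝ → ℝ}
    (hF : ∀ k < n, ∀ T ∈ Icc (-T₀) T₀, ∀ X τ, HasDerivAt (fun x => F k x τ T) (F (k + 1) X τ T) X)
    (hn : Dom (Pt.near T₀) H (Pt.eval (F n))) {s : ℝ} (hs : |s| ≤ 1) :
    ∃ ρ : Pt → ℝ, Dom (Pt.onSite T₀) H ρ ∧ ∀ i ∈ Pt.onSite T₀, Pt.eval (F 0) (i.shift s) =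
      ∑ k ∈ Finset.range n, (s * i.ε) ^ k / k.factorial * Pt.eval (F k) i + i.ε ^ n * ρ i := by
  obtain ⟨C, hC0, hC⟩ := exists_taylor_bound hH n hF hn
  refine ⟨fun i => (Pt.eval (F 0) (i.shift s) -
    ∑ k ∈ Finset.range n, (s * i.ε) ^ k / k.factorial * Pt.eval (F k) i) / i.ε ^ n,
    ⟨C, hC0, ?_⟩, ?_⟩
  · rintro ⟨ε, t, y, j⟩ ⟨⟨hε, ht, -⟩, hy⟩
    simp only at hε ht hy
    subst hy
    have hε0 : 0 < ε ^ n := pow_pos hε.1 n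
    rw [abs_div, abs_of_pos (show (0 : ℝ) < (Pt.mk ε t (ε * j) j).ε ^ n from hε0), div_le_iff₀ hε0]
    refine (hC ε hε t ht j (s * ε) ?_).trans (le_of_eq (by ring))
    rw [abs_mul, abs_of_pos hε.1]
    nlinarith [hε.1]
  · rintro i ⟨⟨hε, -, -⟩, -⟩
    have : i.ε ^ n ≠ 0 := (pow_pos hε.1 n).ne'
    field_simp
    ring

theorem WaveField.exists_taylor_one {Φ ΦX Φτ ΦT : ℝ → ℝ → ℝ → ℝ}
    (hH : ∀ ε t y y' j, H ⟨ε, t, y, j⟩ = H ⟨ε, t, y', j⟩) (h : WaveField T₀ H Φ ΦX Φτ ΦT)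
    {s : ℝ} (hs : |s| ≤ 1) :
    ∃ ρ : Pt → ℝ, Dom (Pt.onSite T₀) H ρ ∧ ∀ i ∈ Pt.onSite T₀,
      Pt.eval Φ (i.shift s) = Pt.eval Φ i + i.ε * ρ i := by
  obtain ⟨ρ, h1, h2⟩ := exists_taylor hH 1 (F := fun k => if k = 0 then Φ else ΦX)
    (fun k hk => by obtain rfl : k = 0 := by omega
                    exact h.dX) h.domX hs
  refine ⟨ρ, h1, fun i hi => ?_⟩
  simpa using h2 i hi

theorem WaveField.exists_taylor_two {Φ ΦX Φτ ΦT ΦXX ΦXτ ΦXT : ℝ → ℝ → ℝ → ℝ}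
    (hH : ∀ ε t y y' j, H ⟨ε, t, y, j⟩ = H ⟨ε, t, y', j⟩) (h : WaveField T₀ H Φ ΦX Φτ ΦT)
    (h' : WaveField T₀ H ΦX ΦXX ΦXτ ΦXT) {s : ℝ} (hs : |s| ≤ 1) :
    ∃ ρ : Pt → ℝ, Dom (Pt.onSite T₀) H ρ ∧ ∀ i ∈ Pt.onSite T₀,
      Pt.eval Φ (i.shift s) = Pt.eval Φ i + s * i.ε * Pt.eval ΦX i + i.ε ^ 2 * ρ i := by
  obtain ⟨ρ, h1, h2⟩ := exists_taylor hH 2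
    (F := fun k => if k = 0 then Φ else if k = 1 then ΦX else ΦXX)
    (fun k hk => by
      obtain rfl | rfl : k = 0 ∨ k = 1 := by omega
      · exact h.dX
      · exact h'.dX) h'.domX hs
  refine ⟨ρ, h1, fun i hi => ?_⟩
  simpa [Finset.sum_range_succ] using h2 i hi

end Taylor

theorem uniqueDiffOn_timeInterval {T₀ ε : ℝ} (hT₀ : 0 < T₀) (hε : 0 < ε) :
    UniqueDiffOn ℝ (timeInterval T₀ ε) :=
  uniqueDiffOn_Icc (by have : 0 < T₀ / ε ^ 3 := by positivity
                       linarith)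

section

variable {σ T₀ : ℝ} {A B : ℝ → ℝ → ℝ} {MA MB : ℝ} {hA hB : ℝ → ℝ → ℝ} {ζ : ℤ → ℝ}
  {γ₁ γ₂ : ℝ → ℤ → ℝ}

theorem majorant_congr (hA hB : ℝ → ℝ → ℝ) (ε t y y' : ℝ) (j : ℤ) :
    majorant hA hB ⟨ε, t, y, j⟩ = majorant hA hB ⟨ε, t, y', j⟩ := rfl

namespace Environment

theorem delta_le (E : Environment σ ζ γ₁ γ₂) (j : ℤ) : |deltaPlus ζ j| ≤ 1 := by
  have h1 := abs_le.mp (E.noise_le j)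
  have h2 := abs_le.mp (E.noise_le (j + 1))
  rw [deltaPlus, abs_le]
  constructor <;> linarith

theorem noise_le_one (E : Environment σ ζ γ₁ γ₂) (j : ℤ) : |ζ j| ≤ 1 :=
  (E.noise_le j).trans (by norm_num)

end Environment

theorem Pt.hasDerivWithinAt_qApprox (K : KdVPair (1 / 12 + 2 * σ ^ 2) T₀ A B MA MB hA hB)
    (E : Environment σ ζ γ₁ γ₂) : ∃ R : Pt → ℝ,
    Dom (Pt.onSite T₀) (siteMaj γ₁ γ₂ (majorant hA hB)) R ∧ ∀ i ∈ Pt.onSite T₀,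
      HasDerivWithinAt (qApprox σ T₀ A B ζ (γ₂ i.ε) i.ε i.j)
        (Pt.eval (qFormT σ A B (ζ i.j) (deltaPlus ζ i.j) i.ε) i + i.ε ^ 6 * R i)
        (timeInterval T₀ i.ε) i.t := by
  obtain ⟨C, hC0, hC⟩ := K.exists_hasDerivWithinAt_qForm
  choose! R hR using hC
  have hn : ∀ i ∈ Pt.onSite T₀, Config.mk i (ζ i.j) (deltaPlus ζ i.j) (γ₂ i.ε i.j) ∈
      Config.near T₀ := fun i hi => ⟨hi.1, E.noise_le_one _, E.delta_le _⟩
  refine ⟨fun i => R ⟨i, ζ i.j, deltaPlus ζ i.j, γ₂ i.ε i.j⟩,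
    ⟨C, hC0, fun i hi => ((hR _ (hn i hi)).1).trans ?_⟩, fun i hi => ?_⟩
  · refine mul_le_mul_of_nonneg_left (mul_le_mul_of_nonneg_right ?_ (K.majorant_nonneg i)) hC0
    simp only [arWeight]
    linarith [abs_nonneg (γ₁ i.ε i.j), abs_nonneg (γ₁ i.ε (i.j + 1)),
      abs_nonneg (γ₂ i.ε (i.j - 1))]
  · refine (hR _ (hn i hi)).2.congr (fun s hs => ?_) ?_
    · rw [K.qApprox_eq ζ _ hi.1.1 _ hs, ← hi.2]
    · rw [K.qApprox_eq ζ _ hi.1.1 _ hi.1.2.1, ← hi.2]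

theorem Pt.hasDerivWithinAt_pApprox (K : KdVPair (1 / 12 + 2 * σ ^ 2) T₀ A B MA MB hA hB)
    (E : Environment σ ζ γ₁ γ₂) : ∃ R : Pt → ℝ,
    Dom (Pt.onSite T₀) (siteMaj γ₁ γ₂ (majorant hA hB)) R ∧ ∀ i ∈ Pt.onSite T₀,
      HasDerivWithinAt (pApprox σ A B ζ (γ₁ i.ε) i.ε i.j)
        (Pt.eval (pFormT σ A B (ζ i.j) i.ε) i + i.ε ^ 6 * R i)
        (timeInterval T₀ i.ε) i.t := by
  obtain ⟨C, hC0, hC⟩ := K.exists_hasDerivWithinAt_pForm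
  choose! R hR using hC
  have hn : ∀ i ∈ Pt.onSite T₀, Config.mk i (ζ i.j) 0 (γ₁ i.ε i.j) ∈
      Config.near T₀ := fun i hi => ⟨hi.1, E.noise_le_one _, by simp⟩
  refine ⟨fun i => R ⟨i, ζ i.j, 0, γ₁ i.ε i.j⟩,
    ⟨C, hC0, fun i hi => ((hR _ (hn i hi)).1).trans ?_⟩, fun i hi => ?_⟩
  · refine mul_le_mul_of_nonneg_left (mul_le_mul_of_nonneg_right ?_ (K.majorant_nonneg i)) hC0
    simp only [arWeight]
    linarith [abs_nonneg (γ₂ i.ε i.j), abs_nonneg (γ₁ i.ε (i.j + 1)),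
      abs_nonneg (γ₂ i.ε (i.j - 1))]
  · refine (hR _ (hn i hi)).2.congr (fun s hs => ?_) ?_
    · rw [K.pApprox_eq ζ _ hi.1.1 _ hs, ← hi.2]
    · rw [K.pApprox_eq ζ _ hi.1.1 _ hi.1.2.1, ← hi.2]

end

/-! ### Cancellation in the residuals -/

section

variable {σ T₀ : ℝ} {A B : ℝ → ℝ → ℝ} {MA MB : ℝ} {hA hB : ℝ → ℝ → ℝ} {ζ : ℤ → ℝ}
  {γ₁ γ₂ : ℝ → ℤ → ℝ}

theorem Dom.mono_set {ι : Type*} {S S' : Set ι} {H f : ι → ℝ} (h : Dom S H f) (hS : S' ⊆ S) :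
    Dom S' H f := by
  obtain ⟨C, hC0, hC⟩ := h
  exact ⟨C, hC0, fun x hx => hC x (hS hx)⟩

theorem Dom.onSite {H f : Pt → ℝ} (h : Dom (Pt.near T₀) H f) : Dom (Pt.onSite T₀) H f :=
  h.mono_set fun _ hi => hi.1

theorem Dom.shift {f : Pt → ℝ} (h : Dom (Pt.near T₀) (majorant hA hB) f) {s : ℝ} (hs : |s| ≤ 1) :
    Dom (Pt.onSite T₀) (majorant hA hB) (fun i => f (i.shift s)) := by
  refine h.comp (fun i hi => ⟨hi.1.1, hi.1.2.1, ?_⟩) fun i _ => le_rfl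
  simp only [Pt.shift]
  rw [hi.2, add_sub_cancel_left, abs_mul, abs_of_pos hi.1.1.1]
  exact mul_le_one₀ hs hi.1.1.1.le hi.1.1.2.le

theorem one_le_arWeight (γ₁ γ₂ : ℝ → ℤ → ℝ) (ε : ℝ) (j : ℤ) : 1 ≤ arWeight γ₁ γ₂ ε j := by
  simp only [arWeight]
  linarith [abs_nonneg (γ₁ ε j), abs_nonneg (γ₁ ε (j + 1)), abs_nonneg (γ₂ ε j),
    abs_nonneg (γ₂ ε (j - 1))]

theorem Dom.siteMaj {S : Set Pt} {H f : Pt → ℝ} (h : Dom S H f) :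
    Dom S (siteMaj γ₁ γ₂ H) f := by
  have := h.weight_mul (g := fun _ => 1) (w := fun i => arWeight γ₁ γ₂ i.ε i.j)
    fun i => by simpa using one_le_arWeight γ₁ γ₂ i.ε i.j
  simp only [one_mul] at this
  exact this

theorem Dom.ar_mul {S : Set Pt} {H f g : Pt → ℝ} (h : Dom S H f)
    (hg : ∀ i, |g i| ≤ arWeight γ₁ γ₂ i.ε i.j) :
    Dom S (_root_.siteMaj γ₁ γ₂ H) (fun i => g i * f i) := h.weight_mul hg

theorem abs_ar₁_le (γ₁ γ₂ : ℝ → ℤ → ℝ) (i : Pt) : |γ₁ i.ε i.j| ≤ arWeight γ₁ γ₂ i.ε i.j := by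
  simp only [arWeight]
  linarith [abs_nonneg (γ₁ i.ε i.j), abs_nonneg (γ₁ i.ε (i.j + 1)), abs_nonneg (γ₂ i.ε i.j),
    abs_nonneg (γ₂ i.ε (i.j - 1))]

theorem abs_ar₁_succ_le (γ₁ γ₂ : ℝ → ℤ → ℝ) (i : Pt) :
    |γ₁ i.ε (i.j + 1)| ≤ arWeight γ₁ γ₂ i.ε i.j := by
  simp only [arWeight]
  linarith [abs_nonneg (γ₁ i.ε i.j), abs_nonneg (γ₁ i.ε (i.j + 1)), abs_nonneg (γ₂ i.ε i.j),
    abs_nonneg (γ₂ i.ε (i.j - 1))]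

theorem abs_ar₂_le (γ₁ γ₂ : ℝ → ℤ → ℝ) (i : Pt) : |γ₂ i.ε i.j| ≤ arWeight γ₁ γ₂ i.ε i.j := by
  simp only [arWeight]
  linarith [abs_nonneg (γ₁ i.ε i.j), abs_nonneg (γ₁ i.ε (i.j + 1)), abs_nonneg (γ₂ i.ε i.j),
    abs_nonneg (γ₂ i.ε (i.j - 1))]

theorem abs_ar₂_pred_le (γ₁ γ₂ : ℝ → ℤ → ℝ) (i : Pt) :
    |γ₂ i.ε (i.j - 1)| ≤ arWeight γ₁ γ₂ i.ε i.j := by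
  simp only [arWeight]
  linarith [abs_nonneg (γ₁ i.ε i.j), abs_nonneg (γ₁ i.ε (i.j + 1)), abs_nonneg (γ₂ i.ε i.j),
    abs_nonneg (γ₂ i.ε (i.j - 1))]

theorem bd_onSite_ε : Bd (Pt.onSite T₀) (fun i => i.ε) :=
  ⟨1, zero_le_one, fun i hi => by rw [abs_of_pos hi.1.1.1]; exact hi.1.1.2.le⟩

namespace Environment

theorem bd_noise (E : Environment σ ζ γ₁ γ₂) {S : Set Pt} (f : Pt → ℤ) :
    Bd S (fun i => ζ (f i)) := ⟨1, zero_le_one, fun _ _ => E.noise_le_one _⟩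

theorem bd_delta (E : Environment σ ζ γ₁ γ₂) {S : Set Pt} (f : Pt → ℤ) :
    Bd S (fun i => deltaPlus ζ (f i)) := ⟨1, zero_le_one, fun _ _ => E.delta_le _⟩

end Environment

theorem bd_sign (f : Pt → ℤ) {S : Set Pt} : Bd S (fun i => ((f i).sign : ℝ)) := by
  refine ⟨1, zero_le_one, fun i _ => ?_⟩
  rcases lt_trichotomy (f i) 0 with h | h | h
  · simp [Int.sign_eq_neg_one_of_neg h]
  · simp [h]
  · simp [Int.sign_eq_one_of_pos h]

namespace KdVPair

/-- Each term of `p̃` is expanded just far enough to leave a remainder of order `ε⁶`: four orders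
for `P₀`, two for the terms with `ε⁴`, one for the term with `γ₁`. -/
theorem dom_res₁ (K : KdVPair (1 / 12 + 2 * σ ^ 2) T₀ A B MA MB hA hB)
    (E : Environment σ ζ γ₁ γ₂) : ∃ R : Pt → ℝ,
    Dom (Pt.onSite T₀) (siteMaj γ₁ γ₂ (majorant hA hB)) R ∧ ∀ i ∈ Pt.onSite T₀,
      res₁ T₀ i.ε (qApprox σ T₀ A B ζ (γ₂ i.ε) i.ε) (pApprox σ A B ζ (γ₁ i.ε) i.ε) i.j i.t =
        i.ε ^ 6 * R i := by
  obtain ⟨RT, hRT, hT⟩ := Pt.hasDerivWithinAt_qApprox K E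
  have hM := majorant_congr hA hB
  obtain ⟨AT, fA⟩ := K.fieldCorrA σ
  obtain ⟨BT, fB⟩ := K.fieldCorrB σ
  obtain ⟨_, _, _, fAX⟩ := K.fieldCorrAX σ
  obtain ⟨_, _, _, fBX⟩ := K.fieldCorrBX σ
  have one : |(1 : ℝ)| ≤ 1 := by norm_num
  have p := fun k hk => K.fieldDiff (k := k) hk
  obtain ⟨ρ0, hρ0, e0⟩ := exists_taylor hM 4 (F := waveDiff A B)
    (fun k hk => (p k (by omega)).dX) (p 3 le_rfl).domX one
  obtain ⟨ρA, hρA, eA⟩ := fA.exists_taylor_two hM fAX one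
  obtain ⟨ρB, hρB, eB⟩ := fB.exists_taylor_two hM fBX one
  obtain ⟨ρ2, hρ2, e2⟩ := (p 2 (by norm_num)).exists_taylor_two hM (p 3 le_rfl) one
  obtain ⟨ρ3, hρ3, e3⟩ := (p 3 le_rfl).exists_taylor_one hM one
  refine ⟨fun i => ρ0 i + (ρB i - ρA i) + ζ (i.j + 1) * ρ2 i + γ₁ i.ε (i.j + 1) * ρ3 i
    - (i.j.sign : ℝ) * (γ₁ i.ε i.j * Pt.eval (waveDiff A B 3) i) - RT i, ?_, fun i hi => ?_⟩
  · repeat' first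
      | exact hρ0.siteMaj
      | exact hρA.siteMaj
      | exact hρB.siteMaj
      | exact hρ2.siteMaj
      | exact hRT
      | exact hρ3.ar_mul (abs_ar₁_succ_le γ₁ γ₂)
      | exact (p 3 le_rfl).dom.onSite.ar_mul (abs_ar₁_le γ₁ γ₂)
      | exact E.bd_noise _
      | exact bd_sign _
      | apply Dom.sub
      | apply Dom.add
      | apply Dom.bd_mul
  · have hε := hi.1.1
    have hd : timeDeriv T₀ i.ε (qApprox σ T₀ A B ζ (γ₂ i.ε) i.ε) i.j i.t = _ :=
      (hT i hi).derivWithin (uniqueDiffOn_timeInterval K.pos hε.1 _ hi.1.2.1)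
    have hr := (E.ar₁ i.ε hε).2 i.j
    have hI := corr_identity₁ σ A B i.y (i.ε * i.t) (i.ε ^ 3 * i.t)
    have hsh : i.y + 1 * i.ε = i.ε * ((i.j + 1 : ℤ) : ℝ) := by rw [hi.2]; push_cast; ring
    have f0 := e0 i hi
    have f2 := e2 i hi
    have f3 := e3 i hi
    have fA := eA i hi
    have fB := eB i hi
    rw [res₁, hd]
    simp only [deltaPlus, K.pApprox_eq ζ _ hε _ hi.1.2.1, pForm, ← hi.2, ← hsh]
    simp only [Finset.sum_range_succ, Finset.sum_range_zero, Nat.factorial, Pt.eval, Pt.shift,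
      deltaPlus, qFormT] at f0 f2 f3 fA fB hr hI ⊢
    rw [f0, f2, f3, fA, fB]
    push_cast
    -- At order `ε⁵` the equation of `γ₁` cancels `(ζ + S⁺ζ) ∂_X³P₀`, and `hI` disposes of the
    -- deterministic part; the damping of `γ₁` has been placed in the remainder.
    linear_combination i.ε ^ 5 * hI +
      i.ε ^ 5 * waveDiff A B 3 i.y (i.ε * i.t) (i.ε ^ 3 * i.t) * hr

theorem fieldSumSq (K : KdVPair (1 / 12 + 2 * σ ^ 2) T₀ A B MA MB hA hB) : ∃ Φτ ΦT,
    WaveField T₀ (majorant hA hB) (fun X τ T => waveSum A B 0 X τ T * waveSum A B 0 X τ T)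
      (fun X τ T => 2 * (waveSum A B 0 X τ T * waveSum A B 1 X τ T)) Φτ ΦT :=
  ⟨_, _, ((K.fieldSum (k := 0) (by norm_num)).mul ((K.fieldSum (k := 0) (by norm_num)).one
    K.bd_majorant)).congr (fun _ _ _ => rfl) (fun _ _ _ => by ring) fun _ _ _ => rfl⟩

/-- The terms of order `ε⁴` and higher in `qForm`, divided by `ε⁴`. -/
noncomputable def qTail (σ : ℝ) (A B : ℝ → ℝ → ℝ) (z d g ε : ℝ) (X τ T : ℝ) : ℝ :=
  corrA σ A B X τ T + corrB σ A B X τ T - z * waveSum A B 2 X τ T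
    + ((ε * g + ε * (1 / 2 * z)) * waveSum A B 3 X τ T
      - ε * d * (2 * (waveSum A B 0 X τ T * waveSum A B 1 X τ T)) + ε * d * corrE σ A B X τ T)

/-- The terms of order `ε⁶` and higher in the square of `qForm`, divided by `ε⁶`. -/
noncomputable def qSqTail (σ : ℝ) (A B : ℝ → ℝ → ℝ) (z d g ε : ℝ) (X τ T : ℝ) : ℝ :=
  ((1 / 2 + d) * waveSum A B 1 X τ T) * ((1 / 2 + d) * waveSum A B 1 X τ T)
    + 2 * (waveSum A B 0 X τ T * qTail σ A B z d g ε X τ T)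
    + 2 * (ε * (((1 / 2 + d) * waveSum A B 1 X τ T) * qTail σ A B z d g ε X τ T))
    + ε * (ε * (qTail σ A B z d g ε X τ T * qTail σ A B z d g ε X τ T))

/-- The `ε⁴` and `ε⁵` terms are kept explicit. The left difference gains an `ε` on the former; on
the latter it also hits the noise and gains nothing. The `ε⁶` tail is estimated without
differencing. -/
theorem _root_.qForm_sq (σ : ℝ) (A B : ℝ → ℝ → ℝ) (z d g ε X τ T : ℝ) :
    qForm σ A B z d g ε X τ T * qForm σ A B z d g ε X τ T =
      ε ^ 4 * (waveSum A B 0 X τ T * waveSum A B 0 X τ T)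
      + 2 * ε ^ 5 * ((1 / 2 + d) * (waveSum A B 0 X τ T * waveSum A B 1 X τ T))
      + ε ^ 6 * qSqTail σ A B z d g ε X τ T := by
  simp only [qForm, qSqTail, qTail]
  ring

theorem dom_qTail (K : KdVPair (1 / 12 + 2 * σ ^ 2) T₀ A B MA MB hA hB) {z d g : Pt → ℝ}
    (hz : Bd (Pt.onSite T₀) z) (hd : Bd (Pt.onSite T₀) d)
    (hg : Bd (Pt.onSite T₀) (fun i => i.ε * g i)) {s : ℝ} (hs : |s| ≤ 1) :
    Dom (Pt.onSite T₀) (majorant hA hB)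
      (fun i => Pt.eval (qTail σ A B (z i) (d i) (g i) i.ε) (i.shift s)) := by
  obtain ⟨AT, fA⟩ := K.fieldCorrA σ
  obtain ⟨BT, fB⟩ := K.fieldCorrB σ
  obtain ⟨_, _, _, fE⟩ := K.fieldCorrE σ
  obtain ⟨_, fM⟩ := K.fieldSumMul
  have q := fun k hk => (K.fieldSum (k := k) hk).dom.shift hs
  have hA := fA.dom.shift hs
  have hB := fB.dom.shift hs
  have hE := fE.dom.shift hs
  have hM := fM.dom.shift hs
  have q2 := q 2 (by norm_num)
  have q3 := q 3 (by norm_num)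
  simp only [Pt.eval, qTail] at *
  repeat' first
    | assumption
    | exact bd_onSite_ε
    | exact Bd.const _
    | apply Dom.sub
    | apply Dom.add
    | apply Dom.const_mul
    | apply Dom.bd_mul
    | apply Bd.add
    | apply Bd.mul

theorem dom_qSqTail (K : KdVPair (1 / 12 + 2 * σ ^ 2) T₀ A B MA MB hA hB) {z d g : Pt → ℝ}
    (hz : Bd (Pt.onSite T₀) z) (hd : Bd (Pt.onSite T₀) d)
    (hg : Bd (Pt.onSite T₀) (fun i => i.ε * g i)) {s : ℝ} (hs : |s| ≤ 1) :
    Dom (Pt.onSite T₀) (majorant hA hB)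
      (fun i => Pt.eval (qSqTail σ A B (z i) (d i) (g i) i.ε) (i.shift s)) := by
  have hb : Bd (Pt.onSite T₀) (majorant hA hB) := by
    obtain ⟨C, hC0, hC⟩ := K.bd_majorant
    exact ⟨C, hC0, fun i hi => hC i hi.1⟩
  have hw := K.dom_qTail hz hd hg hs
  have hw' := hw.bd hb
  have q0 := (K.fieldSum (k := 0) (by norm_num)).dom.shift hs
  have q1 := (K.fieldSum (k := 1) (by norm_num)).dom.shift hs
  have hd' : Bd (Pt.onSite T₀) (fun i => 1 / 2 + d i) := (Bd.const _).add hd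
  have hu := Dom.bd_mul hd' q1
  have hu' := hu.bd hb
  exact (((hu.mul_bd hu').add ((q0.mul_bd hw').const_mul 2)).add
    ((Dom.bd_mul bd_onSite_ε (hu.mul_bd hw')).const_mul 2)).add
    (Dom.bd_mul bd_onSite_ε (Dom.bd_mul bd_onSite_ε (hw.mul_bd hw')))

theorem deriv_springPotential (x : ℝ) : deriv springPotential x = x + x * x := by
  have h : HasDerivAt springPotential (1 / 2 * (2 * x) + 1 / 3 * (3 * x ^ 2)) x := by
    unfold springPotential
    refine (((hasDerivAt_pow 2 x).const_mul (1 / 2)).add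
      ((hasDerivAt_pow 3 x).const_mul (1 / 3))).congr_deriv ?_
    norm_num
  rw [h.deriv]
  ring

/-- The force is matched with `m ∂ₜp̃` before dividing by the mass. As `δ⁻δ⁺ζ = m - 1`, the `δ⁺ζ`
terms of `Q₁` and `Q₃` restore the factor `m` in front of the deterministic terms, and `m` times the
`ζ` term of `∂ₜp̃` explains `ζ δ⁺δ⁻ζ` in the drive of `γ₂`. -/
theorem dom_deltaMinus_force (K : KdVPair (1 / 12 + 2 * σ ^ 2) T₀ A B MA MB hA hB)
    (E : Environment σ ζ γ₁ γ₂) : ∃ R : Pt → ℝ,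
    Dom (Pt.onSite T₀) (siteMaj γ₁ γ₂ (majorant hA hB)) R ∧ ∀ i ∈ Pt.onSite T₀,
      deltaMinus (fun k => deriv springPotential (qApprox σ T₀ A B ζ (γ₂ i.ε) i.ε k i.t)) i.j =
        mass ζ i.j * Pt.eval (pFormT σ A B (ζ i.j) i.ε) i + i.ε ^ 6 * R i := by
  have hM := majorant_congr hA hB
  obtain ⟨AT, fA⟩ := K.fieldCorrA σ
  obtain ⟨BT, fB⟩ := K.fieldCorrB σ
  obtain ⟨_, _, _, fAX⟩ := K.fieldCorrAX σ
  obtain ⟨_, _, _, fBX⟩ := K.fieldCorrBX σ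
  obtain ⟨_, _, _, fE⟩ := K.fieldCorrE σ
  obtain ⟨_, fM⟩ := K.fieldSumMul
  obtain ⟨_, _, fS⟩ := K.fieldSumSq
  have one : |(-1 : ℝ)| ≤ 1 := by norm_num
  have p := fun k hk => K.fieldSum (k := k) hk
  obtain ⟨ρ0, hρ0, e0⟩ := exists_taylor hM 4 (F := waveSum A B)
    (fun k hk => (p k (by omega)).dX) (p 3 le_rfl).domX one
  obtain ⟨ρ1, hρ1, e1⟩ := exists_taylor hM 3 (F := fun k => waveSum A B (k + 1))
    (fun k hk => (p (k + 1) (by omega)).dX) (p 3 le_rfl).domX one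
  obtain ⟨ρA, hρA, eA⟩ := fA.exists_taylor_two hM fAX one
  obtain ⟨ρB, hρB, eB⟩ := fB.exists_taylor_two hM fBX one
  obtain ⟨ρ2, hρ2, e2⟩ := (p 2 (by norm_num)).exists_taylor_two hM (p 3 le_rfl) one
  obtain ⟨ρ3, hρ3, e3⟩ := (p 3 le_rfl).exists_taylor_one hM one
  obtain ⟨ρE, hρE, eE⟩ := fE.exists_taylor_one hM one
  obtain ⟨ρM, hρM, eM⟩ := fM.exists_taylor_one hM one
  obtain ⟨ρS, hρS, eS⟩ := fS.exists_taylor_two hM (fM.const_mul 2) one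
  have hg : ∀ f : Pt → ℤ, Bd (Pt.onSite T₀) (fun i => i.ε * γ₂ i.ε (f i)) := fun f => by
    obtain ⟨C, hC0, hC⟩ := E.bd₂
    exact ⟨C, hC0, fun i hi => hC _ hi.1.1 _⟩
  -- The tails of the square at `j` and at `j - 1` are bounded separately: the noise differs between
  -- the sites, so their difference gains no power of `ε`.
  have hS := K.dom_qSqTail (E.bd_noise fun i => i.j) (E.bd_delta fun i => i.j) (hg fun i => i.j)
    (s := 0) (by norm_num)
  have hS' := K.dom_qSqTail (E.bd_noise fun i => i.j - 1) (E.bd_delta fun i => i.j - 1)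
    (hg fun i => i.j - 1) one
  refine ⟨fun i => -ρ0 i - (1 / 2 + deltaPlus ζ (i.j - 1)) * ρ1 i
    - (ρA i + ρB i) + ζ (i.j - 1) * ρ2 i - γ₂ i.ε (i.j - 1) * ρ3 i
    - (1 / 2) * (ζ (i.j - 1) * ρ3 i) + 2 * (deltaPlus ζ (i.j - 1) * ρM i)
    - deltaPlus ζ (i.j - 1) * ρE i - (i.j.sign : ℝ) * (γ₂ i.ε i.j * Pt.eval (waveSum A B 3) i)
    - ρS i - 2 * ((1 / 2 + deltaPlus ζ (i.j - 1)) * ρM i)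
    + (Pt.eval (qSqTail σ A B (ζ i.j) (deltaPlus ζ i.j) (γ₂ i.ε i.j) i.ε) (i.shift 0)
      - Pt.eval (qSqTail σ A B (ζ (i.j - 1)) (deltaPlus ζ (i.j - 1)) (γ₂ i.ε (i.j - 1)) i.ε)
        (i.shift (-1))), ?_, fun i hi => ?_⟩
  · repeat' first
      | exact hρ0.siteMaj
      | exact hρ1.siteMaj
      | exact hρA.siteMaj
      | exact hρB.siteMaj
      | exact hρ2.siteMaj
      | exact hρ3.siteMaj
      | exact hρM.siteMaj
      | exact hρE.siteMaj
      | exact hρS.siteMaj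
      | exact hS.siteMaj
      | exact hS'.siteMaj
      | exact hρ3.ar_mul (abs_ar₂_pred_le γ₁ γ₂)
      | exact (p 3 le_rfl).dom.onSite.ar_mul (abs_ar₂_le γ₁ γ₂)
      | exact E.bd_noise _
      | exact E.bd_delta _
      | exact bd_sign _
      | exact Bd.const _
      | apply Dom.sub
      | apply Dom.add
      | apply Dom.neg
      | apply Dom.const_mul
      | apply Dom.bd_mul
      | apply Bd.add
  · have hε := hi.1.1
    have hr := (E.ar₂ i.ε hε).2 i.j
    have hI := corr_identity₂ σ A B i.y (i.ε * i.t) (i.ε ^ 3 * i.t)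
    have hsh : i.ε * ((i.j - 1 : ℤ) : ℝ) = i.y + -1 * i.ε := by rw [hi.2]; push_cast; ring
    have hj : i.j - 1 + 1 = i.j := by ring
    have f0 := e0 i hi
    have f1 := e1 i hi
    have f2 := e2 i hi
    have f3 := e3 i hi
    have fA := eA i hi
    have fB := eB i hi
    have fE := eE i hi
    have fM := eM i hi
    have fS := eS i hi
    simp only [deltaMinus, deriv_springPotential, K.qApprox_eq ζ _ hε _ hi.1.2.1, qForm_sq]
    simp only [qForm, ← hi.2, hsh]
    simp only [Finset.sum_range_succ, Finset.sum_range_zero, Nat.factorial, Pt.eval, Pt.shift,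
      deltaPlus, deltaMinus, mass, hj, corrE, pFormT, add_sub_cancel_right, Nat.reduceAdd, zero_mul, add_zero]
      at f0 f1 f2 f3 fA fB fE fM fS hr hI ⊢
    generalize i.y + -1 * i.ε = y' at *
    rw [fM, fS, f0, f1, f2, f3, fA, fB, fE]
    push_cast
    linear_combination i.ε ^ 5 * hI +
      i.ε ^ 5 * waveSum A B 3 i.y (i.ε * i.t) (i.ε ^ 3 * i.t) * hr

theorem dom_res₂ (K : KdVPair (1 / 12 + 2 * σ ^ 2) T₀ A B MA MB hA hB)
    (E : Environment σ ζ γ₁ γ₂) : ∃ R : Pt → ℝ,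
    Dom (Pt.onSite T₀) (siteMaj γ₁ γ₂ (majorant hA hB)) R ∧ ∀ i ∈ Pt.onSite T₀,
      res₂ T₀ i.ε (mass ζ) (qApprox σ T₀ A B ζ (γ₂ i.ε) i.ε) (pApprox σ A B ζ (γ₁ i.ε) i.ε) i.j
        i.t = i.ε ^ 6 * R i := by
  obtain ⟨RT, hRT, hT⟩ := Pt.hasDerivWithinAt_pApprox K E
  obtain ⟨RF, hRF, hF⟩ := K.dom_deltaMinus_force E
  obtain ⟨b, hb0, hb⟩ := E.mass_pos
  have hm : Bd (Pt.onSite T₀) (fun i => 1 / mass ζ i.j) := by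
    refine ⟨1 / b, by positivity, fun i _ => ?_⟩
    rw [abs_of_pos (one_div_pos.mpr (hb0.trans_le (hb _)))]
    exact one_div_le_one_div_of_le hb0 (hb _)
  refine ⟨fun i => 1 / mass ζ i.j * RF i - RT i, (hRF.bd_mul hm).sub hRT, fun i hi => ?_⟩
  have hd : timeDeriv T₀ i.ε (pApprox σ A B ζ (γ₁ i.ε) i.ε) i.j i.t = _ :=
    (hT i hi).derivWithin (uniqueDiffOn_timeInterval K.pos hi.1.1.1 _ hi.1.2.1)
  have hm0 : mass ζ i.j ≠ 0 := (hb0.trans_le (hb _)).ne'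
  rw [res₂, hd, hF i hi]
  field_simp
  ring

end KdVPair

end

/-! ### Norms on the lattice and Riemann sums -/

theorem enorm_sq_eq_ofReal (x : ℝ) : ‖x‖ₑ ^ 2 = ENNReal.ofReal (x ^ 2) := by
  rw [← ofReal_norm, ← ENNReal.ofReal_pow (norm_nonneg _), Real.norm_eq_abs, sq_abs]

theorem ell2Norm_le_ofReal {f u : ℤ → ℝ} (hf : ∀ j, f j ^ 2 ≤ u j) (hu : Summable u) {R : ℝ}
    (hR : 0 ≤ R) (h : ∑' j, u j ≤ R ^ 2) : ell2Norm f ≤ ENNReal.ofReal R := by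
  have h1 : ∑' j, ‖f j‖ₑ ^ 2 ≤ ENNReal.ofReal (R ^ 2) := by
    simp only [enorm_sq_eq_ofReal]
    refine (ENNReal.tsum_le_tsum fun j => ENNReal.ofReal_le_ofReal (hf j)).trans ?_
    rw [← ENNReal.ofReal_tsum_of_nonneg (fun j => (sq_nonneg _).trans (hf j)) hu]
    exact ENNReal.ofReal_le_ofReal h
  refine (ENNReal.rpow_le_rpow h1 (by norm_num)).trans (le_of_eq ?_)
  rw [ENNReal.ofReal_rpow_of_nonneg (sq_nonneg R) (by norm_num), ← Real.sqrt_eq_rpow,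
    Real.sqrt_sq hR]

/-- Subadditivity of the square root bounds the sum of the two norms below by the joint one. -/
theorem ofReal_le_ell2Norm_add {f g : ℤ → ℝ} {R : ℝ} (hR : 0 ≤ R)
    (hs : Summable fun j => f j ^ 2 + g j ^ 2) (h : R ^ 2 ≤ ∑' j, (f j ^ 2 + g j ^ 2)) :
    ENNReal.ofReal R ≤ ell2Norm f + ell2Norm g := by
  refine le_trans ?_ (ENNReal.rpow_add_le_add_rpow _ _ (by norm_num) (by norm_num))
  have h1 : ENNReal.ofReal (R ^ 2) ≤ ∑' j, ‖f j‖ₑ ^ 2 + ∑' j, ‖g j‖ₑ ^ 2 := by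
    rw [← ENNReal.tsum_add]
    refine (ENNReal.ofReal_le_ofReal h).trans (le_of_eq ?_)
    rw [ENNReal.ofReal_tsum_of_nonneg (fun j => by positivity) hs]
    refine tsum_congr fun j => ?_
    rw [enorm_sq_eq_ofReal, enorm_sq_eq_ofReal, ENNReal.ofReal_add (sq_nonneg _) (sq_nonneg _)]
  refine le_trans (le_of_eq ?_) (ENNReal.rpow_le_rpow h1 (by norm_num))
  rw [ENNReal.ofReal_rpow_of_nonneg (sq_nonneg R) (by norm_num), ← Real.sqrt_eq_rpow,
    Real.sqrt_sq hR]

namespace WaveBounds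

variable {T₀ : ℝ} {v : ℝ → ℝ → ℝ} {M : ℝ} {h : ℝ → ℝ → ℝ}

theorem summable_sq (H : WaveBounds T₀ v M h) {T ε : ℝ} (hT : T ∈ Icc (-T₀) T₀)
    (hε : ε ∈ Ioc (0 : ℝ) 1) (s : ℝ) :
    Summable (fun j : ℤ => h T (ε * j - s) ^ 2) ∧ ∑' j : ℤ, h T (ε * j - s) ^ 2 ≤ M / ε := by
  have hle : ∀ j : ℤ, h T (ε * j - s) ^ 2 ≤ (1 + (ε * j - s) ^ 2) * h T (ε * j - s) ^ 2 :=
    fun j => le_mul_of_one_le_left (sq_nonneg _) (by linarith [sq_nonneg (ε * j - s)])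
  have hs := (H.summable T hT ε hε s).of_nonneg_of_le (fun j => sq_nonneg _) hle
  exact ⟨hs, (hs.tsum_le_tsum hle (H.summable T hT ε hε s)).trans (H.tsum_le T hT ε hε s)⟩

/-- The derivative of `v²` is at most `2h²` within distance one of `x`. -/
theorem sq_le_add (H : WaveBounds T₀ v M h) {T : ℝ} (hT : T ∈ Icc (-T₀) T₀) {x y δ : ℝ}
    (hδ : δ ≤ 1) (hxy : |y - x| ≤ δ) : v y T ^ 2 ≤ v x T ^ 2 + 2 * δ * h T x ^ 2 := by
  have hd : ∀ z, HasDerivAt (fun z => v z T ^ 2) (2 * (jet v 0 z T * jet v 1 z T)) z := fun z => by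
    have := (H.hasDerivAt T hT 0 (by norm_num) z).pow 2
    simp only [jet_zero] at this ⊢
    refine this.congr_deriv ?_
    push_cast
    ring
  have hδ0 : 0 ≤ δ := (abs_nonneg _).trans hxy
  have hb : ∀ z ∈ Icc (x - δ) (x + δ), ‖2 * (jet v 0 z T * jet v 1 z T)‖ ≤ 2 * h T x ^ 2 := by
    intro z hz
    have hz' : |z - x| ≤ 1 := abs_le.mpr ⟨by linarith [hz.1], by linarith [hz.2]⟩
    rw [Real.norm_eq_abs, abs_mul, abs_mul, abs_two, sq]
    have := H.nonneg T x
    gcongr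
    · exact H.jet_le T hT 0 (by norm_num) x z hz'
    · exact H.jet_le T hT 1 (by norm_num) x z hz'
  have := (convex_Icc (x - δ) (x + δ)).norm_image_sub_le_of_norm_hasDerivWithin_le
    (fun z _ => (hd z).hasDerivWithinAt) hb (x := x) (y := y) ⟨by linarith, by linarith⟩
    ⟨by linarith [(abs_le.mp hxy).1], by linarith [(abs_le.mp hxy).2]⟩
  rw [Real.norm_eq_abs, Real.norm_eq_abs] at this
  have h2 : 2 * h T x ^ 2 * |y - x| ≤ 2 * h T x ^ 2 * δ := by gcongr
  linarith [(abs_le.mp this).2]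

/-- Riemann sum comparison on unit cells of `j`: the error in a cell is `2ε h²`, and `∑ h² ≤ M/ε`,
so the total error is the constant `2M`, negligible against `1/ε`. -/
theorem integral_sq_le_tsum (H : WaveBounds T₀ v M h) {T ε : ℝ} (hT : T ∈ Icc (-T₀) T₀)
    (hε : ε ∈ Ioc (0 : ℝ) 1) (s : ℝ) : Summable (fun j : ℤ => v (ε * j - s) T ^ 2) ∧
      (∫ x, v x T ^ 2) / ε ≤ ∑' j : ℤ, v (ε * j - s) T ^ 2 + 2 * M := by
  obtain ⟨hs, hsum⟩ := H.summable_sq hT hε s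
  have hv : Summable (fun j : ℤ => v (ε * j - s) T ^ 2) := by
    refine hs.of_nonneg_of_le (fun j => sq_nonneg _) fun j => ?_
    rw [← sq_abs]
    have := H.jet_le T hT 0 (by norm_num) (ε * j - s) (ε * j - s) (by simp)
    rw [jet_zero] at this
    gcongr
  refine ⟨hv, ?_⟩
  have hint : Integrable (fun x => v (ε * x - s) T ^ 2) :=
    Integrable.comp_mul_left' (g := fun y => v (y - s) T ^ 2)
      ((H.integrable_sq T hT).comp_sub_right s) hε.1.ne'
  have heq : ∫ x, v (ε * x - s) T ^ 2 = (∫ x, v x T ^ 2) / ε := by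
    rw [Measure.integral_comp_mul_left (fun y => v (y - s) T ^ 2) ε,
      integral_sub_right_eq_self (fun y => v y T ^ 2) s, abs_of_pos (inv_pos.mpr hε.1),
      smul_eq_mul, div_eq_inv_mul]
  have hS := hint.hasSum_intervalIntegral 0
  rw [← heq, ← hS.tsum_eq]
  have hle : ∀ n : ℤ, ∫ x in (0 + n : ℝ)..0 + n + 1, v (ε * x - s) T ^ 2 ≤
      v (ε * n - s) T ^ 2 + 2 * ε * h T (ε * n - s) ^ 2 := fun n => by
    have := intervalIntegral.integral_mono_on (μ := volume)
      (show (0 + n : ℝ) ≤ 0 + n + 1 by linarith)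
      hint.intervalIntegrable (intervalIntegrable_const
        (c := v (ε * n - s) T ^ 2 + 2 * ε * h T (ε * n - s) ^ 2)) (fun x hx => by
        refine H.sq_le_add hT hε.2 ?_
        rw [sub_sub_sub_cancel_right, ← mul_sub, abs_mul, abs_of_pos hε.1]
        refine mul_le_of_le_one_right hε.1.le (abs_le.mpr ⟨?_, ?_⟩) <;> linarith [hx.1, hx.2])
    simpa using this
  have hr := hv.add (hs.mul_left (2 * ε))
  refine (hS.summable.tsum_le_tsum hle hr).trans ?_
  rw [hv.tsum_add (hs.mul_left (2 * ε)), tsum_mul_left]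
  have : 2 * ε * ∑' j : ℤ, h T (ε * j - s) ^ 2 ≤ 2 * ε * (M / ε) :=
    mul_le_mul_of_nonneg_left hsum (by linarith [hε.1])
  have e : 2 * ε * (M / ε) = 2 * M := by have := hε.1.ne'; field_simp
  linarith

end WaveBounds

namespace KdVPair

variable {c T₀ : ℝ} {A B : ℝ → ℝ → ℝ} {MA MB : ℝ} {hA hB : ℝ → ℝ → ℝ}

/-- The two waves are centred at `εt` and `-εt`, so the growth of `w` is required to be controlled
relative to both centres, where the weight `1 + X²` of each majorant pays for it. -/
theorem sum_weight_majorant_sq (K : KdVPair c T₀ A B MA MB hA hB) {ε t : ℝ}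
    (hε : ε ∈ Ioo (0 : ℝ) 1) (ht : t ∈ timeInterval T₀ ε) {w : ℤ → ℝ} {L : ℝ}
    (hw : ∀ s, |s| = |ε * t| → ∀ j : ℤ, w j ^ 2 ≤ L * (1 + (ε * j - s) ^ 2)) :
    Summable (fun j : ℤ => (w j * majorant hA hB ⟨ε, t, ε * j, j⟩) ^ 2) ∧
      ∑' j : ℤ, (w j * majorant hA hB ⟨ε, t, ε * j, j⟩) ^ 2 ≤ 2 * L * (MA + MB) / ε := by
  have hT := mul_mem_Icc_of_mem_timeInterval hε.1 ht
  have hε' : ε ∈ Ioc (0 : ℝ) 1 := ⟨hε.1, hε.2.le⟩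
  have hL : 0 ≤ L := by
    have h1 := (sq_nonneg _).trans (hw (ε * t) rfl 0)
    by_contra hL
    nlinarith [sq_nonneg (ε * ((0 : ℤ) : ℝ) - ε * t)]
  have sA := (K.boundsA.summable _ hT ε hε' (ε * t)).mul_left (2 * L)
  have sB := (K.boundsB.summable _ hT ε hε' (-(ε * t))).mul_left (2 * L)
  have hle : ∀ j : ℤ, (w j * majorant hA hB ⟨ε, t, ε * j, j⟩) ^ 2 ≤
      2 * L * ((1 + (ε * j - ε * t) ^ 2) * hA (ε ^ 3 * t) (ε * j - ε * t) ^ 2)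
      + 2 * L * ((1 + (ε * j - -(ε * t)) ^ 2) * hB (ε ^ 3 * t) (ε * j - -(ε * t)) ^ 2) := by
    intro j
    have h1 := mul_le_mul_of_nonneg_right (hw (ε * t) rfl j)
      (sq_nonneg (hA (ε ^ 3 * t) (ε * j - ε * t)))
    have h2 := mul_le_mul_of_nonneg_right (hw (-(ε * t)) (abs_neg _) j)
      (sq_nonneg (hB (ε ^ 3 * t) (ε * j - -(ε * t))))
    simp only [majorant]
    rw [← sub_neg_eq_add (ε * j) (ε * t)]
    nlinarith [mul_nonneg (sq_nonneg (w j)) (sq_nonneg (hA (ε ^ 3 * t) (ε * j - ε * t)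
      - hB (ε ^ 3 * t) (ε * j - -(ε * t))))]
  have hs := (sA.add sB).of_nonneg_of_le (fun j => sq_nonneg _) hle
  refine ⟨hs, (hs.tsum_le_tsum hle (sA.add sB)).trans ?_⟩
  rw [sA.tsum_add sB, tsum_mul_left, tsum_mul_left]
  have e : 2 * L * (MA + MB) / ε = 2 * L * (MA / ε) + 2 * L * (MB / ε) := by ring
  rw [e]
  exact add_le_add
    (mul_le_mul_of_nonneg_left (K.boundsA.tsum_le _ hT ε hε' (ε * t)) (by positivity))
    (mul_le_mul_of_nonneg_left (K.boundsB.tsum_le _ hT ε hε' (-(ε * t))) (by positivity))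

theorem ell2Norm_le (K : KdVPair c T₀ A B MA MB hA hB) {ε t : ℝ}
    (hε : ε ∈ Ioo (0 : ℝ) 1) (ht : t ∈ timeInterval T₀ ε) {w : ℤ → ℝ} {L : ℝ}
    (hw : ∀ s, |s| = |ε * t| → ∀ j : ℤ, w j ^ 2 ≤ L * (1 + (ε * j - s) ^ 2)) {f : ℤ → ℝ} {b : ℝ}
    (hb : 0 ≤ b) (hf : ∀ j, |f j| ≤ b * (w j * majorant hA hB ⟨ε, t, ε * j, j⟩)) :
    ell2Norm f ≤ ENNReal.ofReal (b * √(2 * L * (MA + MB) / ε)) := by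
  obtain ⟨hs, hsum⟩ := K.sum_weight_majorant_sq hε ht hw
  refine ell2Norm_le_ofReal
    (u := fun j => b ^ 2 * (w j * majorant hA hB ⟨ε, t, ε * j, j⟩) ^ 2) (fun j => ?_)
    (hs.mul_left _) (mul_nonneg hb (Real.sqrt_nonneg _)) ?_
  · rw [← sq_abs, ← mul_pow]
    exact pow_le_pow_left₀ (abs_nonneg _) (hf j) 2
  · rw [tsum_mul_left, mul_pow, Real.sq_sqrt ((tsum_nonneg fun j => sq_nonneg _).trans hsum)]
    exact mul_le_mul_of_nonneg_left hsum (sq_nonneg _)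

end KdVPair

/-! ### The asymptotic estimates -/

section

variable {σ T₀ : ℝ} {A B : ℝ → ℝ → ℝ} {MA MB : ℝ} {hA hB : ℝ → ℝ → ℝ} {ζ : ℤ → ℝ}
  {γ₁ γ₂ : ℝ → ℤ → ℝ}

theorem sqrt_div_eq_mul_rpow {a ε : ℝ} (ha : 0 ≤ a) (hε : 0 < ε) :
    √(a / ε) = √a * ε ^ (-(1 / 2) : ℝ) := by
  rw [Real.sqrt_div ha, Real.rpow_neg hε.le, ← Real.sqrt_eq_rpow, div_eq_mul_inv]

namespace KdVPair

theorem bd_onSite_majorant {c : ℝ} (K : KdVPair c T₀ A B MA MB hA hB) :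
    Bd (Pt.onSite T₀) (majorant hA hB) := by
  obtain ⟨C, hC0, hC⟩ := K.bd_majorant
  exact ⟨C, hC0, fun i hi => hC i hi.1⟩

theorem dom_qApprox (K : KdVPair (1 / 12 + 2 * σ ^ 2) T₀ A B MA MB hA hB)
    (E : Environment σ ζ γ₁ γ₂) : ∃ R : Pt → ℝ,
    Dom (Pt.onSite T₀) (majorant hA hB) R ∧ ∀ i ∈ Pt.onSite T₀,
      qApprox σ T₀ A B ζ (γ₂ i.ε) i.ε i.j i.t =
        i.ε ^ 2 * Pt.eval (waveSum A B 0) i + i.ε ^ 3 * R i := by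
  have hg : Bd (Pt.onSite T₀) (fun i => i.ε * γ₂ i.ε i.j) := by
    obtain ⟨C, hC0, hC⟩ := E.bd₂
    exact ⟨C, hC0, fun i hi => hC _ hi.1.1 _⟩
  have hw := K.dom_qTail (E.bd_noise fun i => i.j) (E.bd_delta fun i => i.j) hg
    (s := 0) (by norm_num)
  have q1 := (K.fieldSum (k := 1) (by norm_num)).dom.onSite
  refine ⟨_, (Dom.bd_mul ((Bd.const (1 / 2)).add (E.bd_delta fun i => i.j)) q1).add
    (Dom.bd_mul bd_onSite_ε hw), fun i hi => ?_⟩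
  rw [K.qApprox_eq ζ _ hi.1.1 _ hi.1.2.1]
  simp only [Pt.eval, Pt.shift, qTail, qForm, ← hi.2, zero_mul, add_zero]
  ring

theorem dom_pApprox (K : KdVPair (1 / 12 + 2 * σ ^ 2) T₀ A B MA MB hA hB)
    (E : Environment σ ζ γ₁ γ₂) : ∃ R : Pt → ℝ,
    Dom (Pt.onSite T₀) (majorant hA hB) R ∧ ∀ i ∈ Pt.onSite T₀,
      pApprox σ A B ζ (γ₁ i.ε) i.ε i.j i.t =
        i.ε ^ 2 * Pt.eval (waveDiff A B 0) i + i.ε ^ 3 * R i := by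
  have hg : Bd (Pt.onSite T₀) (fun i => i.ε * γ₁ i.ε i.j) := by
    obtain ⟨C, hC0, hC⟩ := E.bd₁
    exact ⟨C, hC0, fun i hi => hC _ hi.1.1 _⟩
  obtain ⟨AT, fA⟩ := K.fieldCorrA σ
  obtain ⟨BT, fB⟩ := K.fieldCorrB σ
  have p2 := (K.fieldDiff (k := 2) (by norm_num)).dom.onSite
  have p3 := (K.fieldDiff (k := 3) (by norm_num)).dom.onSite
  refine ⟨_, Dom.bd_mul bd_onSite_ε (((fA.dom.onSite.neg.add fB.dom.onSite).add
    (Dom.bd_mul (E.bd_noise fun i => i.j) p2)).add (Dom.bd_mul hg p3)), fun i hi => ?_⟩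
  rw [K.pApprox_eq ζ _ hi.1.1 _ hi.1.2.1]
  simp only [Pt.eval, pForm, ← hi.2]
  ring

/-- Since `ε γ₁` and `ε γ₂` are bounded, the remainder `ε⁶ R` is `O(ε⁵)` in supremum norm. -/
theorem bd_timeDeriv_qApprox (K : KdVPair (1 / 12 + 2 * σ ^ 2) T₀ A B MA MB hA hB)
    (E : Environment σ ζ γ₁ γ₂) : ∃ C, 0 ≤ C ∧ ∀ i ∈ Pt.onSite T₀,
      |timeDeriv T₀ i.ε (qApprox σ T₀ A B ζ (γ₂ i.ε) i.ε) i.j i.t| ≤ C * i.ε ^ 3 := by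
  obtain ⟨R, hR, hT⟩ := Pt.hasDerivWithinAt_qApprox K E
  obtain ⟨C₁, hC₁0, hC₁⟩ := E.bd₁
  obtain ⟨C₂, hC₂0, hC₂⟩ := E.bd₂
  have hmaj := K.bd_onSite_majorant
  have hεR : Bd (Pt.onSite T₀) (fun i => i.ε * R i) := by
    obtain ⟨C, hC0, hC⟩ := hR
    obtain ⟨D, hD0, hD⟩ := hmaj
    refine ⟨C * ((1 + 2 * C₁ + 2 * C₂) * D), by positivity, fun i hi => ?_⟩
    have hε := hi.1.1
    have hm := hD i hi
    rw [abs_of_nonneg (K.majorant_nonneg i)] at hm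
    have hw : i.ε * arWeight γ₁ γ₂ i.ε i.j ≤ 1 + 2 * C₁ + 2 * C₂ := by
      have h1 := hC₁ _ hε i.j
      have h2 := hC₁ _ hε (i.j + 1)
      have h3 := hC₂ _ hε i.j
      have h4 := hC₂ _ hε (i.j - 1)
      rw [abs_mul, abs_of_pos hε.1] at h1 h2 h3 h4
      simp only [arWeight]
      nlinarith [hε.2]
    rw [abs_mul, abs_of_pos hε.1]
    calc i.ε * |R i| ≤ i.ε * (C * siteMaj γ₁ γ₂ (majorant hA hB) i) :=
          mul_le_mul_of_nonneg_left (hC i hi) hε.1.le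
      _ = C * ((i.ε * arWeight γ₁ γ₂ i.ε i.j) * majorant hA hB i) := by
          simp only [siteMaj]; ring
      _ ≤ _ := mul_le_mul_of_nonneg_left
        (mul_le_mul hw hm (K.majorant_nonneg i) (by positivity)) hC0
  obtain ⟨AT, fA⟩ := K.fieldCorrA σ
  obtain ⟨BT, fB⟩ := K.fieldCorrB σ
  have p1 := (K.fieldDiff (k := 1) (by norm_num)).dom.onSite.bd hmaj
  have p2 := (K.fieldDiff (k := 2) (by norm_num)).dom.onSite.bd hmaj
  have p3 := (K.fieldDiff (k := 3) (by norm_num)).dom.onSite.bd hmaj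
  have qT := (K.fieldSum (k := 0) (by norm_num)).domT.onSite.bd hmaj
  have hε := bd_onSite_ε (T₀ := T₀)
  have key := (p1.add (hε.mul (((Bd.const (1 / 2)).add (E.bd_delta fun i => i.j)).mul p2))).add
    ((hε.mul hε).mul ((((fA.domτ.onSite.bd hmaj).add (fB.domτ.onSite.bd hmaj)).sub
      ((E.bd_noise fun i => i.j).mul p3)).add qT)) |>.add ((hε.mul hε).mul hεR)
  obtain ⟨C, hC0, hC⟩ := key
  refine ⟨C, hC0, fun i hi => ?_⟩
  have hd : timeDeriv T₀ i.ε (qApprox σ T₀ A B ζ (γ₂ i.ε) i.ε) i.j i.t = _ :=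
    (hT i hi).derivWithin (uniqueDiffOn_timeInterval K.pos hi.1.1.1 _ hi.1.2.1)
  have h3 : 0 < i.ε ^ 3 := pow_pos hi.1.1.1 3
  rw [hd, mul_comm C]
  refine le_trans (le_of_eq ?_) (mul_le_mul_of_nonneg_left (hC i hi) h3.le)
  rw [← abs_of_pos h3, ← abs_mul]
  congr 1
  simp only [Pt.eval, qFormT]
  ring

theorem onSite_mk {ε t : ℝ} (hε : ε ∈ Ioo (0 : ℝ) 1) (ht : t ∈ timeInterval T₀ ε) (j : ℤ) :
    (⟨ε, t, ε * j, j⟩ : Pt) ∈ Pt.onSite T₀ := ⟨⟨hε, ht, by simp⟩, rfl⟩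

theorem isBigOZero_alpha₂ (K : KdVPair (1 / 12 + 2 * σ ^ 2) T₀ A B MA MB hA hB)
    (E : Environment σ ζ γ₁ γ₂) :
    IsBigOZero (fun ε => alpha₂ T₀ ε (qApprox σ T₀ A B ζ (γ₂ ε) ε)) (fun ε => ε ^ 3) := by
  obtain ⟨C, hC0, hC⟩ := K.bd_timeDeriv_qApprox E
  refine ⟨C + 1, by positivity, 1, one_pos, fun ε hε => ?_⟩
  refine iSup₂_le fun t ht => iSup_le fun j => ?_
  rw [← ofReal_norm, Real.norm_eq_abs]
  refine ENNReal.ofReal_le_ofReal ((hC _ (onSite_mk hε ht j)).trans ?_)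
  have h3 : 0 < ε ^ 3 := pow_pos hε.1 3
  simp only
  rw [abs_of_pos h3]
  nlinarith

theorem exists_ell2Norm_le (K : KdVPair (1 / 12 + 2 * σ ^ 2) T₀ A B MA MB hA hB)
    {u : Pt → ℝ} {R v : Pt → ℝ} (hR : Dom (Pt.onSite T₀) (majorant hA hB) R)
    (hv : Dom (Pt.onSite T₀) (majorant hA hB) v)
    (h : ∀ i ∈ Pt.onSite T₀, u i = i.ε ^ 2 * v i + i.ε ^ 3 * R i) :
    ∃ C, 0 ≤ C ∧ ∀ ε ∈ Ioo (0 : ℝ) 1, ∀ t ∈ timeInterval T₀ ε,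
      ell2Norm (fun j => u ⟨ε, t, ε * j, j⟩) ≤ ENNReal.ofReal (C * ε ^ (3 / 2 : ℝ)) := by
  obtain ⟨C, hC0, hC⟩ := hv.add (Dom.bd_mul bd_onSite_ε hR)
  have hM : 0 ≤ 2 * 1 * (MA + MB) := by linarith [K.boundsA.pos, K.boundsB.pos]
  refine ⟨C * √(2 * 1 * (MA + MB)), by positivity, fun ε hε t ht => ?_⟩
  refine (K.ell2Norm_le hε ht (w := fun _ => 1) (L := 1) (fun s _ j => ?_) (b := ε ^ 2 * C)
    (mul_nonneg (sq_nonneg _) hC0) fun j => ?_).trans (le_of_eq ?_)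
  · nlinarith [sq_nonneg (ε * j - s)]
  · have hi := onSite_mk hε ht j
    rw [h _ hi, one_mul, mul_assoc]
    refine le_trans (le_of_eq ?_) (mul_le_mul_of_nonneg_left (hC _ hi) (sq_nonneg ε))
    nth_rewrite 2 [← abs_of_nonneg (sq_nonneg ε)]
    rw [← abs_mul]
    congr 1
    ring
  · rw [sqrt_div_eq_mul_rpow hM hε.1]
    congr 1
    have : ε ^ (3 / 2 : ℝ) = ε ^ 2 * ε ^ (-(1 / 2) : ℝ) := by
      rw [← Real.rpow_natCast, ← Real.rpow_add hε.1]; norm_num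
    rw [this]
    ring

theorem isBigOZero_alpha₁ (K : KdVPair (1 / 12 + 2 * σ ^ 2) T₀ A B MA MB hA hB)
    (E : Environment σ ζ γ₁ γ₂) :
    IsBigOZero (fun ε => alpha₁ T₀ ε (qApprox σ T₀ A B ζ (γ₂ ε) ε) (pApprox σ A B ζ (γ₁ ε) ε))
      (fun ε => ε ^ (3 / 2 : ℝ)) := by
  obtain ⟨R, hR, hq⟩ := K.dom_qApprox E
  obtain ⟨R', hR', hp⟩ := K.dom_pApprox E
  obtain ⟨C, hC0, hC⟩ := K.exists_ell2Norm_le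
    (u := fun i => qApprox σ T₀ A B ζ (γ₂ i.ε) i.ε i.j i.t) hR
    (K.fieldSum (k := 0) (by norm_num)).dom.onSite hq
  obtain ⟨C', hC'0, hC'⟩ := K.exists_ell2Norm_le
    (u := fun i => pApprox σ A B ζ (γ₁ i.ε) i.ε i.j i.t) hR'
    (K.fieldDiff (k := 0) (by norm_num)).dom.onSite hp
  refine ⟨C + C' + 1, by positivity, 1, one_pos, fun ε hε => iSup₂_le fun t ht => ?_⟩
  have h0 : 0 ≤ ε ^ (3 / 2 : ℝ) := Real.rpow_nonneg hε.1.le _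
  refine (add_le_add (hC ε hε t ht) (hC' ε hε t ht)).trans ?_
  rw [← ENNReal.ofReal_add (by positivity) (by positivity)]
  refine ENNReal.ofReal_le_ofReal ?_
  simp only
  rw [abs_of_nonneg h0]
  nlinarith

/-- The weights contribute `(|ln ε|/ε)^(1/2)` and the lattice sum `ε^(-1/2)`, so `ε⁶` becomes `ε⁵
|ln ε|^(1/2)`. The range of `s` in the hypothesis is that of `±εt` for `|t| ≤ T₀/ε³`. -/
theorem isBigOZero_alpha₃ (K : KdVPair (1 / 12 + 2 * σ ^ 2) T₀ A B MA MB hA hB)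
    (E : Environment σ ζ γ₁ γ₂)
    (hw : ∃ C, 0 ≤ C ∧ ∀ ε ∈ Ioo (0 : ℝ) (1 / 2), ∀ s, |s| ≤ T₀ / ε ^ 2 → ∀ j : ℤ,
      arWeight γ₁ γ₂ ε j ^ 2 ≤ C * (|Real.log ε| / ε) * (1 + (ε * j - s) ^ 2)) :
    IsBigOZero (fun ε => alpha₃ T₀ ε (mass ζ) (qApprox σ T₀ A B ζ (γ₂ ε) ε)
      (pApprox σ A B ζ (γ₁ ε) ε)) (fun ε => ε ^ 5 * √|Real.log ε|) := by
  obtain ⟨R, ⟨C₁, hC₁0, hC₁⟩, h₁⟩ := K.dom_res₁ E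
  obtain ⟨R', ⟨C₂, hC₂0, hC₂⟩, h₂⟩ := K.dom_res₂ E
  obtain ⟨D, hD0, hD⟩ := hw
  have hM : 0 < MA + MB := by linarith [K.boundsA.pos, K.boundsB.pos]
  refine ⟨(C₁ + C₂) * √(2 * D * (MA + MB)) + 1, by positivity, 1 / 2, by norm_num,
    fun ε hε => iSup₂_le fun t ht => ?_⟩
  have hε' : ε ∈ Ioo (0 : ℝ) 1 := ⟨hε.1, hε.2.trans (by norm_num)⟩
  have h6 : 0 ≤ ε ^ 6 := pow_nonneg hε.1.le 6
  have hs : ∀ s, |s| = |ε * t| → ∀ j : ℤ,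
      arWeight γ₁ γ₂ ε j ^ 2 ≤ D * (|Real.log ε| / ε) * (1 + (ε * j - s) ^ 2) := by
    intro s hs j
    refine hD ε hε s ?_ j
    have h1 : |t| ≤ T₀ / ε ^ 3 := abs_le.mpr ht
    rw [hs, abs_mul, abs_of_pos hε.1]
    refine (mul_le_mul_of_nonneg_left h1 hε.1.le).trans (le_of_eq ?_)
    have := hε.1.ne'
    field_simp
  have key : ∀ {f : ℤ → ℝ} {g : Pt → ℝ} {C : ℝ}, 0 ≤ C →
      (∀ i ∈ Pt.onSite T₀, |g i| ≤ C * siteMaj γ₁ γ₂ (majorant hA hB) i) →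
      (∀ j : ℤ, f j = ε ^ 6 * g ⟨ε, t, ε * j, j⟩) →
      ell2Norm f ≤ ENNReal.ofReal
        (C * √(2 * D * (MA + MB)) * (ε ^ 5 * √|Real.log ε|)) := by
    intro f g C hC0 hC hf
    refine (K.ell2Norm_le hε' ht hs (b := ε ^ 6 * C) (mul_nonneg h6 hC0) fun j => ?_).trans
      (le_of_eq ?_)
    · rw [hf, abs_mul, abs_of_nonneg h6, mul_assoc]
      exact mul_le_mul_of_nonneg_left (hC _ (onSite_mk hε' ht j)) h6
    · congr 1
      have e : 2 * (D * (|Real.log ε| / ε)) * (MA + MB) / ε =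
          2 * D * (MA + MB) * (|Real.log ε| * (1 / ε) ^ 2) := by
        have := hε.1.ne'
        field_simp
      rw [e, Real.sqrt_mul (by positivity), Real.sqrt_mul (abs_nonneg _),
        Real.sqrt_sq (by have := hε.1; positivity)]
      have := hε.1.ne'
      field_simp
  have hX : 0 ≤ ε ^ 5 * √|Real.log ε| := by have := hε.1; positivity
  refine (add_le_add (key hC₁0 hC₁ fun j => h₁ _ (onSite_mk hε' ht j))
    (key hC₂0 hC₂ fun j => h₂ _ (onSite_mk hε' ht j))).trans ?_
  rw [← ENNReal.ofReal_add (by positivity) (by positivity)]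
  refine ENNReal.ofReal_le_ofReal ?_
  simp only
  rw [abs_of_nonneg hX]
  nlinarith

theorem isBigOZero_inv_beta₁ (K : KdVPair (1 / 12 + 2 * σ ^ 2) T₀ A B MA MB hA hB)
    (E : Environment σ ζ γ₁ γ₂) {N : ℝ} (hN : 0 < N)
    (hAB : ∀ T ∈ Icc (-T₀) T₀, N ≤ (∫ x, A x T ^ 2) + ∫ x, B x T ^ 2) :
    IsBigOZero (fun ε => (beta₁ T₀ ε (qApprox σ T₀ A B ζ (γ₂ ε) ε)
      (pApprox σ A B ζ (γ₁ ε) ε))⁻¹) (fun ε => ε ^ (-(3 / 2) : ℝ)) := by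
  obtain ⟨R, ⟨C₁, hC₁0, hC₁⟩, hq⟩ := K.dom_qApprox E
  obtain ⟨R', ⟨C₂, hC₂0, hC₂⟩, hp⟩ := K.dom_pApprox E
  have hM : 0 < MA + MB := by linarith [K.boundsA.pos, K.boundsB.pos]
  set D := 2 * (MA + MB) + (C₁ ^ 2 + C₂ ^ 2) * (2 * (MA + MB)) with hD
  have hD0 : 0 < D := by positivity
  -- For `ε D ≤ N/2` the Riemann sum error and the higher order terms together consume at most half
  -- of the energy `N`.
  refine ⟨(√(N / 2))⁻¹, by positivity, min (1 / 2) (N / (2 * D)), by positivity, fun ε hε => ?_⟩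
  have hε1 : ε ∈ Ioo (0 : ℝ) 1 := ⟨hε.1, (hε.2.trans_le (min_le_left _ _)).trans (by norm_num)⟩
  have hεN : ε * D ≤ N / 2 := by
    have := (hε.2.trans_le (min_le_right _ _)).le
    rw [le_div_iff₀ (by positivity)] at this
    linarith
  have h0 := hε1.1
  have hpos : 0 < √(N / 2) * ε ^ (3 / 2 : ℝ) := by positivity
  have hle : ENNReal.ofReal (√(N / 2) * ε ^ (3 / 2 : ℝ)) ≤ beta₁ T₀ ε
      (qApprox σ T₀ A B ζ (γ₂ ε) ε) (pApprox σ A B ζ (γ₁ ε) ε) := by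
    refine le_iInf₂ fun t ht => ?_
    have hT := mul_mem_Icc_of_mem_timeInterval h0 ht
    have hε' : ε ∈ Ioc (0 : ℝ) 1 := ⟨h0, hε1.2.le⟩
    obtain ⟨sA, iA⟩ := K.boundsA.integral_sq_le_tsum hT hε' (ε * t)
    obtain ⟨sB, iB⟩ := K.boundsB.integral_sq_le_tsum hT hε' (-(ε * t))
    obtain ⟨sH, iH⟩ := K.sum_weight_majorant_sq hε1 ht (w := fun _ => 1) (L := 1)
      (fun s _ j => by nlinarith [sq_nonneg (ε * j - s)])
    simp only [one_mul] at sH iH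
    have hlow : ∀ j : ℤ, ε ^ 4 * (A (ε * j - ε * t) (ε ^ 3 * t) ^ 2
        + B (ε * j - -(ε * t)) (ε ^ 3 * t) ^ 2)
        - ε ^ 6 * (C₁ ^ 2 + C₂ ^ 2) * majorant hA hB ⟨ε, t, ε * j, j⟩ ^ 2 ≤
        qApprox σ T₀ A B ζ (γ₂ ε) ε j t ^ 2 + pApprox σ A B ζ (γ₁ ε) ε j t ^ 2 := by
      intro j
      have hi := onSite_mk hε1 ht j
      have e1 := hq _ hi
      have e2 := hp _ hi
      have b1 := pow_le_pow_left₀ (abs_nonneg _) (hC₁ _ hi) 2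
      have b2 := pow_le_pow_left₀ (abs_nonneg _) (hC₂ _ hi) 2
      rw [sq_abs, mul_pow] at b1 b2
      simp only [Pt.eval, waveSum, waveDiff, WaveBounds.jet_zero] at e1 e2
      rw [e1, e2, sub_neg_eq_add]
      have b3 := mul_le_mul_of_nonneg_left (add_le_add b1 b2) (pow_nonneg h0.le 6)
      generalize R ⟨ε, t, ε * j, j⟩ = r at *
      generalize R' ⟨ε, t, ε * j, j⟩ = r' at *
      generalize A (ε * j - ε * t) (ε ^ 3 * t) = a at *
      generalize B (ε * j + ε * t) (ε ^ 3 * t) = b at *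
      -- Uses `(x + r)² ≥ x²/2 - r²`, whose defect is `(x + 2r)²/2`, together with `(a + b)² + (-a +
      -- b)² = 2(a² + b²)`.
      nlinarith [sq_nonneg (ε ^ 2 * (a + b) + 2 * (ε ^ 3 * r)),
        sq_nonneg (ε ^ 2 * (-a + b) + 2 * (ε ^ 3 * r'))]
    have hupp : Summable fun j : ℤ => qApprox σ T₀ A B ζ (γ₂ ε) ε j t ^ 2
        + pApprox σ A B ζ (γ₁ ε) ε j t ^ 2 := by
      have s1 := ((sA.add sB).mul_left (4 * ε ^ 4)).add
        (sH.mul_left (2 * ε ^ 6 * (C₁ ^ 2 + C₂ ^ 2)))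
      refine s1.of_nonneg_of_le (fun j => by positivity) fun j => ?_
      have hi := onSite_mk hε1 ht j
      have e1 := hq _ hi
      have e2 := hp _ hi
      have b1 := pow_le_pow_left₀ (abs_nonneg _) (hC₁ _ hi) 2
      have b2 := pow_le_pow_left₀ (abs_nonneg _) (hC₂ _ hi) 2
      rw [sq_abs, mul_pow] at b1 b2
      simp only [Pt.eval, waveSum, waveDiff, WaveBounds.jet_zero] at e1 e2
      rw [e1, e2, sub_neg_eq_add]
      have b3 := mul_le_mul_of_nonneg_left (add_le_add b1 b2) (pow_nonneg h0.le 6)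
      generalize R ⟨ε, t, ε * j, j⟩ = r at *
      generalize R' ⟨ε, t, ε * j, j⟩ = r' at *
      generalize A (ε * j - ε * t) (ε ^ 3 * t) = a at *
      generalize B (ε * j + ε * t) (ε ^ 3 * t) = b at *
      nlinarith [sq_nonneg (ε ^ 2 * (a + b) - ε ^ 3 * r),
        sq_nonneg (ε ^ 2 * (-a + b) - ε ^ 3 * r')]
    refine ofReal_le_ell2Norm_add hpos.le hupp ?_
    have sl := ((sA.add sB).mul_left (ε ^ 4)).sub (sH.mul_left (ε ^ 6 * (C₁ ^ 2 + C₂ ^ 2)))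
    refine le_trans ?_ (sl.tsum_le_tsum hlow hupp)
    rw [((sA.add sB).mul_left (ε ^ 4)).tsum_sub (sH.mul_left (ε ^ 6 * (C₁ ^ 2 + C₂ ^ 2))),
      tsum_mul_left, tsum_mul_left, sA.tsum_add sB, mul_pow, Real.sq_sqrt (by positivity),
      ← Real.rpow_natCast, ← Real.rpow_mul h0.le]
    have e : ε ^ ((3 / 2 : ℝ) * ((2 : ℕ) : ℝ)) = ε ^ 3 := by
      rw [← Real.rpow_natCast]; norm_num
    rw [e]
    have i1 : N / ε ≤ (∑' j : ℤ, A (ε * j - ε * t) (ε ^ 3 * t) ^ 2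
        + ∑' j : ℤ, B (ε * j - -(ε * t)) (ε ^ 3 * t) ^ 2) + 2 * (MA + MB) := by
      refine (div_le_div_of_nonneg_right (hAB _ hT) h0.le).trans ?_
      rw [add_div]
      linarith
    have i2 := mul_le_mul_of_nonneg_left i1 (pow_nonneg h0.le 4)
    have i3 := mul_le_mul_of_nonneg_left iH
      (show 0 ≤ ε ^ 6 * (C₁ ^ 2 + C₂ ^ 2) by positivity)
    have i4 := mul_le_mul_of_nonneg_left hεN (pow_nonneg h0.le 3)
    have f1 : ε ^ 4 * (N / ε) = ε ^ 3 * N := by field_simp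
    have f2 : ε ^ 6 * (C₁ ^ 2 + C₂ ^ 2) * (2 * 1 * (MA + MB) / ε) =
        ε ^ 5 * ((C₁ ^ 2 + C₂ ^ 2) * (2 * (MA + MB))) := by field_simp
    rw [f1] at i2
    rw [f2] at i3
    have f3 : ε ^ 5 * ((C₁ ^ 2 + C₂ ^ 2) * (2 * (MA + MB))) ≤
        ε ^ 4 * ((C₁ ^ 2 + C₂ ^ 2) * (2 * (MA + MB))) :=
      mul_le_mul_of_nonneg_right (pow_le_pow_of_le_one h0.le hε1.2.le (by norm_num))
        (by positivity)
    have f4 : ε ^ 3 * (ε * D) = ε ^ 4 * (2 * (MA + MB))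
        + ε ^ 4 * ((C₁ ^ 2 + C₂ ^ 2) * (2 * (MA + MB))) := by rw [hD]; ring
    rw [f4] at i4
    linarith
  refine (ENNReal.inv_le_inv.mpr hle).trans (le_of_eq ?_)
  simp only
  rw [← ENNReal.ofReal_inv_of_pos hpos, mul_inv, Real.rpow_neg h0.le,
    abs_of_pos (by positivity)]

end KdVPair

end

/-! ### From the hypotheses to the estimates -/

section

theorem isIterWeakDeriv_zero (n : ℕ) : IsIterWeakDeriv n (fun _ => 0) (fun _ => 0) := by
  have h0 : LocallyIntegrable (fun _ : ℝ => (0 : ℝ)) := locallyIntegrable_const 0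
  induction n with
  | zero => exact ⟨h0, ae_eq_refl _⟩
  | succ n ih => exact ⟨_, ih, h0, h0, fun φ _ _ => by simp⟩

theorem sobolevNorm_zero (n r : ℕ) : sobolevNorm n r (fun _ => 0) = 0 := by
  refine le_antisymm (iInf₂_le_of_le (fun _ => 0) (isIterWeakDeriv_zero n) ?_) zero_le
  simp

theorem WaveBounds.eq_zero_of_integral_sq {T₀ : ℝ} {v : ℝ → ℝ → ℝ} {M : ℝ} {h : ℝ → ℝ → ℝ}
    (H : WaveBounds T₀ v M h) {T : ℝ} (hT : T ∈ Icc (-T₀) T₀) (h0 : ∫ x, v x T ^ 2 = 0) :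
    (fun x => v x T) = fun _ => 0 := by
  have hc : Continuous (fun x => v x T) := by
    simpa only [WaveBounds.jet_zero] using H.continuous_jet hT (k := 0) (by norm_num)
  have h1 := (integral_eq_zero_iff_of_nonneg (fun x => sq_nonneg (v x T))
    (H.integrable_sq T hT)).mp h0
  have h2 := ((hc.pow 2).ae_eq_iff_eq volume (continuous_const (y := (0 : ℝ)))).mp h1
  funext x
  exact pow_eq_zero_iff two_ne_zero |>.mp (congrFun h2 x)

theorem hasDerivWithinAt_timeJet {T₀ κ c : ℝ} {v : ℝ → ℝ → ℝ} {x T : ℝ}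
    (hc : ContDiff ℝ 3 (fun y => v y T))
    (hd : DifferentiableWithinAt ℝ (fun s => v x s) (Icc (-T₀) T₀) T)
    (he : 2 * slowDeriv T₀ (fun s => v x s) T = κ * (c * iteratedDeriv 3 (fun y => v y T) x
      + deriv (fun y => v y T ^ 2) x)) :
    HasDerivWithinAt (fun s => v x s) (timeJet κ c v 0 x T) (Icc (-T₀) T₀) T := by
  refine hd.hasDerivWithinAt.congr_deriv ?_
  have h1 := ((hc.differentiable (by norm_num) x).hasDerivAt.pow 2).deriv
  have h2 : deriv (fun y => v y T ^ 2) x = 2 * (v x T * deriv (fun y => v y T) x) := by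
    refine h1.trans ?_
    push_cast
    ring
  rw [h2] at he
  simp only [slowDeriv] at he
  simp only [timeJet, jet, iteratedDeriv_zero, iteratedDeriv_one]
  linear_combination he / 2

variable {σ T₀ : ℝ} {A B : ℝ → ℝ → ℝ}

theorem TransparentFPUT.IsGoodKdV.exists_kdVPair (h : IsGoodKdV σ T₀ A B) (hT₀ : 0 < T₀) :
    ∃ MA MB hA hB, KdVPair (1 / 12 + 2 * σ ^ 2) T₀ A B MA MB hA hB := by
  set S := ⨆ T ∈ Icc (-T₀) T₀,
    (sobolevNorm 7 1 (fun w => A w T) + sobolevNorm 7 1 (fun l => B l T)) with hS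
  have hlt : S < ENNReal.ofReal (S.toReal + 1) := by
    rw [ENNReal.ofReal_add ENNReal.toReal_nonneg zero_le_one, ENNReal.ofReal_toReal h.bounded.ne,
      ENNReal.ofReal_one]
    exact ENNReal.lt_add_right h.bounded.ne one_ne_zero
  have hle : ∀ T ∈ Icc (-T₀) T₀,
      sobolevNorm 7 1 (fun w => A w T) + sobolevNorm 7 1 (fun l => B l T) ≤ S :=
    fun T hT => le_iSup₂ (f := fun T (_ : T ∈ Icc (-T₀) T₀) =>
      sobolevNorm 7 1 (fun w => A w T) + sobolevNorm 7 1 (fun l => B l T)) T hT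
  have hK : 0 < S.toReal + 1 := by positivity
  obtain ⟨MA, hA, wA⟩ := exists_waveBounds hK (fun T hT => (h.kdvA T hT).1.continuous)
    fun T hT => (le_self_add.trans (hle T hT)).trans_lt hlt
  obtain ⟨MB, hB, wB⟩ := exists_waveBounds hK (fun T hT => (h.kdvB T hT).1.continuous)
    fun T hT => (le_add_self.trans (hle T hT)).trans_lt hlt
  refine ⟨MA, MB, hA, hB, hT₀, wA, wB, fun T hT x => ?_, fun T hT x => ?_⟩
  · obtain ⟨hc, hx⟩ := h.kdvA T hT
    exact hasDerivWithinAt_timeJet hc (hx x).1 (by linear_combination (hx x).2)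
  · obtain ⟨hc, hx⟩ := h.kdvB T hT
    exact hasDerivWithinAt_timeJet hc (hx x).1 (by linear_combination (hx x).2)

/-- The energy is constant in time. If it vanished, both waves would vanish identically on the time
interval, against nontriviality. -/
theorem TransparentFPUT.IsGoodKdV.exists_energy_le (h : IsGoodKdV σ T₀ A B) {MA MB : ℝ}
    {hA hB : ℝ → ℝ → ℝ} (K : KdVPair (1 / 12 + 2 * σ ^ 2) T₀ A B MA MB hA hB) :
    ∃ N > 0, ∀ T ∈ Icc (-T₀) T₀, N ≤ (∫ x, A x T ^ 2) + ∫ x, B x T ^ 2 := by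
  have h0 : (0 : ℝ) ∈ Icc (-T₀) T₀ := ⟨by linarith [K.pos], K.pos.le⟩
  have eA := fun T (hT : T ∈ Icc (-T₀) T₀) => K.boundsA.integral_sq_eq K.eqA hT h0
  have eB := fun T (hT : T ∈ Icc (-T₀) T₀) => K.boundsB.integral_sq_eq K.eqB hT h0
  refine ⟨(∫ x, A x 0 ^ 2) + ∫ x, B x 0 ^ 2, ?_, fun T hT => by rw [eA T hT, eB T hT]⟩
  have nA : 0 ≤ ∫ x, A x 0 ^ 2 := integral_nonneg fun x => sq_nonneg _
  have nB : 0 ≤ ∫ x, B x 0 ^ 2 := integral_nonneg fun x => sq_nonneg _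
  by_contra hN
  have zA : ∫ x, A x 0 ^ 2 = 0 := by linarith
  have zB : ∫ x, B x 0 ^ 2 = 0 := by linarith
  refine h.nontrivial.ne' ?_
  refine le_antisymm (iSup₂_le fun T hT => ?_) zero_le
  rw [K.boundsA.eq_zero_of_integral_sq hT ((eA T hT).trans zA),
    K.boundsB.eq_zero_of_integral_sq hT ((eB T hT).trans zB), sobolevNorm_zero, add_zero]

variable {ζ : ℤ → ℝ} {γ₁ γ₂ : ℝ → ℤ → ℝ}

theorem le_mass {a : ℝ} (h : ∀ j, |ζ j| ≤ a) (j : ℤ) : 1 - 4 * a ≤ mass ζ j := by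
  have h0 := abs_le.mp (h j)
  have h1 := abs_le.mp (h (j + 1))
  have h2 := abs_le.mp (h (j - 1))
  simp only [mass, deltaPlus, deltaMinus, add_sub_cancel_right]
  linarith

theorem environment_of_isAutoregressive {a : ℝ} (ha : a < 1 / 4) (h : ∀ j, |ζ j| ≤ a)
    (h₁ : ∀ ε ∈ Ioo (0 : ℝ) 1, IsAutoregressive₁ ε ζ (γ₁ ε))
    (h₂ : ∀ ε ∈ Ioo (0 : ℝ) 1, IsAutoregressive₂ σ ε ζ (γ₂ ε)) : Environment σ ζ γ₁ γ₂ where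
  noise_le j := (h j).trans ha.le
  mass_pos := ⟨1 - 4 * a, by linarith, le_mass h⟩
  ar₁ := h₁
  ar₂ := h₂
  bd₁ := by
    have hb : ∀ j, |ζ j + ζ (j + 1)| ≤ 1 := fun j => (abs_add_le _ _).trans (by
      linarith [h j, h (j + 1)])
    refine ⟨2 * 1, by norm_num, fun ε hε j => ?_⟩
    have := (isTwoSidedAR_of_isAutoregressive₁ hε (h₁ ε hε)).abs_le hε.1 hb j
    rw [abs_mul, abs_of_pos hε.1]
    rwa [le_div_iff₀ hε.1, mul_comm] at this
  bd₂ := by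
    have hb : ∀ j, |ζ (j + 1) + ζ (j + 1 - 1) + ζ (j + 1) * deltaPlus (deltaMinus ζ) (j + 1)
        + 2 * σ ^ 2| ≤ 1 + 2 * σ ^ 2 := fun j => by
      have b0 := abs_le.mp (h j)
      have b1 := abs_le.mp (h (j + 1))
      have b2 := abs_le.mp (h (j + 1 + 1))
      simp only [deltaPlus, deltaMinus, add_sub_cancel_right]
      have hp : |ζ (j + 1) * (ζ (j + 1 + 1) - ζ (j + 1) - (ζ (j + 1) - ζ j))| ≤ 1 / 4 * 1 := by
        rw [abs_mul]
        refine mul_le_mul (by linarith [h (j + 1)]) ?_ (abs_nonneg _) (by norm_num)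
        rw [abs_le]
        constructor <;> linarith
      have hp' := abs_le.mp hp
      rw [abs_le]
      constructor <;> nlinarith [sq_nonneg σ]
    refine ⟨2 * (1 + 2 * σ ^ 2), by positivity, fun ε hε j => ?_⟩
    have := (isTwoSidedAR_of_isAutoregressive₂ hε (h₂ ε hε)).abs_le hε.1 hb j
    rw [abs_mul, abs_of_pos hε.1]
    rwa [le_div_iff₀ hε.1, mul_comm] at this

/-- Moving to a neighbouring site shifts `εj` by `ε ≤ 1` and changes the weight by a factor of at
most `3`; the summand `1` is absorbed because `|ln ε|/ε ≥ 1` for `ε < 1/2`. -/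
theorem exists_arWeight_sq_le (hT₀ : 0 < T₀)
    (h₁ : ∀ ε ∈ Ioo (0 : ℝ) 1, IsAutoregressive₁ ε ζ (γ₁ ε))
    (h₂ : ∀ ε ∈ Ioo (0 : ℝ) 1, IsAutoregressive₂ σ ε ζ (γ₂ ε))
    (c₁ : ControlledSums (fun j => ζ j + ζ (j + 1)))
    (c₂ : ControlledSums (fun j => ζ (j + 1) + ζ (j + 1 - 1)
        + ζ (j + 1) * deltaPlus (deltaMinus ζ) (j + 1) + 2 * σ ^ 2)) :
    ∃ C, 0 ≤ C ∧ ∀ ε ∈ Ioo (0 : ℝ) (1 / 2), ∀ s, |s| ≤ T₀ / ε ^ 2 → ∀ j : ℤ,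
      arWeight γ₁ γ₂ ε j ^ 2 ≤ C * (|Real.log ε| / ε) * (1 + (ε * j - s) ^ 2) := by
  obtain ⟨C₁, hC₁0, hC₁⟩ := IsTwoSidedAR.exists_sq_le c₁
    (fun ε hε => isTwoSidedAR_of_isAutoregressive₁ hε (h₁ ε hε)) hT₀
  obtain ⟨C₂, hC₂0, hC₂⟩ := IsTwoSidedAR.exists_sq_le c₂
    (fun ε hε => isTwoSidedAR_of_isAutoregressive₂ hε (h₂ ε hε)) hT₀
  refine ⟨5 * (1 + 4 * C₁ + 4 * C₂), by positivity, fun ε hε s hs j => ?_⟩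
  have hε0 := hε.1
  have hL : 1 ≤ |Real.log ε| / ε := by
    rw [one_le_div hε0, abs_of_nonpos (Real.log_nonpos hε0.le (by linarith [hε.2]))]
    have h1 := Real.log_le_log hε0 hε.2.le
    rw [one_div, Real.log_inv] at h1
    linarith [Real.log_two_gt_d9, hε.2]
  set L := |Real.log ε| / ε
  have hshift : ∀ r : ℝ, |r| ≤ 1 → 1 + (ε * j + r - s) ^ 2 ≤ 3 * (1 + (ε * j - s) ^ 2) :=
    fun r hr => by
      have := (abs_le.mp hr)
      nlinarith [sq_nonneg (ε * j - s - r)]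
  have g1 := hC₁ ε hε s hs j
  have g2 := hC₁ ε hε s hs (j + 1)
  have g3 := hC₂ ε hε s hs j
  have g4 := hC₂ ε hε s hs (j - 1)
  have e2 : ε * ((j + 1 : ℤ) : ℝ) - s = ε * j + ε - s := by push_cast; ring
  have e4 : ε * ((j - 1 : ℤ) : ℝ) - s = ε * j + -ε - s := by push_cast; ring
  have hεa : |ε| ≤ 1 := by rw [abs_of_pos hε0]; linarith [hε.2]
  rw [e2] at g2
  rw [e4] at g4
  have b2 := mul_le_mul_of_nonneg_left (hshift ε hεa) (show 0 ≤ C₁ * L by positivity)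
  have b4 := mul_le_mul_of_nonneg_left (hshift (-ε) (by rwa [abs_neg]))
    (show 0 ≤ C₂ * L by positivity)
  have b0 : 1 ≤ L * (1 + (ε * j - s) ^ 2) := one_le_mul_of_one_le_of_one_le hL
    (by linarith [sq_nonneg (ε * j - s)])
  have hsq : arWeight γ₁ γ₂ ε j ^ 2 ≤ 5 * (1 + γ₁ ε j ^ 2 + γ₁ ε (j + 1) ^ 2 + γ₂ ε j ^ 2
      + γ₂ ε (j - 1) ^ 2) := by
    rw [← sq_abs (γ₁ ε j), ← sq_abs (γ₁ ε (j + 1)), ← sq_abs (γ₂ ε j), ← sq_abs (γ₂ ε (j - 1))]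
    simp only [arWeight]
    generalize |γ₁ ε j| = a
    generalize |γ₁ ε (j + 1)| = b
    generalize |γ₂ ε j| = c
    generalize |γ₂ ε (j - 1)| = d
    linarith [sq_nonneg (1 - a), sq_nonneg (1 - b), sq_nonneg (1 - c), sq_nonneg (1 - d),
      sq_nonneg (a - b), sq_nonneg (a - c), sq_nonneg (a - d), sq_nonneg (b - c),
      sq_nonneg (b - d), sq_nonneg (c - d)]
  linarith

theorem KdVPair.differentiableOn_qApprox {MA MB : ℝ} {hA hB : ℝ → ℝ → ℝ}
    (K : KdVPair (1 / 12 + 2 * σ ^ 2) T₀ A B MA MB hA hB)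
    (E : Environment σ ζ γ₁ γ₂) {ε : ℝ} (hε : ε ∈ Ioo (0 : ℝ) 1) (j : ℤ) :
    DifferentiableOn ℝ (qApprox σ T₀ A B ζ (γ₂ ε) ε j) (timeInterval T₀ ε) := fun t ht => by
  obtain ⟨R, -, hR⟩ := Pt.hasDerivWithinAt_qApprox K E
  exact (hR _ (onSite_mk hε ht j)).differentiableWithinAt

theorem KdVPair.differentiableOn_pApprox {MA MB : ℝ} {hA hB : ℝ → ℝ → ℝ}
    (K : KdVPair (1 / 12 + 2 * σ ^ 2) T₀ A B MA MB hA hB)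
    (E : Environment σ ζ γ₁ γ₂) {ε : ℝ} (hε : ε ∈ Ioo (0 : ℝ) 1) (j : ℤ) :
    DifferentiableOn ℝ (pApprox σ A B ζ (γ₁ ε) ε j) (timeInterval T₀ ε) := fun t ht => by
  obtain ⟨R, -, hR⟩ := Pt.hasDerivWithinAt_pApprox K E
  exact (hR _ (onSite_mk hε ht j)).differentiableWithinAt

end

end

theorem proposition5p1 {Ω : Type*} [MeasurableSpace Ω] (P : Measure Ω) [IsProbabilityMeasure P]
    (ζ : ℤ → Ω → ℝ) (σ : ℝ) (hζ : IsTransparentNoise P ζ σ)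
    (T₀ : ℝ) (hT₀ : 0 < T₀) (A B : ℝ → ℝ → ℝ) (hAB : IsGoodKdV σ T₀ A B)
    (γ₁ γ₂ : ℝ → Ω → ℤ → ℝ)
    (hγ₁ : ∀ᵐ ω ∂P, ∀ ε ∈ Ioo (0 : ℝ) 1, IsAutoregressive₁ ε (fun j => ζ j ω) (γ₁ ε ω))
    (hγ₂ : ∀ᵐ ω ∂P, ∀ ε ∈ Ioo (0 : ℝ) 1, IsAutoregressive₂ σ ε (fun j => ζ j ω) (γ₂ ε ω))
    (m : Ω → ℤ → ℝ) (hm : ∀ ω, m ω = mass (fun j => ζ j ω))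
    (q p : ℝ → Ω → ℤ → ℝ → ℝ)
    (hq : ∀ ε ω, q ε ω = qApprox σ T₀ A B (fun j => ζ j ω) (γ₂ ε ω) ε)
    (hp : ∀ ε ω, p ε ω = pApprox σ A B (fun j => ζ j ω) (γ₁ ε ω) ε) :
    ∀ᵐ ω ∂P,
      (∀ ε ∈ Ioo (0 : ℝ) 1, ∀ j, DifferentiableOn ℝ (q ε ω j) (timeInterval T₀ ε) ∧
        DifferentiableOn ℝ (p ε ω j) (timeInterval T₀ ε)) ∧
      IsBigOZero (fun ε => alpha₁ T₀ ε (q ε ω) (p ε ω)) (fun ε => ε ^ (3 / 2 : ℝ)) ∧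
      IsBigOZero (fun ε => alpha₂ T₀ ε (q ε ω)) (fun ε => ε ^ 3) ∧
      IsBigOZero (fun ε => alpha₃ T₀ ε (m ω) (q ε ω) (p ε ω))
        (fun ε => ε ^ 5 * Real.sqrt |Real.log ε|) ∧
      IsBigOZero (fun ε => (beta₁ T₀ ε (q ε ω) (p ε ω))⁻¹) (fun ε => ε ^ (-(3 / 2) : ℝ)) := by
  obtain ⟨MA, MB, hA, hB, K⟩ := hAB.exists_kdVPair hT₀
  obtain ⟨N, hN, hE⟩ := hAB.exists_energy_le K
  obtain ⟨a, ha, hae⟩ := hζ.ae_properties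
  -- From here on the realization is fixed and everything is deterministic; all constants may depend
  -- on it but not on `ε`.
  filter_upwards [hγ₁, hγ₂, hae] with ω h₁ h₂ ⟨hz, c₁, c₂⟩
  have E := environment_of_isAutoregressive (γ₁ := fun ε => γ₁ ε ω) (γ₂ := fun ε => γ₂ ε ω)
    ha hz h₁ h₂
  simp only [hq, hp, hm]
  exact ⟨fun ε hε j => ⟨K.differentiableOn_qApprox E hε j, K.differentiableOn_pApprox E hε j⟩,
    K.isBigOZero_alpha₁ E, K.isBigOZero_alpha₂ E,
    K.isBigOZero_alpha₃ E (exists_arWeight_sq_le hT₀ h₁ h₂ c₁ c₂),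
    K.isBigOZero_inv_beta₁ E hN hE⟩
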